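/- **Setting.** Fix $e\in[0,1)$ and $T>0$. Let $\mathbb R^2_{/}=\{(v,v_*)\in\mathbb R^2: v\ne v_*\}$ and $\sigma_e(r)=\frac{1-e}{4}r$. Let $\mathcal P(\mathbb R)$ be the Borel probability measures on $\mathbb R$ with narrow convergence, $\mathcal P_1(\mathbb R)$ those with finite first moment, and $\mathcal M(\mathbb R^2_{/})$ the finite signed Radon measures on $\mathbb R^2_{/}$. Write $\tilde\nabla\varphi(v,v_*)=\varphi'(v_*)-\varphi'(v)$. *Action density.* For $f\in\mathcal P(\mathbb R)$ and $U\in\mathcal M(\mathbb R^2_{/})$ let $\lambda=f\otimes f+|U|$ on $\mathbb R^2_{/}$ and $$\mathcal A(f,U)=\iint_{\mathbb R^2_{/}}\alpha\Big(\frac{d(f\otimes f)}{d\lambda},\frac{dU}{d\lambda}\Big)\,\sigma_e(|v-v_*|)\,d\lambda\in[0,\infty],$$ where $\alpha(s,u)=u^2/s$ if $s>0$, $\alpha(s,0)=0$, and $\alpha(0,u)=\infty$ if $u\neq0$. *Generalised continuity equation.* $(f_t,U_t)_{t\in[0,T]}\in\mathrm{GCE}_T$ means: $t\mapsto f_t\in\mathcal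 P(\mathbb R)$ is narrowly continuous on $[0,T]$, $t\mapsto U_t\in\mathcal M(\mathbb R^2_{/})$ is weak-$*$ measurable, $\int_0^T\iint\sigma_e(|v-v_*|)\,d|U_t|\,dt<\infty$, and for every $\varphi\in C^1_c((0,T)\times\mathbb R)$ $$\int_0^T\!\int_{\mathbb R}\partial_t\varphi_t\,df_t\,dt+\int_0^T\!\iint_{\mathbb R^2_{/}}\sigma_e(|v-v_*|)\,\tilde\nabla\varphi_t(v,v_*)\,dU_t(v,v_*)\,dt=0.$$ *Metric.* $d_{\mathcal A}(\mu_0,\mu_1)^2=\inf\big\{\int_0^1\mathcal A(f_t,U_t)\,dt:(f,U)\in\mathrm{GCE}_1,\ f_0=\mu_0,\ f_1=\mu_1\big\}\in[0,\infty]$. *Absolutely continuous curves.* For $p\in\{1,2\}$, $f\in AC^p(0,T;d_{\mathcal A})$ means that there is a nonnegative $m\in L^p(0,T)$ with $d_{\mathcal A}(f_{t_0},f_{t_1})\le\int_{t_0}^{t_1}m(t)\,dt$ for all $0<t_0\le t_1<T$. The metric derivative is $|f'|(t)=\lim_{h\to0}d_{\mathcal A}(f_{t+h},f_t)/|h|$.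 **Proposition (Metric velocity).** Let $\{f_t\}_{t\in[0,T]}\subset\mathcal P(\mathbb R)$. 1. Let $\{U_t\}$ be such that $(f_t,U_t)_{t\in[0,T]}\in\mathrm{GCE}_T$ and $\int_0^T\mathcal A(f_t,U_t)^{1/2}\,dt<\infty$. Then $f\in AC^1(0,T;d_{\mathcal A})$, and $f\in AC^2(0,T;d_{\mathcal A})$ if moreover $\int_0^T\mathcal A(f_t,U_t)\,dt<\infty$. There is a measurable $\hat U:[0,T]\times\mathbb R^2_{/}\to\mathbb R$ with $dU_t=\hat U_t\,d(f_t\otimes f_t)$ for a.e. $t$. For a.e. $t\in[0,T]$ the metric derivative exists and $|f'|^2(t)\le\mathcal A(f_t,U_t)$. 2. Suppose that $f_t\in\mathcal P_1(\mathbb R)$ for all $t\in[0,T]$ and that $t\mapsto f_t$ is narrowly continuous at the end points $t=0$ and $t=T$. Then - $f\in AC^1(0,T;d_{\mathcal A})$ if and only if there is $\{U_t\}$ with $(f_t,U_t)\in\mathrm{GCE}_T$ and $\int_0^T\mathcal A(f_t,U_t)^{1/2}\,dt<\infty$; - $f\in AC^2(0,T;d_{\mathcal A})$ if and only if there is $\{U_t\}$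 with $(f_t,U_t)\in\mathrm{GCE}_T$ and $\int_0^T\mathcal A(f_t,U_t)\,dt<\infty$; - if $f\in AC^1(0,T;d_{\mathcal A})$, there is a family $\{\tilde U_t\}$ with $(f_t,\tilde U_t)\in\mathrm{GCE}_T$ such that for a.e. $t\in[0,T]$ the metric derivative exists and $|f'|^2(t)=\mathcal A(f_t,\tilde U_t)$. It is unique up to a null set of times among all fluxes with these properties. Moreover $\int_0^T\mathcal A(f_t,\tilde U_t)^{1/2}\,dt<\infty$, and $\tilde U_t$ has a jointly measurable density with respect to $f_t\otimes f_t$ for a.e. $t$. -/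

import Mathlib

open MeasureTheory Filter Topology Set
open scoped ENNReal ZeroAtInfty

noncomputable section

namespace Collision

/-- The set of pairs `(v, v_*)` of distinct velocities. -/
abbrev OffDiag : Type := {p : ℝ × ℝ // p.1 ≠ p.2}

/-- The collision kernel `σ_e(r) = (1 - e) / 4 * r`, evaluated at a relative speed `r ≥ 0`. -/
def sigma (e r : ℝ) : ℝ := (1 - e) / 4 * r

/-- The weight `σ_e(|v - v_*|)` on pairs of distinct velocities. -/
def weight (e : ℝ) (p : OffDiag) : ℝ := sigma e |p.1.1 - p.1.2|

/-- The nonlocal-local gradient `φ'(v_*) - φ'(v)`. -/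
def nlGrad (φ : ℝ → ℝ) (p : OffDiag) : ℝ := deriv φ p.1.2 - deriv φ p.1.1

/-- The product measure `f ⊗ f`, restricted to pairs of distinct velocities. -/
def prodOff (f : ProbabilityMeasure ℝ) : Measure OffDiag :=
  ((f : Measure ℝ).prod (f : Measure ℝ)).comap Subtype.val

/-- The function `α(s, u)` for `s ≥ 0`: it is `u ^ 2 / s` if `s > 0`, it is `0` if `u = 0`, and it
is `∞` if `s = 0` and `u ≠ 0`. -/
def alpha (s u : ℝ) : ℝ≥0∞ :=
  if 0 < s then ENNReal.ofReal (u ^ 2 / s) else if u = 0 then 0 else ⊤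

/-- The reference measure `f ⊗ f + |U|`. -/
def refMeasure (f : ProbabilityMeasure ℝ) (U : SignedMeasure OffDiag) : Measure OffDiag :=
  prodOff f + U.totalVariation

/-- The action density `A(f, U)`. -/
def action (e : ℝ) (f : ProbabilityMeasure ℝ) (U : SignedMeasure OffDiag) : ℝ≥0∞ :=
  ∫⁻ p, alpha ((prodOff f).rnDeriv (refMeasure f U) p).toReal (U.rnDeriv (refMeasure f U) p)
    * ENNReal.ofReal (weight e p) ∂(refMeasure f U)

/-- Weak solutions of the generalised continuity equation on `[0, T]`. Curves are functions on `ℝ`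
of which only the values on `[0, T]` matter. Finite Radon measures on the pairs of distinct
velocities are signed measures. -/
structure IsWeakSolution (e T : ℝ) (f : ℝ → ProbabilityMeasure ℝ)
    (U : ℝ → SignedMeasure OffDiag) : Prop where
  measurable_curve : ∀ g : C₀(ℝ, ℝ), Measurable fun t : Icc (0 : ℝ) T =>
    ∫ v, g v ∂(f t : Measure ℝ)
  measurable_flux : ∀ g : C₀(OffDiag, ℝ), Measurable fun t : Icc (0 : ℝ) T =>
    ∫ᵛ p, g p ∂<•(U t)
  integrability : ∫⁻ t in Icc 0 T, ∫⁻ p, ENNReal.ofReal (weight e p) ∂(U t).totalVariation < ⊤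
  weak_form : ∀ φ : ℝ × ℝ → ℝ, ContDiff ℝ 1 φ → HasCompactSupport φ →
    tsupport φ ⊆ Ioo 0 T ×ˢ univ →
    (∫ t in Icc 0 T, ∫ v, deriv (fun s => φ (s, v)) t ∂(f t : Measure ℝ))
      + (∫ t in Icc 0 T, ∫ᵛ p, weight e p * nlGrad (fun v => φ (t, v)) p ∂<•(U t)) = 0

/-- The class `GCE_T`: weak solutions whose curve is its narrowly continuous representative
(the topology of `ProbabilityMeasure ℝ` is that of narrow convergence). -/
def GCE (e T : ℝ) (f : ℝ → ProbabilityMeasure ℝ) (U : ℝ → SignedMeasure OffDiag) : Prop :=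
  IsWeakSolution e T f U ∧ ContinuousOn f (Icc 0 T)

/-- The total action `∫_0^1 A(f_t, U_t) dt` of a solution on `[0, 1]` connecting `μ₀` to `μ₁`, as
a set of values. -/
def connectingActions (e : ℝ) (μ₀ μ₁ : ProbabilityMeasure ℝ) : Set ℝ≥0∞ :=
  {a | ∃ (f : ℝ → ProbabilityMeasure ℝ) (U : ℝ → SignedMeasure OffDiag),
    GCE e 1 f U ∧ f 0 = μ₀ ∧ f 1 = μ₁ ∧ a = ∫⁻ t in Icc (0 : ℝ) 1, action e (f t) (U t)}

/-- The collision transportation cost `d_A`, with value `∞` if no solution of finite action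
connects `μ₀` to `μ₁`. -/
def dA (e : ℝ) (μ₀ μ₁ : ProbabilityMeasure ℝ) : ℝ≥0∞ :=
  (sInf (connectingActions e μ₀ μ₁)) ^ (1 / 2 : ℝ)

/-- `p`-absolutely continuous curves on `(0, T)` with respect to `d_A`. -/
def IsAC (e : ℝ) (p : ℝ≥0∞) (T : ℝ) (f : ℝ → ProbabilityMeasure ℝ) : Prop :=
  ∃ m : ℝ → ℝ, (∀ t, 0 ≤ m t) ∧ MemLp m p (volume.restrict (Ioo 0 T)) ∧
    ∀ t₀ t₁ : ℝ, 0 < t₀ → t₀ ≤ t₁ → t₁ < T →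
      dA e (f t₀) (f t₁) ≤ ENNReal.ofReal (∫ t in t₀..t₁, m t)

/-- The metric derivative `|f'|(t)`, the limit of `d_A(f_{t+h}, f_t) / |h|` as `h → 0`, exists and
equals `r`. -/
def HasMetricDeriv (e : ℝ) (f : ℝ → ProbabilityMeasure ℝ) (t : ℝ) (r : ℝ≥0∞) : Prop :=
  Tendsto (fun h : ℝ => dA e (f (t + h)) (f t) / ENNReal.ofReal |h|) (𝓝[≠] 0) (𝓝 r)

/-- The fluxes have a jointly measurable density with respect to `f_t ⊗ f_t`, for a.e. `t`. -/
def HasFluxDensity (T : ℝ) (f : ℝ → ProbabilityMeasure ℝ) (U : ℝ → SignedMeasure OffDiag) :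
    Prop :=
  ∃ Uhat : ℝ × OffDiag → ℝ, Measurable Uhat ∧ ∀ᵐ t ∂(volume.restrict (Icc 0 T)),
    Integrable (fun p => Uhat (t, p)) (prodOff (f t)) ∧
      U t = (prodOff (f t)).withDensityᵥ (fun p => Uhat (t, p))

end Collision

end

noncomputable section

namespace Collision

/-! ### Pairs of distinct velocities, and products along a curve as kernels -/

section

open ProbabilityTheory

/-! The action is a Benamou–Brenier functional, quadratic in the density of the flux with respect to
`f ⊗ f`. The proof moves between curves with fluxes and the cost `dA` through the notion
`IsDensitySolution`: the flux has a jointly measurable density `u`, and the continuity equation is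
integrated in time against observables `ψ(v)`. `exists_density_of_GCE` and `IsDensitySolution.gce`
translate from and to `GCE`. The passage to densities rests on the fact that finite action forces
the flux to be absolutely continuous with respect to `f_t ⊗ f_t`, and on Radon–Nikodym derivatives
that are measurable in a parameter.

From flux to curve. Reparametrising a solution to almost constant speed turns action into squared
length, so `dA` is at most the integral of the square root of the action (`dA_le_length`). Reversal
and concatenation make `dA` a pseudometric with values in `[0, ∞]`. The classical argument with the
functions `d(f_q, f_t)`, `q` rational, then gives the metric derivative as the least integrable
bound for the increments (`exists_metricDeriv`), and in particular `|f'|² ≤ A`.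

From curve to flux. For finite first moment the energy of a flux controls its weighted mass, hence
the moments and all Lipschitz observables along a competitor (`totalMass_le`). Therefore the
quantity `energy e (f t) (nlGrad ψ)` hardly changes along a short competitor, and Cauchy–Schwarz
yields `|d/dt ∫ ψ df_t| ≤ |f'|(t) · energy(∇ψ)^(1/2)` with the sharp constant 1
(`exists_sq_integral_sub_le`, `IsACCurve.abs_deriv_le`). With this bound, time derivatives of
observables define a bounded functional on gradients in an `L²` space over `f_t ⊗ f_t dt`, and Riesz
representation produces one flux for all observables (`exists_flux_of_deriv_bound`). As `n = |f'|`
is only integrable, time is weighted by `n + 1`; the resulting bound is `∫ E/(n+1) ≤ ∫ n²/(n+1)`,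
where `E` is the energy of the flux. The first half of the theorem gives `E ≥ n²`, so equality holds
at almost every time.

The kernel weight degenerates at the diagonal, so finite energy alone does not make the flux a
finite measure. The flux found by Riesz lies in the closure of gradients, and there a weighted
Poincaré inequality (`exists_lintegral_nlGrad_sq_le`) bounds the unweighted `L²` norm.

Uniqueness is strict convexity: the average of two optimal fluxes solves the same equation, so its
energy is at least `n²`, and the parallelogram identity makes the difference vanish. -/

theorem measurableSet_offDiag : MeasurableSet {p : ℝ × ℝ | p.1 ≠ p.2} :=
  (measurableSet_eq_fun measurable_fst measurable_snd).compl

theorem isOpen_offDiag : IsOpen {p : ℝ × ℝ | p.1 ≠ p.2} :=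
  isOpen_ne_fun continuous_fst continuous_snd

instance : LocallyCompactSpace OffDiag := isOpen_offDiag.locallyCompactSpace

instance : MeasurableSpace.CountablyGenerated OffDiag := inferInstance

theorem continuous_weight (e : ℝ) : Continuous (weight e) := by
  unfold weight sigma; fun_prop

theorem measurable_weight (e : ℝ) : Measurable (weight e) := (continuous_weight e).measurable

theorem weight_pos {e : ℝ} (he : e < 1) (p : OffDiag) : 0 < weight e p := by
  have h := abs_pos.2 (sub_ne_zero.2 p.2)
  unfold weight sigma
  have : 0 < 1 - e := by linarith
  positivity

theorem weight_nonneg {e : ℝ} (he : e < 1) (p : OffDiag) : 0 ≤ weight e p := (weight_pos he p).le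

theorem weight_le {e : ℝ} (he₀ : 0 ≤ e) (he : e < 1) (p : OffDiag) :
    weight e p ≤ |p.1.1| + |p.1.2| := by
  unfold weight sigma
  have h1 := abs_sub p.1.1 p.1.2
  have h2 : (1 - e) / 4 ≤ 1 := by linarith
  have h3 : 0 ≤ (1 - e) / 4 := by linarith
  nlinarith [abs_nonneg (p.1.1 - p.1.2)]

instance (f : ProbabilityMeasure ℝ) : IsFiniteMeasure (prodOff f) := by
  unfold prodOff; infer_instance

theorem prodOff_univ_le (f : ProbabilityMeasure ℝ) : prodOff f univ ≤ 1 := by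
  have h := MeasurableEmbedding.comap_apply (MeasurableEmbedding.subtype_coe measurableSet_offDiag)
    ((f : Measure ℝ).prod (f : Measure ℝ)) univ
  exact h.le.trans prob_le_one

theorem lintegral_prodOff (f : ProbabilityMeasure ℝ) (h : ℝ × ℝ → ℝ≥0∞) :
    ∫⁻ p, h p.1 ∂prodOff f
      = ∫⁻ p in {p : ℝ × ℝ | p.1 ≠ p.2}, h p ∂((f : Measure ℝ).prod (f : Measure ℝ)) :=
  lintegral_subtype_comap measurableSet_offDiag h

theorem lintegral_prodOff_le (f : ProbabilityMeasure ℝ) (h : ℝ × ℝ → ℝ≥0∞) :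
    ∫⁻ p, h p.1 ∂prodOff f ≤ ∫⁻ p, h p ∂((f : Measure ℝ).prod (f : Measure ℝ)) := by
  rw [lintegral_prodOff]; exact setLIntegral_le_lintegral _ _

theorem integral_prodOff (f : ProbabilityMeasure ℝ) (h : ℝ × ℝ → ℝ) (h0 : ∀ v, h (v, v) = 0) :
    ∫ p, h p.1 ∂prodOff f = ∫ p, h p ∂((f : Measure ℝ).prod (f : Measure ℝ)) := by
  refine (integral_subtype_comap measurableSet_offDiag h).trans ?_
  apply setIntegral_eq_integral_of_forall_compl_eq_zero
  rintro ⟨a, b⟩ hab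
  simp only [mem_ofPred_eq, not_not] at hab
  subst hab; exact h0 a

/-- Closed sets form a generating π-system, and the mass of a closed set is a limit of integrals of
bounded continuous functions, which are continuous in `t`. -/
theorem measurable_probabilityMeasure {f : ℝ → ProbabilityMeasure ℝ} (hf : Continuous f) :
    Measurable fun t => (f t : Measure ℝ) := by
  refine Measurable.measure_of_isPiSystem_of_isProbabilityMeasure
    (S := {s : Set ℝ | IsClosed s})
    (BorelSpace.measurable_eq.trans borel_eq_generateFrom_isClosed) isPiSystem_isClosed fun s hs => ?_
  refine measurable_of_tendsto_metrizable (f := fun n t =>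
    ∫⁻ x, (IsClosed.apprSeq hs n x : ℝ≥0∞) ∂(f t : Measure ℝ)) (fun n => ?_) ?_
  · exact ((ProbabilityMeasure.continuous_lintegral_boundedContinuousFunction _).comp hf).measurable
  · exact tendsto_pi_nhds.2 fun t => HasOuterApproxClosed.tendsto_lintegral_apprSeq hs _

/-- A narrowly continuous curve as a transition kernel. -/
def curveKernel (f : ℝ → ProbabilityMeasure ℝ) (hf : Continuous f) : Kernel ℝ ℝ :=
  ⟨fun t => (f t : Measure ℝ), measurable_probabilityMeasure hf⟩

instance (f : ℝ → ProbabilityMeasure ℝ) (hf : Continuous f) : IsMarkovKernel (curveKernel f hf) :=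
  ⟨fun t => inferInstanceAs (IsProbabilityMeasure (f t : Measure ℝ))⟩

/-- The products `f_t ⊗ f_t` off the diagonal as a transition kernel. -/
def pairKernel (f : ℝ → ProbabilityMeasure ℝ) (hf : Continuous f) : Kernel ℝ OffDiag :=
  (curveKernel f hf ×ₖ curveKernel f hf).comapRight
    (MeasurableEmbedding.subtype_coe measurableSet_offDiag)

@[simp]
theorem pairKernel_apply (f : ℝ → ProbabilityMeasure ℝ) (hf : Continuous f) (t : ℝ) :
    pairKernel f hf t = prodOff (f t) := by
  rw [pairKernel, Kernel.comapRight_apply, Kernel.prod_apply]; rfl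

instance (f : ℝ → ProbabilityMeasure ℝ) (hf : Continuous f) : IsFiniteKernel (pairKernel f hf) :=
  ⟨1, ENNReal.one_lt_top, fun t => by rw [pairKernel_apply]; exact prodOff_univ_le _⟩

theorem measurable_lintegral_prodOff {f : ℝ → ProbabilityMeasure ℝ} (hf : Continuous f)
    {h : ℝ × OffDiag → ℝ≥0∞} (hh : Measurable h) :
    Measurable fun t => ∫⁻ p, h (t, p) ∂prodOff (f t) := by
  have := Measurable.lintegral_kernel_prod_right (κ := pairKernel f hf)
    (f := fun t p => h (t, p)) hh
  simpa using this

theorem measurable_integral_prodOff {f : ℝ → ProbabilityMeasure ℝ} (hf : Continuous f)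
    {h : ℝ × OffDiag → ℝ} (hh : Measurable h) :
    Measurable fun t => ∫ p, h (t, p) ∂prodOff (f t) := by
  have := StronglyMeasurable.integral_kernel_prod_right (κ := pairKernel f hf)
    (f := fun t p => h (t, p)) hh.stronglyMeasurable
  simpa using this.measurable

theorem measurableSet_integrable_prodOff {f : ℝ → ProbabilityMeasure ℝ} (hf : Continuous f)
    {h : ℝ × OffDiag → ℝ} (hh : Measurable h) :
    MeasurableSet {t | Integrable (fun p => h (t, p)) (prodOff (f t))} := by
  have := measurableSet_kernel_integrable (κ := pairKernel f hf)
    (f := fun t p => h (t, p)) hh.stronglyMeasurable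
  simpa using this

/-! ### Integration against signed measures with a density -/

section Vector

variable {X : Type*} [MeasurableSpace X]

/-- Only `g * u` has to be integrable: `g` may be unbounded, as the weighted gradient is. The
integral splits along the positive and negative parts of `u`. -/
theorem integral_withDensityᵥ {μ : Measure X} {u g : X → ℝ} (hu : Integrable u μ)
    (hum : Measurable u) (hg : Measurable g) (hgu : Integrable (fun x => g x * u x) μ) :
    ∫ᵛ x, g x ∂<•(μ.withDensityᵥ u) = ∫ x, g x * u x ∂μ := by
  have hfin1 : IsFiniteMeasure (μ.withDensity fun x => ENNReal.ofReal (u x)) :=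
    isFiniteMeasure_withDensity_ofReal hu.2
  have hfin2 : IsFiniteMeasure (μ.withDensity fun x => ENNReal.ofReal (-u x)) :=
    isFiniteMeasure_withDensity_ofReal hu.neg.2
  have e1 : ∀ x, (ENNReal.ofReal (u x)).toReal • g x = max (u x) 0 * g x := fun x => by
    rw [ENNReal.toReal_ofReal', smul_eq_mul]
  have e2 : ∀ x, (ENNReal.ofReal (-u x)).toReal • g x = max (-u x) 0 * g x := fun x => by
    rw [ENNReal.toReal_ofReal', smul_eq_mul]
  have i1' : Integrable (fun x => max (u x) 0 * g x) μ := by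
    refine hgu.mono ((by fun_prop : Measurable _).aestronglyMeasurable) (ae_of_all _ fun x => ?_)
    rw [norm_mul, norm_mul, mul_comm]
    gcongr
    rw [Real.norm_eq_abs, Real.norm_eq_abs]
    rcases le_total 0 (u x) with h | h <;> simp [h]
  have i2' : Integrable (fun x => max (-u x) 0 * g x) μ := by
    refine hgu.mono ((by fun_prop : Measurable _).aestronglyMeasurable) (ae_of_all _ fun x => ?_)
    rw [norm_mul, norm_mul, mul_comm]
    gcongr
    rw [Real.norm_eq_abs, Real.norm_eq_abs]
    rcases le_total 0 (u x) with h | h <;> simp [h]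
  have i1 : Integrable g (μ.withDensity fun x => ENNReal.ofReal (u x)) := by
    rw [integrable_withDensity_iff_integrable_smul' (by fun_prop)
      (ae_of_all _ fun _ => ENNReal.ofReal_lt_top)]
    simpa only [e1] using i1'
  have i2 : Integrable g (μ.withDensity fun x => ENNReal.ofReal (-u x)) := by
    rw [integrable_withDensity_iff_integrable_smul' (by fun_prop)
      (ae_of_all _ fun _ => ENNReal.ofReal_lt_top)]
    simpa only [e2] using i2'
  rw [withDensityᵥ_eq_withDensity_pos_part_sub_withDensity_neg_part hu,
    VectorMeasure.integral_sub_vectorMeasure, VectorMeasure.integral_toSignedMeasure,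
    VectorMeasure.integral_toSignedMeasure,
    integral_withDensity_eq_integral_toReal_smul (by fun_prop)
      (ae_of_all _ fun _ => ENNReal.ofReal_lt_top),
    integral_withDensity_eq_integral_toReal_smul (by fun_prop)
      (ae_of_all _ fun _ => ENNReal.ofReal_lt_top)]
  · simp only [e1, e2]
    rw [← integral_sub i1' i2']
    congr with x
    rcases le_total 0 (u x) with h | h <;> simp [h] <;> ring
  · simpa [VectorMeasure.Integrable, Measure.variation_toSignedMeasure] using i1
  · simpa [VectorMeasure.Integrable, Measure.variation_toSignedMeasure] using i2

theorem totalVariation_withDensityᵥ {μ : Measure X} {u : X → ℝ} (hu : Integrable u μ) :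
    SignedMeasure.totalVariation (μ.withDensityᵥ u) = μ.withDensity fun x => ‖u x‖ₑ := by
  rw [SignedMeasure.totalVariation_eq_variation, Measure.variation_withDensityᵥ hu]

end Vector

end

/-- The action of the flux with density `u` with respect to `f ⊗ f`. -/
def energy (e : ℝ) (f : ProbabilityMeasure ℝ) (u : OffDiag → ℝ) : ℝ≥0∞ :=
  ∫⁻ p, ENNReal.ofReal (weight e p * u p ^ 2) ∂prodOff f

/-! ### Fluxes of finite action -/

instance (f : ProbabilityMeasure ℝ) (U : SignedMeasure OffDiag) :
    IsFiniteMeasure (refMeasure f U) := by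
  unfold refMeasure; infer_instance

theorem prodOff_ac_refMeasure (f : ProbabilityMeasure ℝ) (U : SignedMeasure OffDiag) :
    prodOff f ≪ refMeasure f U :=
  Measure.AbsolutelyContinuous.rfl.add_right _

theorem withDensityᵥ_rnDeriv_of_ac {X : Type*} [MeasurableSpace X] {U : SignedMeasure X}
    {μ : Measure X} [SigmaFinite μ] (h : U.totalVariation ≪ μ) :
    μ.withDensityᵥ (U.rnDeriv μ) = U := by
  refine SignedMeasure.withDensityᵥ_rnDeriv_eq U μ ?_
  rw [SignedMeasure.absolutelyContinuous_ennreal_iff]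
  have h' : μ.toENNRealVectorMeasure.ennrealToMeasure = μ := VectorMeasure.equivMeasure.right_inv μ
  rwa [h']

theorem withDensityᵥ_rnDeriv_refMeasure (f : ProbabilityMeasure ℝ) (U : SignedMeasure OffDiag) :
    (refMeasure f U).withDensityᵥ (U.rnDeriv (refMeasure f U)) = U := by
  apply withDensityᵥ_rnDeriv_of_ac
  unfold refMeasure
  rw [add_comm]
  exact Measure.AbsolutelyContinuous.rfl.add_right _

/-- With `a` the density of `f ⊗ f` relative to the reference measure, the flux has density `a * u`
relative to it, and `α(a, a u) = a u²`. Multiplication by `a` is undone by changing back to `f ⊗ f`.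
-/
theorem action_withDensityᵥ (e : ℝ) (f : ProbabilityMeasure ℝ) {u : OffDiag → ℝ}
    (hu : Integrable u (prodOff f)) (hum : Measurable u) :
    action e f ((prodOff f).withDensityᵥ u) = energy e f u := by
  set U := (prodOff f).withDensityᵥ u with hU
  set ρ := refMeasure f U with hρ
  have hac : prodOff f ≪ ρ := prodOff_ac_refMeasure f U
  have h1 := withDensityᵥ_rnDeriv_smul hac hu
  have h2 : (fun x => ((prodOff f).rnDeriv ρ x).toReal • u x) =ᵐ[ρ]
      SignedMeasure.rnDeriv U ρ := by
    refine SignedMeasure.eq_rnDeriv 0 _ ((integrable_rnDeriv_smul_iff hac).mpr hu) ?_ ?_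
    · exact VectorMeasure.MutuallySingular.zero_left
    · rw [h1, zero_add]
  have h3 : energy e f u
      = ∫⁻ p, (prodOff f).rnDeriv ρ p * ENNReal.ofReal (weight e p * u p ^ 2) ∂ρ := by
    rw [lintegral_rnDeriv_mul hac]
    · rfl
    · have := measurable_weight e
      fun_prop
  rw [h3, action]
  refine lintegral_congr_ae ?_
  filter_upwards [h2, Measure.rnDeriv_lt_top (prodOff f) ρ] with p hp hp'
  rw [← hp]
  rw [← ENNReal.ofReal_toReal hp'.ne]
  set a := ((prodOff f).rnDeriv ρ p).toReal with ha
  have ha0 : 0 ≤ a := ENNReal.toReal_nonneg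
  rw [ENNReal.toReal_ofReal ha0]
  rcases ha0.eq_or_lt with h | h
  · simp [← h, alpha]
  · rw [alpha, if_pos h, smul_eq_mul, show (a * u p) ^ 2 / a = a * u p ^ 2 by field_simp,
      ENNReal.ofReal_mul ha0, mul_assoc, mul_comm (weight e p),
      ENNReal.ofReal_mul (sq_nonneg _)]

/-- Without integrability only an inequality survives, because `withDensityᵥ` is then the zero
measure by convention. In this form no exceptional set of times has to be carried along. -/
theorem action_withDensityᵥ_le (e : ℝ) (f : ProbabilityMeasure ℝ) {u : OffDiag → ℝ}
    (hum : Measurable u) :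
    action e f ((prodOff f).withDensityᵥ u) ≤ energy e f u := by
  by_cases hu : Integrable u (prodOff f)
  · exact (action_withDensityᵥ e f hu hum).le
  · have h0 : (prodOff f).withDensityᵥ u = (prodOff f).withDensityᵥ (0 : OffDiag → ℝ) := by
      rw [withDensityᵥ_zero, Measure.withDensityᵥ, dif_neg hu]
    rw [h0, action_withDensityᵥ e f (integrable_zero _ _ _) measurable_zero]
    simp [energy]

/-- Where the density of `f ⊗ f` vanishes, `α` is infinite unless the density of `U` vanishes too.
The weight is strictly positive off the diagonal, so it cannot hide the infinite value. -/
theorem totalVariation_ac_of_action_lt_top {e : ℝ} (he : e < 1) {f : ProbabilityMeasure ℝ}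
    {U : SignedMeasure OffDiag} (hm : Measurable fun p =>
      alpha ((prodOff f).rnDeriv (refMeasure f U) p).toReal (U.rnDeriv (refMeasure f U) p)
        * ENNReal.ofReal (weight e p)) (h : action e f U < ⊤) :
    U.totalVariation ≪ prodOff f := by
  set ρ := refMeasure f U with hρ
  have hac : prodOff f ≪ ρ := prodOff_ac_refMeasure f U
  have hU := withDensityᵥ_rnDeriv_refMeasure f U
  have hb : Integrable (U.rnDeriv ρ) ρ := SignedMeasure.integrable_rnDeriv U ρ
  have hTV : U.totalVariation = ρ.withDensity fun x => ‖U.rnDeriv ρ x‖ₑ := by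
    conv_lhs => rw [← hU]
    exact totalVariation_withDensityᵥ hb
  refine Measure.AbsolutelyContinuous.mk fun N hN hN0 => ?_
  rw [hTV, withDensity_apply _ hN, lintegral_eq_zero_iff (by fun_prop)]
  have h1 : ∫⁻ p in N, (prodOff f).rnDeriv ρ p ∂ρ = 0 := by
    rw [Measure.setLIntegral_rnDeriv hac, hN0]
  rw [lintegral_eq_zero_iff (by fun_prop)] at h1
  have h2 := ae_restrict_of_ae (s := N) (ae_lt_top hm h.ne)
  filter_upwards [h1, h2] with p hp1 hp2
  by_contra hne
  have hb0 : U.rnDeriv ρ p ≠ 0 := by simpa using hne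
  have hp1' : (prodOff f).rnDeriv ρ p = 0 := hp1
  rw [hp1'] at hp2
  simp only [ENNReal.toReal_zero, alpha, lt_irrefl, if_false, hb0] at hp2
  rw [ENNReal.top_mul (by simpa using weight_pos he p)] at hp2
  exact lt_irrefl _ hp2

theorem measurable_alpha : Measurable fun q : ℝ × ℝ => alpha q.1 q.2 := by
  unfold alpha
  refine Measurable.ite (measurableSet_lt measurable_const measurable_fst) (by fun_prop) ?_
  exact Measurable.ite (measurable_snd (measurableSet_singleton 0)) (by fun_prop) (by fun_prop)

theorem eq_withDensityᵥ_of_action_lt_top {e : ℝ} (he : e < 1) {f : ProbabilityMeasure ℝ}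
    {U : SignedMeasure OffDiag} (h : action e f U < ⊤) :
    (prodOff f).withDensityᵥ (U.rnDeriv (prodOff f)) = U := by
  refine withDensityᵥ_rnDeriv_of_ac (totalVariation_ac_of_action_lt_top he ?_ h)
  refine Measurable.mul ?_ (measurable_weight e).ennreal_ofReal
  exact measurable_alpha.comp ((Measure.measurable_rnDeriv _ _).ennreal_toReal.prodMk
    (SignedMeasure.measurable_rnDeriv _ _))

/-! ### Radon–Nikodym derivatives depending measurably on a parameter -/

section

open ProbabilityTheory

section Flux

variable {X S : Type*} [MeasurableSpace X] [MeasurableSpace S]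

theorem integral_signedMeasure (U : SignedMeasure X) {g : X → ℝ} (hg : Measurable g) {C : ℝ}
    (hC : ∀ x, ‖g x‖ ≤ C) :
    ∫ᵛ x, g x ∂<•U = ∫ x, g x ∂U.toJordanDecomposition.posPart
      - ∫ x, g x ∂U.toJordanDecomposition.negPart := by
  conv_lhs => rw [← U.toSignedMeasure_toJordanDecomposition]
  rw [JordanDecomposition.toSignedMeasure, VectorMeasure.integral_sub_vectorMeasure,
    VectorMeasure.integral_toSignedMeasure, VectorMeasure.integral_toSignedMeasure]
  · rw [VectorMeasure.Integrable, Measure.variation_toSignedMeasure]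
    exact Integrable.of_bound hg.aestronglyMeasurable C (ae_of_all _ hC)
  · rw [VectorMeasure.Integrable, Measure.variation_toSignedMeasure]
    exact Integrable.of_bound hg.aestronglyMeasurable C (ae_of_all _ hC)

theorem tendsto_integral_signedMeasure (U : SignedMeasure X) {g : ℕ → X → ℝ} {g' : X → ℝ}
    (hg : ∀ n, Measurable (g n)) {C : ℝ} (hC : ∀ n x, ‖g n x‖ ≤ C)
    (hlim : ∀ x, Tendsto (fun n => g n x) atTop (𝓝 (g' x))) :
    Tendsto (fun n => ∫ᵛ x, g n x ∂<•U) atTop (𝓝 (∫ᵛ x, g' x ∂<•U)) := by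
  have hg' : Measurable g' := measurable_of_tendsto_metrizable hg (tendsto_pi_nhds.2 hlim)
  have hC' : ∀ x, ‖g' x‖ ≤ C := fun x =>
    le_of_tendsto (hlim x).norm (Eventually.of_forall fun n => hC n x)
  simp_rw [integral_signedMeasure U (hg _) (hC _), integral_signedMeasure U hg' hC']
  refine Tendsto.sub ?_ ?_ <;>
  exact tendsto_integral_of_dominated_convergence (fun _ => C)
    (fun n => (hg n).aestronglyMeasurable) (integrable_const C)
    (fun n => ae_of_all _ (hC n)) (ae_of_all _ hlim)

theorem integral_signedMeasure_indicator (U : SignedMeasure X) {B : Set X}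
    (hB : MeasurableSet B) : ∫ᵛ x, B.indicator (fun _ => (1 : ℝ)) x ∂<•U = U B := by
  rw [integral_signedMeasure U (measurable_const.indicator hB) (C := 1),
    integral_indicator hB, integral_indicator hB, U.apply_eq_posPart_real_sub_negPart_real hB]
  · simp
  · intro x
    by_cases hx : x ∈ B <;> simp [hx]

/-- A Hahn set realises the positive part, and it can be approximated in total variation by members
of a generating algebra. When the algebra is countable this exhibits the positive part as a
countable supremum of values of `U`. -/
theorem posPart_eq_iSup (U : SignedMeasure X) {𝒜 : Set (Set X)} (hA : IsSetAlgebra 𝒜)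
    (hgen : ‹MeasurableSpace X› = MeasurableSpace.generateFrom 𝒜) {B : Set X}
    (hB : MeasurableSet B) :
    U.toJordanDecomposition.posPart B = ⨆ A : 𝒜, ENNReal.ofReal (U ((A : Set X) ∩ B)) := by
  have hAm : ∀ A ∈ 𝒜, MeasurableSet A := fun A h => by
    rw [hgen]; exact MeasurableSpace.measurableSet_generateFrom h
  have hval : ∀ A, MeasurableSet A → ENNReal.ofReal (U A)
      ≤ U.toJordanDecomposition.posPart A := fun A hA' => by
    rw [U.apply_eq_posPart_real_sub_negPart_real hA']
    refine ENNReal.ofReal_le_of_le_toReal ?_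
    have : 0 ≤ U.toJordanDecomposition.negPart.real A := measureReal_nonneg
    have h2 : U.toJordanDecomposition.posPart.real A =
      (U.toJordanDecomposition.posPart A).toReal := rfl
    linarith
  refine le_antisymm ?_ (iSup_le fun A => (hval _ ((hAm A A.2).inter hB)).trans
    (measure_mono inter_subset_right))
  obtain ⟨P, hP, hpos, hneg, hpp, hnp⟩ := U.toJordanDecomposition_spec
  have hPB : U.toJordanDecomposition.posPart B = ENNReal.ofReal (U (P ∩ B)) := by
    rw [hpp, U.toMeasureOfZeroLE_apply hpos hP hB, ENNReal.ofReal_eq_coe_nnreal]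
  have hd := Measure.MeasureDense.of_generateFrom_isSetAlgebra_finite U.totalVariation hA hgen
  rw [hPB]
  refine ENNReal.le_of_forall_pos_le_add fun ε hε _ => ?_
  obtain ⟨A, hA1, hA2⟩ := hd.approx P hP (measure_ne_top _ _) ε hε
  have hAB := hAm A hA1
  have key : U (P ∩ B) - U (A ∩ B) ≤ ε := by
    have e1 : U (P ∩ B) = U (P ∩ B ∩ A) + U ((P ∩ B) \ A) := by
      rw [← VectorMeasure.of_union _ ((hP.inter hB).inter hAB) ((hP.inter hB).diff hAB),
        inter_union_sdiff]
      exact (disjoint_sdiff_inter).symm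
    have e2 : U (A ∩ B) = U (P ∩ B ∩ A) + U ((A ∩ B) \ P) := by
      rw [← VectorMeasure.of_union _ ((hP.inter hB).inter hAB) ((hAB.inter hB).diff hP)]
      · congr 1; ext x; simp only [mem_inter_iff, mem_union, Set.mem_sdiff]; tauto
      · rw [Set.disjoint_left]; rintro x ⟨⟨h1, _⟩, _⟩ ⟨_, h2⟩; exact h2 h1
    have b1 := U.norm_le_totalVariation ((P ∩ B) \ A)
    have b2 := U.norm_le_totalVariation ((A ∩ B) \ P)
    have b3 : U.totalVariation.real ((P ∩ B) \ A) + U.totalVariation.real ((A ∩ B) \ P)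
        ≤ U.totalVariation.real (symmDiff P A) := by
      rw [← measureReal_union]
      · refine measureReal_mono ?_
        rintro x (⟨⟨h1, _⟩, h2⟩ | ⟨⟨h1, _⟩, h2⟩)
        · exact Or.inl ⟨h1, h2⟩
        · exact Or.inr ⟨h1, h2⟩
      · rw [Set.disjoint_left]; rintro x ⟨⟨h1, _⟩, h2⟩ ⟨⟨h3, _⟩, _⟩; exact h2 h3
      · exact (hAB.inter hB).diff hP
    have b4 : U.totalVariation.real (symmDiff P A) ≤ ε := by
      refine ENNReal.toReal_le_of_le_ofReal ε.2 hA2.le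
    rw [Real.norm_eq_abs] at b1 b2
    have := abs_le.1 b1
    have := abs_le.1 b2
    linarith
  calc ENNReal.ofReal (U (P ∩ B)) ≤ ENNReal.ofReal (U (A ∩ B) + ε) :=
        ENNReal.ofReal_le_ofReal (by linarith)
    _ ≤ ENNReal.ofReal (U (A ∩ B)) + ENNReal.ofReal ε := ENNReal.ofReal_add_le
    _ ≤ _ := by
      rw [ENNReal.ofReal_coe_nnreal]
      gcongr
      exact le_iSup (fun A : 𝒜 => ENNReal.ofReal (U ((A : Set X) ∩ B))) ⟨A, hA1⟩

variable [MeasurableSpace.CountablyGenerated X]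

theorem measurable_posPart {U : S → SignedMeasure X}
    (hU : ∀ B, MeasurableSet B → Measurable fun s => U s B) :
    Measurable fun s => (U s).toJordanDecomposition.posPart := by
  refine Measure.measurable_of_measurable_coe _ fun B hB => ?_
  set 𝒜 := generateSetAlgebra (MeasurableSpace.countableGeneratingSet X)
  have hA : IsSetAlgebra 𝒜 := isSetAlgebra_generateSetAlgebra
  have hgen : ‹MeasurableSpace X› = MeasurableSpace.generateFrom 𝒜 := by
    rw [generateFrom_generateSetAlgebra_eq, MeasurableSpace.generateFrom_countableGeneratingSet]
  have hc : Countable 𝒜 :=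
    (countable_generateSetAlgebra (MeasurableSpace.countable_countableGeneratingSet)).to_subtype
  simp_rw [posPart_eq_iSup _ hA hgen hB]
  refine Measurable.iSup fun A => ENNReal.measurable_ofReal.comp (hU _ (MeasurableSet.inter ?_ hB))
  rw [hgen]; exact MeasurableSpace.measurableSet_generateFrom A.2

theorem measurable_negPart {U : S → SignedMeasure X}
    (hU : ∀ B, MeasurableSet B → Measurable fun s => U s B) :
    Measurable fun s => (U s).toJordanDecomposition.negPart := by
  have h := measurable_posPart (U := fun s => -U s) fun B hB => (hU B hB).neg
  simpa [SignedMeasure.toJordanDecomposition_neg] using h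

/-- A measurable family of finite measures, rescaled to total mass at most one. -/
def normalizedKernel (ν : S → Measure X) (hν : Measurable ν) : Kernel S X :=
  ⟨fun s => (1 + ν s univ)⁻¹ • ν s, by
    refine Measure.measurable_of_measurable_coe _ fun B hB => ?_
    simp only [Measure.smul_apply, smul_eq_mul]
    exact ((measurable_const.add (Measure.measurable_coe MeasurableSet.univ |>.comp hν)).inv).mul
      ((Measure.measurable_coe hB).comp hν)⟩

instance (ν : S → Measure X) (hν : Measurable ν) [∀ s, IsFiniteMeasure (ν s)] :
    IsFiniteKernel (normalizedKernel ν hν) := by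
  refine ⟨1, ENNReal.one_lt_top, fun s => ?_⟩
  change (1 + ν s univ)⁻¹ * ν s univ ≤ 1
  rw [mul_comm, ← div_eq_mul_inv]
  refine ENNReal.div_le_of_le_mul ?_
  rw [one_mul]; exact le_add_self

/-- Kernel derivatives require a uniform bound on the masses, which a family of finite measures need
not have. The family is therefore rescaled, and the factor `1 + ν s univ` is put back into the
derivative. -/
theorem exists_measurable_rnDeriv {ν : S → Measure X} (hν : Measurable ν)
    [∀ s, IsFiniteMeasure (ν s)] (η : Kernel S X) [IsFiniteKernel η] :
    ∃ h : S × X → ℝ≥0∞, Measurable h ∧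
      ∀ s, (fun x => h (s, x)) =ᵐ[η s] (ν s).rnDeriv (η s) := by
  refine ⟨fun q => (1 + ν q.1 univ) * Kernel.rnDeriv (normalizedKernel ν hν) η q.1 q.2,
    ?_, fun s => ?_⟩
  · refine Measurable.mul ?_ (Kernel.measurable_rnDeriv _ _)
    exact measurable_const.add ((Measure.measurable_coe MeasurableSet.univ).comp
      (hν.comp measurable_fst))
  · have h0 : (1 + ν s univ) ≠ 0 := by simp
    have h1 : (1 + ν s univ) ≠ ⊤ := ENNReal.add_ne_top.2 ⟨ENNReal.one_ne_top, measure_ne_top _ _⟩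
    have h2 : (1 + ν s univ)⁻¹ ≠ ⊤ := ENNReal.inv_ne_top.2 h0
    have e1 := Kernel.rnDeriv_eq_rnDeriv_measure (κ := normalizedKernel ν hν) (η := η) (a := s)
    have e2 := Measure.rnDeriv_smul_left_of_ne_top (ν s) (η s) h2
    filter_upwards [e1, e2] with x hx1 hx2
    rw [hx1]
    have hx3 : ((normalizedKernel ν hν) s).rnDeriv (η s) x
      = ((1 + ν s univ)⁻¹ • (ν s).rnDeriv (η s)) x := hx2
    rw [hx3, Pi.smul_apply, smul_eq_mul, ← mul_assoc, ENNReal.mul_inv_cancel h0 h1, one_mul]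

theorem measurableSet_ac {ν : S → Measure X} (hν : Measurable ν)
    [∀ s, IsFiniteMeasure (ν s)] (η : Kernel S X) [IsFiniteKernel η] :
    MeasurableSet {s | ν s ≪ η s} := by
  have h := Kernel.measurableSet_absolutelyContinuous (normalizedKernel ν hν) η
  convert h using 3 with s
  have h0 : (1 + ν s univ)⁻¹ ≠ 0 := ENNReal.inv_ne_zero.2 (by simp)
  refine ⟨fun h => ?_, fun h => ?_⟩
  · exact (Measure.AbsolutelyContinuous.smul_left h _ : (1 + ν s univ)⁻¹ • ν s ≪ η s)
  · exact (Measure.absolutelyContinuous_smul h0).trans h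

theorem exists_measurable_signed_rnDeriv {U : S → SignedMeasure X}
    (hU : ∀ B, MeasurableSet B → Measurable fun s => U s B) (η : Kernel S X) [IsFiniteKernel η] :
    ∃ h : S × X → ℝ, Measurable h ∧
      ∀ s, (fun x => h (s, x)) =ᵐ[η s] (U s).rnDeriv (η s) := by
  obtain ⟨h1, hm1, he1⟩ := exists_measurable_rnDeriv (measurable_posPart hU) η
  obtain ⟨h2, hm2, he2⟩ := exists_measurable_rnDeriv (measurable_negPart hU) η
  refine ⟨fun q => (h1 q).toReal - (h2 q).toReal, by fun_prop, fun s => ?_⟩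
  filter_upwards [he1 s, he2 s] with x hx1 hx2
  rw [hx1, hx2]; rfl

end Flux

/-- Weak-* measurability extends from functions to sets: the indicator of an open set is a pointwise
limit of compactly supported bumps, and a π-λ argument covers all Borel sets. -/
theorem measurable_flux_apply {S : Type*} [MeasurableSpace S] {U : S → SignedMeasure OffDiag}
    (hU : ∀ g : C₀(OffDiag, ℝ), Measurable fun s => ∫ᵛ p, g p ∂<•(U s)) :
    ∀ B, MeasurableSet B → Measurable fun s => U s B := by
  have hopen : ∀ O : Set OffDiag, IsOpen O → Measurable fun s => U s O := by
    intro O hO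
    obtain ⟨F, hFc, hFO, hFU, hFm⟩ := hO.exists_iUnion_isClosed
    set K : CompactExhaustion OffDiag := default
    have hg : ∀ n, ∃ g : C(OffDiag, ℝ), EqOn g 1 (K n ∩ F n) ∧ EqOn g 0 Oᶜ ∧
        HasCompactSupport g ∧ ∀ x, g x ∈ Icc (0 : ℝ) 1 := fun n =>
      exists_continuous_one_zero_of_isCompact ((K.isCompact n).inter_right (hFc n))
        hO.isClosed_compl (disjoint_compl_right_iff_subset.2 (inter_subset_right.trans (hFO n)))
    choose g hg1 hg0 hgc hgI using hg
    refine measurable_of_tendsto_metrizable (f := fun n s => ∫ᵛ p, g n p ∂<•(U s))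
      (fun n => hU ⟨g n, (hgc n).is_zero_at_infty⟩) (tendsto_pi_nhds.2 fun s => ?_)
    rw [← integral_signedMeasure_indicator (U s) hO.measurableSet]
    refine tendsto_integral_signedMeasure (U s) (fun n => (g n).continuous.measurable) (C := 1)
      (fun n x => ?_) fun x => ?_
    · rw [Real.norm_eq_abs, abs_le]
      exact ⟨by linarith [(hgI n x).1], (hgI n x).2⟩
    · by_cases hx : x ∈ O
      · obtain ⟨k, hk⟩ := K.exists_mem x
        obtain ⟨m, hm⟩ := mem_iUnion.1 (hFU.symm ▸ hx : x ∈ ⋃ n, F n)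
        rw [indicator_of_mem hx]
        refine tendsto_const_nhds.congr' ?_
        filter_upwards [eventually_ge_atTop k, eventually_ge_atTop m] with n hn1 hn2
        exact (hg1 n ⟨K.subset hn1 hk, hFm hn2 hm⟩).symm
      · rw [indicator_of_notMem hx]
        refine tendsto_const_nhds.congr fun n => ?_
        exact (hg0 n hx).symm
  have huniv := hopen univ isOpen_univ
  refine MeasurableSpace.induction_on_inter (s := {O : Set OffDiag | IsOpen O})
    (BorelSpace.measurable_eq) isPiSystem_isOpen ?_ (fun O hO => hopen O hO) ?_ ?_
  · simp
  · intro B hB h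
    have : ∀ s, U s Bᶜ = U s univ - U s B := fun s => by
      rw [← VectorMeasure.of_add_of_sdiff hB MeasurableSet.univ (subset_univ B),
        compl_eq_univ_sdiff]; ring
    simp_rw [this]
    exact huniv.sub h
  · intro B hd hB h
    refine measurable_of_tendsto_metrizable (f := fun n s => ∑ i ∈ Finset.range n, U s (B i))
      (fun n => Finset.measurable_fun_sum _ fun i _ => h i) (tendsto_pi_nhds.2 fun s => ?_)
    exact (VectorMeasure.hasSum_of_disjoint_iUnion hB hd).tendsto_sum_nat

/-! ### Joint measurability of the flux density -/

section Action

variable {f : ℝ → ProbabilityMeasure ℝ} {U : ℝ → SignedMeasure OffDiag}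

/-- The action equals the energy of the chosen density on the measurable set of times at which the
flux is absolutely continuous, and is infinite at all other times. -/
theorem exists_flux_density {e : ℝ} (he : e < 1) (hf : Continuous f)
    (hU : ∀ B, MeasurableSet B → Measurable fun t => U t B) :
    Measurable (fun t => action e (f t) (U t)) ∧
      ∃ u : ℝ × OffDiag → ℝ, Measurable u ∧ ∀ t, action e (f t) (U t) < ⊤ →
        Integrable (fun p => u (t, p)) (prodOff (f t)) ∧
          U t = (prodOff (f t)).withDensityᵥ fun p => u (t, p) := by
  obtain ⟨u, hum, hu⟩ := exists_measurable_signed_rnDeriv hU (pairKernel f hf)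
  simp_rw [pairKernel_apply] at hu
  have hint : ∀ t, Integrable (fun p => u (t, p)) (prodOff (f t)) := fun t =>
    (SignedMeasure.integrable_rnDeriv (U t) (prodOff (f t))).congr (hu t).symm
  have hrep : ∀ t, (prodOff (f t)).withDensityᵥ ((U t).rnDeriv (prodOff (f t))) =
      (prodOff (f t)).withDensityᵥ fun p => u (t, p) := fun t =>
    (WithDensityᵥEq.congr_ae (hu t)).symm
  have hTV : Measurable fun t => (U t).totalVariation := by
    refine Measure.measurable_of_measurable_coe _ fun B hB => ?_
    exact ((Measure.measurable_coe hB).comp (measurable_posPart hU)).add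
      ((Measure.measurable_coe hB).comp (measurable_negPart hU))
  have hac := measurableSet_ac hTV (pairKernel f hf)
  simp_rw [pairKernel_apply] at hac
  refine ⟨?_, u, hum, fun t ht => ⟨hint t, ?_⟩⟩
  · classical
    have : (fun t => action e (f t) (U t)) = fun t =>
        if (U t).totalVariation ≪ prodOff (f t) then energy e (f t) (fun p => u (t, p)) else ⊤ := by
      funext t
      split_ifs with h
      · rw [← action_withDensityᵥ e (f t) (hint t) (by fun_prop), ← hrep,
          withDensityᵥ_rnDeriv_of_ac h]
      · by_contra hne
        have hlt := lt_top_iff_ne_top.2 hne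
        refine h (totalVariation_ac_of_action_lt_top he ?_ hlt)
        refine Measurable.mul ?_ (measurable_weight e).ennreal_ofReal
        exact measurable_alpha.comp ((Measure.measurable_rnDeriv _ _).ennreal_toReal.prodMk
          (SignedMeasure.measurable_rnDeriv _ _))
    rw [this]
    refine Measurable.ite hac ?_ measurable_const
    refine measurable_lintegral_prodOff hf (h := fun q => ENNReal.ofReal (weight e q.2 * u q ^ 2)) ?_
    have := measurable_weight e
    fun_prop
  · rw [← hrep, eq_withDensityᵥ_of_action_lt_top he ht]

end Action

end

/-! ### Weak derivatives in time -/

/-- For large `k` the derivative of the ramp is an approximate identity: it is nonnegative, has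
integral 1, and lives on `[s, s + 1/(k+1)]`. -/
theorem tendsto_integral_deriv_ramp {F : ℝ → ℝ} (hF : Continuous F) {T s : ℝ} (hs : s ∈ Ioo 0 T) :
    Tendsto (fun k : ℕ => ∫ r in 0..T,
      deriv (fun r => Real.smoothTransition ((k + 1) * (r - s))) r * F r) atTop (𝓝 (F s)) := by
  rw [Metric.tendsto_atTop]
  intro ε hε
  obtain ⟨δ, hδ, hFδ⟩ := Metric.continuous_iff.1 hF s (ε / 2) (half_pos hε)
  obtain ⟨N, hN⟩ := exists_nat_one_div_lt (lt_min hδ (sub_pos.2 hs.2))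
  refine ⟨N, fun k hk => ?_⟩
  set g : ℝ → ℝ := fun r => Real.smoothTransition ((k + 1) * (r - s)) with hg
  have hk0 : (0 : ℝ) < k + 1 := by positivity
  have hk1 : 1 / ((k : ℝ) + 1) < min δ (T - s) :=
    lt_of_le_of_lt (one_div_le_one_div_of_le (by positivity) (by
      have : (N : ℝ) ≤ k := by exact_mod_cast hk
      linarith)) hN
  have hgd : ContDiff ℝ 1 g := Real.smoothTransition.contDiff.comp (by fun_prop)
  have hgc : Continuous (deriv g) := hgd.continuous_deriv le_rfl
  have hgmono : Monotone g := fun x y hxy => Real.smoothTransition.monotone (by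
    have : x - s ≤ y - s := by linarith
    gcongr)
  have hg0 : ∀ r, 0 ≤ deriv g r := fun r => hgmono.deriv_nonneg
  have hI : ∫ r in 0..T, deriv g r = 1 := by
    rw [intervalIntegral.integral_deriv_eq_sub
      (fun x _ => (hgd.differentiable one_ne_zero) x) (hgc.intervalIntegrable _ _)]
    have h1 : g T = 1 := Real.smoothTransition.one_of_one_le (by
      have := hk1.trans_le (min_le_right _ _)
      rw [div_lt_iff₀ hk0] at this; linarith)
    have h0 : g 0 = 0 := Real.smoothTransition.zero_of_nonpos (by nlinarith [hs.1])
    rw [h1, h0, sub_zero]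
  have hout : ∀ r, δ ≤ |r - s| → deriv g r = 0 := by
    intro r hr
    rcases le_abs.1 hr with h | h
    · have : g =ᶠ[𝓝 r] fun _ => 1 := by
        filter_upwards [lt_mem_nhds (show s + 1 / ((k : ℝ) + 1) < r by
          have := hk1.trans_le (min_le_left _ _); linarith)] with x hx
        refine Real.smoothTransition.one_of_one_le ?_
        have : 1 / ((k : ℝ) + 1) ≤ x - s := by linarith
        rw [div_le_iff₀ hk0] at this; linarith
      rw [this.deriv_eq, deriv_const]
    · have : g =ᶠ[𝓝 r] fun _ => 0 := by
        filter_upwards [gt_mem_nhds (show r < s by linarith)] with x hx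
        refine Real.smoothTransition.zero_of_nonpos ?_
        nlinarith
      rw [this.deriv_eq, deriv_const]
  have hrew : (∫ r in 0..T, deriv g r * F r) - F s = ∫ r in 0..T, deriv g r * (F r - F s) := by
    simp_rw [mul_sub]
    have i1 : IntervalIntegrable (fun r => deriv g r * F r) volume 0 T :=
      (hgc.mul hF).intervalIntegrable _ _
    have i2 : IntervalIntegrable (fun r => deriv g r * F s) volume 0 T :=
      (hgc.mul continuous_const).intervalIntegrable _ _
    rw [intervalIntegral.integral_sub i1 i2, intervalIntegral.integral_mul_const, hI, one_mul]
  rw [Real.dist_eq, hrew, ← Real.norm_eq_abs]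
  have hT : 0 ≤ T := (hs.1.trans hs.2).le
  calc ‖∫ r in 0..T, deriv g r * (F r - F s)‖ ≤ ∫ r in 0..T, deriv g r * (ε / 2) := by
        refine intervalIntegral.norm_integral_le_of_norm_le hT (ae_of_all _ fun r _ => ?_)
          ((hgc.mul continuous_const).intervalIntegrable _ _)
        rw [norm_mul, Real.norm_eq_abs, abs_of_nonneg (hg0 r)]
        rcases lt_or_ge |r - s| δ with h | h
        · exact mul_le_mul_of_nonneg_left (hFδ r h).le (hg0 r)
        · rw [hout r h]; simp
    _ = ε / 2 := by rw [intervalIntegral.integral_mul_const, hI, one_mul]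
    _ < ε := half_lt_self hε

/-- A weak derivative in the sense of distributions on `(0, T)` yields the fundamental theorem of
calculus on `[0, T]`. -/
theorem sub_eq_integral_of_weak_deriv {F G : ℝ → ℝ} {T : ℝ} (hT : 0 < T) (hF : Continuous F)
    (hG : IntegrableOn G (Icc 0 T))
    (h : ∀ η : ℝ → ℝ, ContDiff ℝ 1 η → HasCompactSupport η → tsupport η ⊆ Ioo 0 T →
      (∫ t in Icc 0 T, deriv η t * F t) + (∫ t in Icc 0 T, η t * G t) = 0)
    {s t : ℝ} (hs : s ∈ Icc 0 T) (ht : t ∈ Icc 0 T) : F t - F s = ∫ r in s..t, G r := by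
  have hGi : ∀ a ∈ Icc 0 T, ∀ b ∈ Icc 0 T, IntervalIntegrable G volume a b := fun a ha b hb =>
    (hG.mono_set (uIcc_subset_Icc ha hb)).intervalIntegrable
  have hT0 : (0 : ℝ) ∈ Icc 0 T := ⟨le_rfl, hT.le⟩
  have hTT : T ∈ Icc 0 T := ⟨hT.le, le_rfl⟩
  have key : ∀ s ∈ Ioo 0 T, ∀ t ∈ Ioo 0 T, s < t → F t - F s = ∫ r in s..t, G r := by
    intro s hs t ht hst
    -- The difference of the ramps at `s` and `t` is a smooth version of the indicator of `(s, t]`.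
    -- It is supported in `[s, t + 1/(k+1)]`, thus inside `(0, T)` for large `k`.
    set g : ℕ → ℝ → ℝ → ℝ := fun k s r => Real.smoothTransition ((k + 1) * (r - s)) with hg
    have hgd : ∀ k s, ContDiff ℝ 1 (g k s) := fun k s =>
      Real.smoothTransition.contDiff.comp (by fun_prop)
    have hgc : ∀ k s, Continuous (deriv (g k s)) := fun k s => (hgd k s).continuous_deriv le_rfl
    have h1 := (tendsto_integral_deriv_ramp hF hs).sub (tendsto_integral_deriv_ramp hF ht)
    have hpos : ∀ k r, s < t → r ≤ s → g k s r - g k t r = 0 := fun k r hst hr => by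
      have hk0 : (0 : ℝ) < k + 1 := by positivity
      simp only [hg]
      rw [Real.smoothTransition.zero_of_nonpos (by nlinarith),
        Real.smoothTransition.zero_of_nonpos (by nlinarith), sub_zero]
    have h2 : Tendsto (fun k : ℕ => ∫ r in 0..T, (g k s r - g k t r) * G r) atTop
        (𝓝 (∫ r in 0..T, (Ioc s t).indicator G r)) := by
      refine intervalIntegral.tendsto_integral_filter_of_dominated_convergence
        (fun r => ‖G r‖) ?_ ?_ (hGi 0 hT0 T hTT).norm ?_
      · refine Eventually.of_forall fun k => ?_
        refine AEStronglyMeasurable.mul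
          (((hgd k s).continuous.sub (hgd k t).continuous).aestronglyMeasurable) ?_
        rw [uIoc_of_le hT.le]
        exact (hGi 0 hT0 T hTT).1.aestronglyMeasurable
      · refine Eventually.of_forall fun k => ae_of_all _ fun r _ => ?_
        rw [norm_mul]
        refine mul_le_of_le_one_left (norm_nonneg _) ?_
        rw [Real.norm_eq_abs, abs_le]
        have a1 := Real.smoothTransition.le_one (((k : ℝ) + 1) * (r - s))
        have a2 := Real.smoothTransition.nonneg (((k : ℝ) + 1) * (r - s))
        have a3 := Real.smoothTransition.le_one (((k : ℝ) + 1) * (r - t))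
        have a4 := Real.smoothTransition.nonneg (((k : ℝ) + 1) * (r - t))
        constructor <;> simp only [hg] <;> linarith
      · refine ae_of_all _ fun r _ => ?_
        rcases le_or_gt r s with hr | hr
        · rw [indicator_of_notMem (fun h => absurd h.1 (not_lt.2 hr))]
          simp_rw [hpos _ r hst hr, zero_mul]; exact tendsto_const_nhds
        · have e1 : ∀ x, x < r → ∀ᶠ k : ℕ in atTop, g k x r = 1 := fun x hx => by
            obtain ⟨N, hN⟩ := exists_nat_one_div_lt (sub_pos.2 hx)
            filter_upwards [eventually_ge_atTop N] with k hk
            refine Real.smoothTransition.one_of_one_le ?_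
            have hk' : (N : ℝ) ≤ k := by exact_mod_cast hk
            rw [div_lt_iff₀ (by positivity)] at hN
            nlinarith [sub_pos.2 hx]
          rcases le_or_gt r t with hr' | hr'
          · rw [indicator_of_mem (show r ∈ Ioc s t from ⟨hr, hr'⟩)]
            refine tendsto_const_nhds.congr' ?_
            filter_upwards [e1 s hr] with k hk
            rw [hk]
            simp only [hg]
            rw [Real.smoothTransition.zero_of_nonpos, sub_zero, one_mul]
            have : (0 : ℝ) < k + 1 := by positivity
            nlinarith
          · rw [indicator_of_notMem (fun h => absurd h.2 (not_le.2 hr'))]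
            refine tendsto_const_nhds.congr' ?_
            filter_upwards [e1 s hr, e1 t hr'] with k hk hk'
            rw [hk, hk']; simp
    have h3 : ∫ r in 0..T, (Ioc s t).indicator G r = ∫ r in s..t, G r := by
      rw [intervalIntegral.integral_of_le hT.le, setIntegral_indicator measurableSet_Ioc,
        intervalIntegral.integral_of_le hst.le,
        inter_eq_right.2 (Ioc_subset_Ioc hs.1.le ht.2.le)]
    rw [h3] at h2
    have h4 : ∀ᶠ k : ℕ in atTop, ((∫ r in 0..T, deriv (g k s) r * F r)
        - ∫ r in 0..T, deriv (g k t) r * F r) + (∫ r in 0..T, (g k s r - g k t r) * G r) = 0 := by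
      obtain ⟨N, hN⟩ := exists_nat_one_div_lt (sub_pos.2 ht.2)
      filter_upwards [eventually_ge_atTop N] with k hk
      have hk' : (N : ℝ) ≤ k := by exact_mod_cast hk
      have hk0 : (0 : ℝ) < k + 1 := by positivity
      have hk1 : 1 / ((k : ℝ) + 1) < T - t :=
        (one_div_le_one_div_of_le (by positivity) (by linarith)).trans_lt hN
      have hsupp : Function.support (fun r => g k s r - g k t r)
          ⊆ Icc s (t + 1 / ((k : ℝ) + 1)) := by
        intro r hr
        by_contra hmem
        refine hr ?_
        rcases lt_or_ge r s with h | h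
        · exact hpos k r hst h.le
        · have h' : t + 1 / ((k : ℝ) + 1) < r := by
            by_contra hc; exact hmem ⟨h, not_lt.1 hc⟩
          have h5 : 1 / ((k : ℝ) + 1) ≤ r - t := by linarith
          rw [div_le_iff₀ hk0] at h5
          simp only [hg]
          rw [Real.smoothTransition.one_of_one_le (by nlinarith),
            Real.smoothTransition.one_of_one_le (by nlinarith), sub_self]
      have hts : tsupport (fun r => g k s r - g k t r) ⊆ Icc s (t + 1 / ((k : ℝ) + 1)) :=
        closure_minimal hsupp isClosed_Icc
      have h5 := h (fun r => g k s r - g k t r) ((hgd k s).sub (hgd k t))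
        (HasCompactSupport.of_support_subset_isCompact isCompact_Icc hsupp)
        (hts.trans fun r hr => ⟨hs.1.trans_le hr.1, by linarith [hr.2]⟩)
      rw [integral_Icc_eq_integral_Ioc, integral_Icc_eq_integral_Ioc,
        ← intervalIntegral.integral_of_le hT.le, ← intervalIntegral.integral_of_le hT.le] at h5
      have i1 : IntervalIntegrable (fun r => deriv (g k s) r * F r) volume 0 T :=
        ((hgc k s).mul hF).intervalIntegrable _ _
      have i2 : IntervalIntegrable (fun r => deriv (g k t) r * F r) volume 0 T :=
        ((hgc k t).mul hF).intervalIntegrable _ _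
      rw [← intervalIntegral.integral_sub i1 i2]
      refine Eq.trans ?_ h5
      congr 1
      refine intervalIntegral.integral_congr fun r _ => ?_
      rw [deriv_fun_sub ((hgd k s).differentiable one_ne_zero r)
        ((hgd k t).differentiable one_ne_zero r), sub_mul]
    have h6 := (h1.add h2).congr' h4
    have := tendsto_nhds_unique h6 tendsto_const_nhds
    linarith
  -- `F` minus the primitive of `G` is constant on the open interval and continuous on the closed
  -- one, so the end points are covered.
  have hprim : ContinuousOn (fun x => F x - ∫ r in 0..x, G r) (Icc 0 T) := by
    refine hF.continuousOn.sub ?_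
    have := intervalIntegral.continuousOn_primitive_interval (a := 0) (b := T) (f := G)
      (μ := volume) (by rwa [uIcc_of_le hT.le])
    rwa [uIcc_of_le hT.le] at this
  have hsplit : ∀ a ∈ Icc 0 T, ∀ b ∈ Icc 0 T,
      (∫ r in 0..b, G r) - (∫ r in 0..a, G r) = ∫ r in a..b, G r := fun a ha b hb =>
    intervalIntegral.integral_interval_sub_left (hGi 0 hT0 b hb) (hGi 0 hT0 a ha)
  have hIoo : ∀ a ∈ Ioo 0 T, ∀ b ∈ Ioo 0 T,
      F a - ∫ r in 0..a, G r = F b - ∫ r in 0..b, G r := by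
    intro a ha b hb
    have := hsplit a (Ioo_subset_Icc_self ha) b (Ioo_subset_Icc_self hb)
    rcases lt_trichotomy a b with hab | hab | hab
    · have := key a ha b hb hab; linarith
    · rw [hab]
    · have := key b hb a ha hab
      rw [intervalIntegral.integral_symm] at this; linarith
  have hmid : T / 2 ∈ Ioo 0 T := ⟨by linarith, by linarith⟩
  have hconst : EqOn (fun x => F x - ∫ r in 0..x, G r)
      (fun _ => F (T / 2) - ∫ r in 0..(T / 2), G r) (Icc 0 T) := by
    refine EqOn.of_subset_closure (s := Ioo 0 T) (fun x hx => hIoo x hx _ hmid) hprim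
      continuousOn_const Ioo_subset_Icc_self ?_
    rw [closure_Ioo hT.ne]
  have e1 := hconst hs
  have e2 := hconst ht
  have e3 := hsplit s hs t ht
  simp only at e1 e2
  linarith

/-- A function whose increments are locally of smaller order than those of `N` is constant. -/
theorem eq_of_increments_le {R N : ℝ → ℝ} {a b : ℝ} (hab : a ≤ b)
    (h : ∀ ε > 0, ∃ δ > 0, ∀ s t, a ≤ s → s ≤ t → t ≤ b → t - s < δ →
      |R t - R s| ≤ ε * (N t - N s)) : R a = R b := by
  have key : ∀ ε > 0, |R b - R a| ≤ ε * (N b - N a) := by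
    intro ε hε
    obtain ⟨δ, hδ, hR⟩ := h ε hε
    -- A partition into `n + 1` equal steps shorter than `δ`; the increments of `N` telescope.
    obtain ⟨n, hn⟩ := exists_nat_gt ((b - a) / δ)
    have hn' : (b - a) / (n + 1) < δ := by
      rw [div_lt_iff₀ (by positivity)]
      rw [div_lt_iff₀ hδ] at hn
      nlinarith
    set x : ℕ → ℝ := fun i => a + i * ((b - a) / (n + 1)) with hx
    have hstep : 0 ≤ (b - a) / ((n : ℝ) + 1) := div_nonneg (by linarith) (by positivity)
    have hxn : x (n + 1) = b := by
      simp only [hx]; push_cast; field_simp; ring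
    have hind : ∀ i ≤ n + 1, |R (x i) - R a| ≤ ε * (N (x i) - N a) := by
      intro i
      induction i with
      | zero => intro _; simp [hx]
      | succ i ih =>
        intro hi
        have h1 := ih (by omega)
        have hx1 : x (i + 1) = x i + (b - a) / (n + 1) := by simp only [hx]; push_cast; ring
        have hle : x (i + 1) ≤ b := by
          rw [← hxn]
          simp only [hx]
          have : ((i + 1 : ℕ) : ℝ) ≤ ((n + 1 : ℕ) : ℝ) := by exact_mod_cast hi
          gcongr
        have hxi : a ≤ x i := by
          simp only [hx]
          have : 0 ≤ (i : ℝ) * ((b - a) / (n + 1)) := by positivity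
          linarith
        have h2 := hR (x i) (x (i + 1)) hxi (by linarith) hle (by rw [hx1]; linarith)
        calc |R (x (i + 1)) - R a| ≤ |R (x (i + 1)) - R (x i)| + |R (x i) - R a| :=
              abs_sub_le _ _ _
          _ ≤ _ := by linarith
    have := hind (n + 1) le_rfl
    rwa [hxn] at this
  by_contra hne
  have hpos : 0 < |R b - R a| := abs_pos.2 (sub_ne_zero.2 (Ne.symm hne))
  have hN : 0 < N b - N a := by
    have := key 1 one_pos; linarith
  -- This `ε` bounds the increment of `R` by half of itself.
  have := key (|R b - R a| / (2 * (N b - N a))) (by positivity)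
  have e : |R b - R a| / (2 * (N b - N a)) * (N b - N a) = |R b - R a| / 2 := by
    field_simp
  linarith

/-- The pairing of the weighted nonlocal gradient of `ψ` with the flux of density `w`. -/
def fluxPair (e : ℝ) (f : ProbabilityMeasure ℝ) (w : OffDiag → ℝ) (ψ : ℝ → ℝ) : ℝ :=
  ∫ p, weight e p * nlGrad ψ p * w p ∂prodOff f

/-- The weighted total variation of the flux of density `w`. -/
def fluxMass (e : ℝ) (f : ProbabilityMeasure ℝ) (w : OffDiag → ℝ) : ℝ≥0∞ :=
  ∫⁻ p, ENNReal.ofReal (weight e p * |w p|) ∂prodOff f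

/-- Solutions of the generalised continuity equation on `[a, b]`, integrated in time, whose fluxes
are given by a jointly measurable density. -/
structure IsDensitySolution (e a b : ℝ) (f : ℝ → ProbabilityMeasure ℝ) (u : ℝ × OffDiag → ℝ) :
    Prop where
  cont : Continuous f
  meas : Measurable u
  fin : ∀ᵐ t ∂(volume.restrict (Icc a b)), Integrable (fun p => u (t, p)) (prodOff (f t))
  mass : ∫⁻ t in Icc a b, fluxMass e (f t) (fun p => u (t, p)) < ⊤
  eq : ∀ ψ : ℝ → ℝ, ContDiff ℝ 1 ψ → HasCompactSupport ψ → ∀ s t, a ≤ s → s ≤ t → t ≤ b →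
    (∫ v, ψ v ∂(f t : Measure ℝ)) - ∫ v, ψ v ∂(f s : Measure ℝ)
      = ∫ r in s..t, fluxPair e (f r) (fun p => u (r, p)) ψ

/-! ### Pairing of fluxes with gradients of observables -/

theorem measurable_nlGrad (ψ : ℝ → ℝ) : Measurable (nlGrad ψ) := by
  unfold nlGrad
  have := measurable_deriv ψ
  fun_prop

theorem abs_nlGrad_le {ψ : ℝ → ℝ} {C : ℝ} (hC : ∀ v, |deriv ψ v| ≤ C) (p : OffDiag) :
    |nlGrad ψ p| ≤ 2 * C := by
  unfold nlGrad
  have := abs_sub (deriv ψ p.1.2) (deriv ψ p.1.1)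
  linarith [hC p.1.2, hC p.1.1]

theorem exists_deriv_bound {ψ : ℝ → ℝ} (hψ : ContDiff ℝ 1 ψ) (hc : HasCompactSupport ψ) :
    ∃ C, ∀ v, |deriv ψ v| ≤ C :=
  (hψ.continuous_deriv le_rfl).bounded_above_of_compact_support hc.deriv

section Slice

variable {e : ℝ} {f : ProbabilityMeasure ℝ} {w : OffDiag → ℝ}

theorem integrable_weight_mul (he : e < 1) (hw : Measurable w) (h : fluxMass e f w < ⊤) :
    Integrable (fun p => weight e p * w p) (prodOff f) := by
  refine ⟨((measurable_weight e).mul hw).aestronglyMeasurable, ?_⟩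
  rw [hasFiniteIntegral_iff_norm]
  simp only [norm_mul, Real.norm_eq_abs, abs_of_pos (weight_pos he _)]
  exact h

theorem fluxMass_eq_integral (he : e < 1) (hw : Measurable w) :
    (fluxMass e f w).toReal = ∫ p, weight e p * |w p| ∂prodOff f := by
  rw [integral_eq_lintegral_of_nonneg_ae]
  · rfl
  · exact ae_of_all _ fun p => mul_nonneg (weight_nonneg he p) (abs_nonneg _)
  · exact ((measurable_weight e).mul hw.abs).aestronglyMeasurable

theorem integrable_fluxPair (he : e < 1) (hw : Measurable w) (h : fluxMass e f w < ⊤) {ψ : ℝ → ℝ}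
    {C : ℝ} (hC : ∀ v, |deriv ψ v| ≤ C) :
    Integrable (fun p => weight e p * nlGrad ψ p * w p) (prodOff f) := by
  have := (integrable_weight_mul he hw h).bdd_mul (c := 2 * C) (f := nlGrad ψ)
    (measurable_nlGrad ψ).aestronglyMeasurable (ae_of_all _ (abs_nlGrad_le hC))
  refine this.congr (ae_of_all _ fun p => ?_)
  simp only; ring

theorem abs_fluxPair_le (he : e < 1) (hw : Measurable w) (h : fluxMass e f w < ⊤) {ψ : ℝ → ℝ}
    {C : ℝ} (hC : ∀ v, |deriv ψ v| ≤ C) :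
    |fluxPair e f w ψ| ≤ 2 * C * (fluxMass e f w).toReal := by
  rw [fluxMass_eq_integral he hw, ← integral_const_mul, fluxPair, ← Real.norm_eq_abs]
  have hi := (integrable_weight_mul he hw h).abs
  simp_rw [abs_mul, abs_of_pos (weight_pos he _)] at hi
  refine norm_integral_le_of_norm_le (hi.const_mul _) (ae_of_all _ fun p => ?_)
  rw [norm_mul, norm_mul, Real.norm_eq_abs, Real.norm_eq_abs, Real.norm_eq_abs,
    abs_of_pos (weight_pos he _)]
  have h1 := abs_nlGrad_le hC p
  have h2 := mul_nonneg (weight_nonneg he p) (abs_nonneg (w p))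
  nlinarith

theorem fluxPair_sub (he : e < 1) (hw : Measurable w) (h : fluxMass e f w < ⊤) {ψ₁ ψ₂ : ℝ → ℝ}
    {C₁ C₂ : ℝ} (h₁ : ContDiff ℝ 1 ψ₁) (h₂ : ContDiff ℝ 1 ψ₂)
    (hC₁ : ∀ v, |deriv ψ₁ v| ≤ C₁) (hC₂ : ∀ v, |deriv ψ₂ v| ≤ C₂) :
    fluxPair e f w (ψ₁ - ψ₂) = fluxPair e f w ψ₁ - fluxPair e f w ψ₂ := by
  unfold fluxPair
  rw [← integral_sub (integrable_fluxPair he hw h hC₁) (integrable_fluxPair he hw h hC₂)]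
  congr with p
  unfold nlGrad
  rw [deriv_sub (h₁.differentiable one_ne_zero _) (h₂.differentiable one_ne_zero _),
    deriv_sub (h₁.differentiable one_ne_zero _) (h₂.differentiable one_ne_zero _)]
  ring

end Slice

theorem measurable_fluxMass (e : ℝ) {f : ℝ → ProbabilityMeasure ℝ} (hf : Continuous f)
    {u : ℝ × OffDiag → ℝ} (hu : Measurable u) :
    Measurable fun t => fluxMass e (f t) (fun p => u (t, p)) := by
  refine measurable_lintegral_prodOff hf (h := fun q => ENNReal.ofReal (weight e q.2 * |u q|)) ?_
  have := measurable_weight e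
  fun_prop

theorem measurable_fluxPair (e : ℝ) {f : ℝ → ProbabilityMeasure ℝ} (hf : Continuous f)
    {u : ℝ × OffDiag → ℝ} (hu : Measurable u) (ψ : ℝ → ℝ) :
    Measurable fun t => fluxPair e (f t) (fun p => u (t, p)) ψ := by
  refine measurable_integral_prodOff hf (h := fun q => weight e q.2 * nlGrad ψ q.2 * u q) ?_
  have := measurable_weight e
  have := measurable_nlGrad ψ
  fun_prop

theorem measurable_energy (e : ℝ) {f : ℝ → ProbabilityMeasure ℝ} (hf : Continuous f)
    {u : ℝ × OffDiag → ℝ} (hu : Measurable u) :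
    Measurable fun t => energy e (f t) (fun p => u (t, p)) := by
  refine measurable_lintegral_prodOff hf
    (h := fun q => ENNReal.ofReal (weight e q.2 * u q ^ 2)) ?_
  have := measurable_weight e
  fun_prop

theorem continuous_integral_curve {f : ℝ → ProbabilityMeasure ℝ} (hf : Continuous f) {ψ : ℝ → ℝ}
    (hψ : Continuous ψ) (hc : HasCompactSupport ψ) :
    Continuous fun t => ∫ v, ψ v ∂(f t : Measure ℝ) := by
  obtain ⟨C, hC⟩ := hψ.bounded_above_of_compact_support hc
  exact (ProbabilityMeasure.continuous_integral_boundedContinuousFunction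
    (BoundedContinuousFunction.ofNormedAddCommGroup ψ hψ C hC)).comp hf

namespace IsDensitySolution

variable {e a b : ℝ} {f : ℝ → ProbabilityMeasure ℝ} {u : ℝ × OffDiag → ℝ}

theorem ae_mass_lt_top (h : IsDensitySolution e a b f u) :
    ∀ᵐ t ∂(volume.restrict (Icc a b)), fluxMass e (f t) (fun p => u (t, p)) < ⊤ :=
  ae_lt_top (measurable_fluxMass e h.cont h.meas) h.mass.ne

theorem integrableOn_mass (h : IsDensitySolution e a b f u) :
    IntegrableOn (fun t => (fluxMass e (f t) (fun p => u (t, p))).toReal) (Icc a b) :=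
  integrable_toReal_of_lintegral_ne_top (measurable_fluxMass e h.cont h.meas).aemeasurable
    h.mass.ne

theorem integrableOn_fluxPair (he : e < 1) (h : IsDensitySolution e a b f u) {ψ : ℝ → ℝ} {C : ℝ}
    (hC : ∀ v, |deriv ψ v| ≤ C) :
    IntegrableOn (fun t => fluxPair e (f t) (fun p => u (t, p)) ψ) (Icc a b) := by
  refine Integrable.mono' (h.integrableOn_mass.const_mul (2 * C))
    (measurable_fluxPair e h.cont h.meas ψ).aestronglyMeasurable ?_
  filter_upwards [h.ae_mass_lt_top] with t ht
  exact abs_fluxPair_le he (h.meas.comp measurable_prodMk_left) ht hC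

end IsDensitySolution

/-! ### From the generalised continuity equation to density solutions -/

theorem continuous_clamp {f : ℝ → ProbabilityMeasure ℝ} {T : ℝ} (hT : 0 ≤ T)
    (hf : ContinuousOn f (Icc 0 T)) : Continuous fun t => f (projIcc 0 T hT t) :=
  (continuousOn_iff_continuous_domRestrict.1 hf).comp continuous_projIcc

/-- The curve is frozen outside `[0, T]` so that it is continuous on `ℝ` and defines a kernel. The
action is finite at almost every time, which gives the density. Test functions `η(t) ψ(v)` identify
`fluxPair` as the distributional time derivative of `∫ ψ df_t`, and this is integrated in time. -/
theorem exists_density_of_GCE {e T : ℝ} (he : e < 1) (hT : 0 < T) {f : ℝ → ProbabilityMeasure ℝ}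
    {U : ℝ → SignedMeasure OffDiag} (h : GCE e T f U)
    (hA : ∫⁻ t in Icc 0 T, action e (f t) (U t) ^ (1 / 2 : ℝ) < ⊤) :
    ∃ u : ℝ × OffDiag → ℝ, IsDensitySolution e 0 T (fun t => f (projIcc 0 T hT.le t)) u ∧
      ∀ᵐ t ∂(volume.restrict (Icc 0 T)), Integrable (fun p => u (t, p)) (prodOff (f t)) ∧
        U t = (prodOff (f t)).withDensityᵥ (fun p => u (t, p)) ∧
        action e (f t) (U t) = energy e (f t) (fun p => u (t, p)) := by
  set f' : ℝ → ProbabilityMeasure ℝ := fun t => f (projIcc 0 T hT.le t) with hf'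
  set U' : ℝ → SignedMeasure OffDiag := fun t => U (projIcc 0 T hT.le t) with hU'
  have hfc : Continuous f' := continuous_clamp hT.le h.2
  have ef : ∀ t ∈ Icc 0 T, f' t = f t := fun t ht => by simp only [hf', projIcc_of_mem hT.le ht]
  have eU : ∀ t ∈ Icc 0 T, U' t = U t := fun t ht => by simp only [hU', projIcc_of_mem hT.le ht]
  have hUm : ∀ B, MeasurableSet B → Measurable fun t => U' t B :=
    measurable_flux_apply fun g => (h.1.measurable_flux g).comp continuous_projIcc.measurable
  obtain ⟨hAm, u, hum, hu⟩ := exists_flux_density he hfc hUm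
  have hum' : ∀ t, Measurable fun p => u (t, p) := fun t => hum.comp measurable_prodMk_left
  have hfin : ∀ᵐ t ∂(volume.restrict (Icc 0 T)), action e (f' t) (U' t) < ⊤ := by
    have h1 : ∫⁻ t in Icc 0 T, action e (f' t) (U' t) ^ (1 / 2 : ℝ) < ⊤ := by
      refine lt_of_eq_of_lt (setLIntegral_congr_fun measurableSet_Icc fun t ht => ?_) hA
      simp only [ef t ht, eU t ht]
    filter_upwards [ae_lt_top (hAm.pow_const _) h1.ne] with t ht
    by_contra hne
    rw [not_lt_top_iff] at hne
    rw [hne, ENNReal.top_rpow_of_pos (by norm_num)] at ht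
    exact lt_irrefl _ ht
  have hdens : ∀ᵐ t ∂(volume.restrict (Icc 0 T)), Integrable (fun p => u (t, p)) (prodOff (f t)) ∧
        U t = (prodOff (f t)).withDensityᵥ (fun p => u (t, p)) := by
    filter_upwards [hfin, ae_restrict_mem measurableSet_Icc] with t ht htT
    have := hu t ht
    rwa [ef t htT, eU t htT] at this
  have hmass : ∫⁻ t in Icc 0 T, fluxMass e (f' t) (fun p => u (t, p)) < ⊤ := by
    refine lt_of_eq_of_lt (lintegral_congr_ae ?_) h.1.integrability
    filter_upwards [hdens, ae_restrict_mem measurableSet_Icc] with t ht htT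
    rw [ht.2, totalVariation_withDensityᵥ ht.1, lintegral_withDensity_eq_lintegral_mul₀
      (hum' t).enorm.aemeasurable (measurable_weight e).ennreal_ofReal.aemeasurable, ef t htT,
      fluxMass]
    congr with p
    rw [Pi.mul_apply, ENNReal.ofReal_mul (weight_nonneg he p), Real.enorm_eq_ofReal_abs, mul_comm]
  have hmass' : ∀ᵐ t ∂(volume.restrict (Icc 0 T)), fluxMass e (f' t) (fun p => u (t, p)) < ⊤ :=
    ae_lt_top (measurable_fluxMass e hfc hum) hmass.ne
  have hsol : ∀ ψ : ℝ → ℝ, ContDiff ℝ 1 ψ → HasCompactSupport ψ → ∀ s t, 0 ≤ s → s ≤ t → t ≤ T →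
      (∫ v, ψ v ∂(f' t : Measure ℝ)) - ∫ v, ψ v ∂(f' s : Measure ℝ)
        = ∫ r in s..t, fluxPair e (f' r) (fun p => u (r, p)) ψ := by
    intro ψ hψ hψc s t hs hst ht
    obtain ⟨C, hC⟩ := exists_deriv_bound hψ hψc
    refine sub_eq_integral_of_weak_deriv (F := fun t => ∫ v, ψ v ∂(f' t : Measure ℝ)) hT
      (continuous_integral_curve hfc hψ.continuous hψc) ?_ ?_ ⟨hs, hst.trans ht⟩ ⟨hs.trans hst, ht⟩
    · refine Integrable.mono' ((integrable_toReal_of_lintegral_ne_top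
        (measurable_fluxMass e hfc hum).aemeasurable hmass.ne).const_mul (2 * C))
        (measurable_fluxPair e hfc hum ψ).aestronglyMeasurable ?_
      filter_upwards [hmass'] with t ht
      exact abs_fluxPair_le he (hum' t) ht hC
    · intro η hη hηc hηT
      have hsub : tsupport (fun q : ℝ × ℝ => η q.1 * ψ q.2) ⊆ tsupport η ×ˢ tsupport ψ := by
        refine closure_minimal ?_ (isClosed_closure.prod isClosed_closure)
        intro q hq
        exact ⟨subset_tsupport _ (left_ne_zero_of_mul hq),
          subset_tsupport _ (right_ne_zero_of_mul hq)⟩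
      have hw := h.1.weak_form (fun q => η q.1 * ψ q.2)
        ((hη.comp contDiff_fst).mul (hψ.comp contDiff_snd))
        ((hηc.isCompact.prod hψc.isCompact).of_isClosed_subset isClosed_closure hsub)
        (hsub.trans (prod_mono hηT (subset_univ _)))
      refine Eq.trans ?_ hw
      congr 1
      · refine setIntegral_congr_fun measurableSet_Icc fun t ht => ?_
        simp only
        rw [ef t ht, ← integral_const_mul]
        congr with v
        rw [deriv_mul_const (hη.differentiable one_ne_zero t)]
      · refine integral_congr_ae ?_
        filter_upwards [hdens, hmass', ae_restrict_mem measurableSet_Icc] with t ht htm htT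
        have hgrad : ∀ p, nlGrad (fun v => η t * ψ v) p = η t * nlGrad ψ p := fun p => by
          unfold nlGrad
          rw [deriv_const_mul _ (hψ.differentiable one_ne_zero _),
            deriv_const_mul _ (hψ.differentiable one_ne_zero _)]
          ring
        simp only [hgrad]
        have hi := integrable_fluxPair he (hum' t) htm hC
        rw [ef t htT] at hi ⊢
        have e3 : ∀ p, weight e p * (η t * nlGrad ψ p) * u (t, p)
            = η t * (weight e p * nlGrad ψ p * u (t, p)) := fun p => by ring
        rw [ht.2, integral_withDensityᵥ (g := fun p => weight e p * (η t * nlGrad ψ p)) ht.1 (hum' t)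
          ((measurable_weight e).mul ((measurable_nlGrad ψ).const_mul _))]
        · simp_rw [e3]
          rw [integral_const_mul]; rfl
        · simp_rw [e3]
          exact hi.const_mul _
  refine ⟨u, ⟨hfc, hum, ?_, hmass, hsol⟩, ?_⟩
  · filter_upwards [hdens, ae_restrict_mem measurableSet_Icc] with t ht htT
    rw [ef t htT]; exact ht.1
  · filter_upwards [hdens] with t ht
    refine ⟨ht.1, ht.2, ?_⟩
    rw [ht.2, action_withDensityᵥ e (f t) ht.1 (hum' t)]

theorem GCE.congr {e T : ℝ} {f f' : ℝ → ProbabilityMeasure ℝ} {U U' : ℝ → SignedMeasure OffDiag}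
    (h : GCE e T f U) (hf : ∀ t ∈ Icc 0 T, f' t = f t) (hU : ∀ t ∈ Icc 0 T, U' t = U t) :
    GCE e T f' U' := by
  refine ⟨⟨fun g => ?_, fun g => ?_, ?_, fun φ h1 h2 h3 => ?_⟩, h.2.congr hf⟩
  · have := h.1.measurable_curve g
    simpa only [hf _ (Subtype.coe_prop _)] using this
  · have := h.1.measurable_flux g
    simpa only [hU _ (Subtype.coe_prop _)] using this
  · refine lt_of_eq_of_lt (setLIntegral_congr_fun measurableSet_Icc fun t ht => ?_)
      h.1.integrability
    simp only [hU t ht]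
  · refine Eq.trans ?_ (h.1.weak_form φ h1 h2 h3)
    congr 1
    · refine setIntegral_congr_fun measurableSet_Icc fun t ht => ?_
      simp only [hf t ht]
    · refine setIntegral_congr_fun measurableSet_Icc fun t ht => ?_
      simp only [hU t ht]

/-! ### From density solutions back to the generalised continuity equation -/

section TestFunction

variable {Φ : ℝ × ℝ → ℝ}

theorem hasDerivAt_fst (hΦ : ContDiff ℝ 1 Φ) (t v : ℝ) :
    HasDerivAt (fun s => Φ (s, v)) (fderiv ℝ Φ (t, v) (1, 0)) t := by
  have h1 := (hΦ.differentiable one_ne_zero (t, v)).hasFDerivAt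
  have h2 : HasDerivAt (fun s : ℝ => (s, v)) (1, 0) t :=
    (hasDerivAt_id t).prodMk (hasDerivAt_const t v)
  exact h1.comp_hasDerivAt t h2

theorem hasDerivAt_snd (hΦ : ContDiff ℝ 1 Φ) (t v : ℝ) :
    HasDerivAt (fun w => Φ (t, w)) (fderiv ℝ Φ (t, v) (0, 1)) v := by
  have h1 := (hΦ.differentiable one_ne_zero (t, v)).hasFDerivAt
  have h2 : HasDerivAt (fun w : ℝ => (t, w)) (0, 1) v :=
    (hasDerivAt_const v t).prodMk (hasDerivAt_id v)
  exact h1.comp_hasDerivAt v h2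

theorem continuous_fderiv_apply (hΦ : ContDiff ℝ 1 Φ) (x : ℝ × ℝ) :
    Continuous fun q => fderiv ℝ Φ q x :=
  (hΦ.continuous_fderiv one_ne_zero).clm_apply continuous_const

theorem hasCompactSupport_fderiv_apply (hc : HasCompactSupport Φ) (x : ℝ × ℝ) :
    HasCompactSupport fun q => fderiv ℝ Φ q x :=
  (hc.fderiv ℝ).comp_left (g := fun L : ℝ × ℝ →L[ℝ] ℝ => L x) rfl

theorem hasCompactSupport_slice (hc : HasCompactSupport Φ) (t : ℝ) :
    HasCompactSupport fun v => Φ (t, v) := by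
  refine HasCompactSupport.intro (hc.isCompact.image continuous_snd) fun v hv => ?_
  by_contra hne
  exact hv ⟨(t, v), subset_tsupport _ hne, rfl⟩

/-- The derivative in time of the pairing of a time dependent test function with a curve. -/
theorem exists_modulus (hΦ : ContDiff ℝ 1 Φ) (hc : HasCompactSupport Φ) {ε : ℝ} (hε : 0 < ε) :
    ∃ δ > 0, ∀ s t v, |t - s| < δ →
      |fderiv ℝ Φ (t, v) (1, 0) - fderiv ℝ Φ (s, v) (1, 0)| ≤ ε ∧
      |fderiv ℝ Φ (t, v) (0, 1) - fderiv ℝ Φ (s, v) (0, 1)| ≤ ε := by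
  have u1 := (hasCompactSupport_fderiv_apply hc (1, 0)).uniformContinuous_of_continuous
    (continuous_fderiv_apply hΦ (1, 0))
  have u2 := (hasCompactSupport_fderiv_apply hc (0, 1)).uniformContinuous_of_continuous
    (continuous_fderiv_apply hΦ (0, 1))
  obtain ⟨δ₁, h1, h1'⟩ := Metric.uniformContinuous_iff.1 u1 ε hε
  obtain ⟨δ₂, h2, h2'⟩ := Metric.uniformContinuous_iff.1 u2 ε hε
  refine ⟨min δ₁ δ₂, lt_min h1 h2, fun s t v hst => ?_⟩
  have hd : dist (t, v) (s, v) = |t - s| := by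
    rw [Prod.dist_eq]; simp [Real.dist_eq]
  exact ⟨(h1' (hd.trans_lt (hst.trans_le (min_le_left _ _)))).le,
    (h2' (hd.trans_lt (hst.trans_le (min_le_right _ _)))).le⟩

end TestFunction

/-- The integrand and the measure both move with `t`. The integrand converges uniformly in `v`, so
it may be frozen before narrow continuity is applied. -/
theorem continuous_integral_fderiv {Φ : ℝ × ℝ → ℝ} (hΦ : ContDiff ℝ 1 Φ)
    (hc : HasCompactSupport Φ) {f : ℝ → ProbabilityMeasure ℝ} (hf : Continuous f) :
    Continuous fun t => ∫ v, fderiv ℝ Φ (t, v) (1, 0) ∂(f t : Measure ℝ) := by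
  rw [Metric.continuous_iff]
  intro s ε hε
  obtain ⟨δ, hδ, hmod⟩ := exists_modulus hΦ hc (show 0 < ε / 2 by positivity)
  have hcont : ∀ t, Continuous fun v => fderiv ℝ Φ (t, v) (1, 0) := fun t =>
    (continuous_fderiv_apply hΦ (1, 0)).comp (by fun_prop)
  have hcs : ∀ t, HasCompactSupport fun v => fderiv ℝ Φ (t, v) (1, 0) := fun t =>
    hasCompactSupport_slice (hasCompactSupport_fderiv_apply hc (1, 0)) t
  have hint : ∀ t r, Integrable (fun v => fderiv ℝ Φ (t, v) (1, 0)) (f r : Measure ℝ) :=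
    fun t r => (hcont t).integrable_of_hasCompactSupport (hcs t)
  obtain ⟨δ', hδ', hcv⟩ := Metric.continuous_iff.1
    (continuous_integral_curve hf (hcont s) (hcs s)) s (ε / 2) (by positivity)
  refine ⟨min δ δ', lt_min hδ hδ', fun t ht => ?_⟩
  have h1 := hcv t (ht.trans_le (min_le_right _ _))
  rw [Real.dist_eq] at h1 ht ⊢
  have h2 : |(∫ v, fderiv ℝ Φ (t, v) (1, 0) ∂(f t : Measure ℝ))
      - ∫ v, fderiv ℝ Φ (s, v) (1, 0) ∂(f t : Measure ℝ)| ≤ ε / 2 := by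
    rw [← integral_sub (hint t t) (hint s t), ← Real.norm_eq_abs]
    refine (norm_integral_le_of_norm_le_const (C := ε / 2) (ae_of_all _ fun v => ?_)).trans ?_
    · exact (hmod s t v (ht.trans_le (min_le_left _ _))).1
    · simp
  have := abs_sub_le (∫ v, fderiv ℝ Φ (t, v) (1, 0) ∂(f t : Measure ℝ))
    (∫ v, fderiv ℝ Φ (s, v) (1, 0) ∂(f t : Measure ℝ))
    (∫ v, fderiv ℝ Φ (s, v) (1, 0) ∂(f s : Measure ℝ))
  linarith

namespace IsDensitySolution

variable {e T : ℝ} {f : ℝ → ProbabilityMeasure ℝ} {u : ℝ × OffDiag → ℝ}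

/-- A test function depending on time is frozen on short intervals, where the equation for fixed
observables applies. The errors are small relative to the increments of `2t + 2 ∫ k`, with `k` the
mass of the flux, so `eq_of_increments_le` gives the product rule without differentiating any
observable along the curve. -/
theorem weak_form (he : e < 1) (hT : 0 < T) (h : IsDensitySolution e 0 T f u) {Φ : ℝ × ℝ → ℝ}
    (hΦ : ContDiff ℝ 1 Φ) (hc : HasCompactSupport Φ) (hsupp : tsupport Φ ⊆ Ioo 0 T ×ˢ univ) :
    (∫ t in 0..T, ∫ v, fderiv ℝ Φ (t, v) (1, 0) ∂(f t : Measure ℝ))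
      + (∫ t in 0..T, fluxPair e (f t) (fun p => u (t, p)) (fun v => Φ (t, v))) = 0 := by
  set P : ℝ → ℝ := fun t => ∫ v, fderiv ℝ Φ (t, v) (1, 0) ∂(f t : Measure ℝ) with hP
  set Q : ℝ → ℝ := fun t => fluxPair e (f t) (fun p => u (t, p)) (fun v => Φ (t, v)) with hQ
  set A : ℝ → ℝ := fun t => ∫ v, Φ (t, v) ∂(f t : Measure ℝ) with hA
  set k : ℝ → ℝ := fun t => (fluxMass e (f t) (fun p => u (t, p))).toReal with hk
  have hum : ∀ t, Measurable fun p => u (t, p) := fun t => h.meas.comp measurable_prodMk_left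
  have hPc : Continuous P := continuous_integral_fderiv hΦ hc h.cont
  have hslice : ∀ t, ContDiff ℝ 1 fun v => Φ (t, v) := fun t => hΦ.comp (by fun_prop)
  have hsc : ∀ t, HasCompactSupport fun v => Φ (t, v) := hasCompactSupport_slice hc
  have hder : ∀ t v, deriv (fun v => Φ (t, v)) v = fderiv ℝ Φ (t, v) (0, 1) := fun t v =>
    (hasDerivAt_snd hΦ t v).deriv
  obtain ⟨C, hC⟩ := (continuous_fderiv_apply hΦ (0, 1)).bounded_above_of_compact_support
    (hasCompactSupport_fderiv_apply hc (0, 1))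
  have hCd : ∀ t v, |deriv (fun v => Φ (t, v)) v| ≤ C := fun t v => by
    rw [hder]; exact hC (t, v)
  have hQm : Measurable Q := by
    refine measurable_integral_prodOff h.cont (h := fun q => weight e q.2 *
      (deriv (fun v => Φ (q.1, v)) q.2.1.2 - deriv (fun v => Φ (q.1, v)) q.2.1.1) * u q) ?_
    have := measurable_weight e
    have h1 := (continuous_fderiv_apply hΦ (0, 1)).measurable
    have h2 := h.meas
    simp_rw [hder]
    fun_prop
  have hki : IntegrableOn k (Icc 0 T) := h.integrableOn_mass
  have hQi : IntegrableOn Q (Icc 0 T) := by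
    refine Integrable.mono' (hki.const_mul (2 * C)) hQm.aestronglyMeasurable ?_
    filter_upwards [h.ae_mass_lt_top] with t ht
    exact abs_fluxPair_le he (hum t) ht (hCd t)
  have hii : ∀ {g : ℝ → ℝ}, IntegrableOn g (Icc 0 T) → ∀ s t, 0 ≤ s → s ≤ t → t ≤ T →
      IntervalIntegrable g volume s t := fun hg s t h0 h1 h2 =>
    (hg.mono_set (by rw [uIcc_of_le h1]; exact Icc_subset_Icc h0 h2)).intervalIntegrable
  have hint : ∀ t r, Integrable (fun v => Φ (t, v)) (f r : Measure ℝ) :=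
    fun t r => (hslice t).continuous.integrable_of_hasCompactSupport (hsc t)
  set R : ℝ → ℝ := fun t => A t - ((∫ r in 0..t, P r) + ∫ r in 0..t, Q r) with hR
  set N : ℝ → ℝ := fun t => 2 * t + 2 * ∫ r in 0..t, k r with hN
  have hzero : ∀ t, t ∉ Ioo 0 T → A t = 0 := fun t ht => by
    have : ∀ v, Φ (t, v) = 0 := fun v => by
      by_contra hne
      exact ht (hsupp (subset_tsupport _ hne)).1
    simp [hA, this]
  have hRR : R 0 = R T := by
    refine eq_of_increments_le (N := N) hT.le fun ε hε => ?_
    obtain ⟨δ, hδ, hmod⟩ := exists_modulus hΦ hc hε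
    have hPu := isCompact_Icc.uniformContinuousOn_of_continuous (s := Icc 0 T) hPc.continuousOn
    obtain ⟨δ', hδ', hPmod⟩ := Metric.uniformContinuousOn_iff.1 hPu ε hε
    refine ⟨min δ δ', lt_min hδ hδ', fun s t hs hst ht hd => ?_⟩
    have hd1 : t - s < δ := hd.trans_le (min_le_left _ _)
    have hd2 : t - s < δ' := hd.trans_le (min_le_right _ _)
    -- The time difference of the test function is integrated against the later measure, and the
    -- increment of the curve is tested with the earlier slice.
    have e1 : A t - A s = (∫ v, (Φ (t, v) - Φ (s, v)) ∂(f t : Measure ℝ))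
        + ∫ r in s..t, fluxPair e (f r) (fun p => u (r, p)) (fun v => Φ (s, v)) := by
      rw [← h.eq _ (hslice s) (hsc s) s t hs hst ht, integral_sub (hint t t) (hint s t)]
      ring
    have b1 : |(∫ v, (Φ (t, v) - Φ (s, v)) ∂(f t : Measure ℝ)) - (t - s) * P t|
        ≤ ε * (t - s) := by
      have hi2 : Integrable (fun v => fderiv ℝ Φ (t, v) (1, 0)) (f t : Measure ℝ) :=
        ((continuous_fderiv_apply hΦ (1, 0)).comp
          (show Continuous fun v : ℝ => (t, v) by fun_prop)).integrable_of_hasCompactSupport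
          (hasCompactSupport_slice (hasCompactSupport_fderiv_apply hc (1, 0)) t)
      have i0 : Integrable (fun v => Φ (t, v) - Φ (s, v)) (f t : Measure ℝ) :=
        (hint t t).sub (hint s t)
      rw [hP, ← integral_const_mul, ← integral_sub i0 (hi2.const_mul _), ← Real.norm_eq_abs]
      refine (norm_integral_le_of_norm_le_const (C := ε * (t - s)) (ae_of_all _ fun v => ?_)).trans
        (by simp)
      have hfd : ∀ r ∈ Icc s t, HasDerivWithinAt
          (fun r => Φ (r, v) - r * fderiv ℝ Φ (t, v) (1, 0))
          (fderiv ℝ Φ (r, v) (1, 0) - fderiv ℝ Φ (t, v) (1, 0)) (Icc s t) r := fun r _ => by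
        have := (hasDerivAt_fst hΦ r v).sub
          ((hasDerivAt_id r).mul_const (fderiv ℝ Φ (t, v) (1, 0)))
        rw [one_mul] at this
        exact this.hasDerivWithinAt
      have := Convex.norm_image_sub_le_of_norm_hasDerivWithin_le (C := ε) hfd (fun r hr => by
        rw [Real.norm_eq_abs]
        exact (hmod t r v (by rw [abs_sub_comm, abs_of_nonneg (by linarith [hr.2])]
                              linarith [hr.1])).1) (convex_Icc s t)
        (left_mem_Icc.2 hst) (right_mem_Icc.2 hst)
      rw [Real.norm_eq_abs (t - s), abs_of_nonneg (by linarith)] at this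
      refine le_trans (le_of_eq ?_) this
      congr 1; ring
    have b2 : |(∫ r in s..t, P r) - (t - s) * P t| ≤ ε * (t - s) := by
      have : (t - s) * P t = ∫ r in s..t, P t := by simp
      rw [this, ← intervalIntegral.integral_sub (hPc.intervalIntegrable _ _) (by simp),
        ← Real.norm_eq_abs]
      have := intervalIntegral.norm_integral_le_of_norm_le_const (a := s) (b := t) (C := ε)
        (f := fun r => P r - P t) (fun r hr => by
          rw [uIoc_of_le hst] at hr
          refine (hPmod r ⟨hs.trans hr.1.le, hr.2.trans ht⟩ t ⟨hs.trans hst, ht⟩ ?_).le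
          rw [Real.dist_eq, abs_sub_comm, abs_of_nonneg (by linarith [hr.2])]
          linarith [hr.1])
      rwa [abs_of_nonneg (by linarith)] at this
    have b3 : |(∫ r in s..t, fluxPair e (f r) (fun p => u (r, p)) (fun v => Φ (s, v)))
        - ∫ r in s..t, Q r| ≤ ∫ r in s..t, 2 * ε * k r := by
      rw [← intervalIntegral.integral_sub (hii (h.integrableOn_fluxPair he (hCd s)) s t hs hst ht)
        (hii hQi s t hs hst ht), ← Real.norm_eq_abs]
      refine intervalIntegral.norm_integral_le_of_norm_le hst ?_
        (hii (hki.const_mul (2 * ε)) s t hs hst ht)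
      have hae := (ae_restrict_iff' measurableSet_Icc).1 h.ae_mass_lt_top
      filter_upwards [hae] with r hr hrst
      have hrm := hr ⟨hs.trans hrst.1.le, hrst.2.trans ht⟩
      rw [hQ, ← fluxPair_sub he (hum r) hrm (hslice s) (hslice r) (hCd s) (hCd r)]
      refine abs_fluxPair_le he (hum r) hrm fun v => ?_
      rw [deriv_sub ((hslice s).differentiable one_ne_zero v)
        ((hslice r).differentiable one_ne_zero v), hder, hder]
      refine (hmod r s v ?_).2
      rw [abs_sub_comm, abs_of_nonneg (by linarith [hrst.1])]
      linarith [hrst.2]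
    have a1 : (∫ r in 0..t, P r) - ∫ r in 0..s, P r = ∫ r in s..t, P r :=
      intervalIntegral.integral_interval_sub_left (hPc.intervalIntegrable _ _)
        (hPc.intervalIntegrable _ _)
    have a2 : (∫ r in 0..t, Q r) - ∫ r in 0..s, Q r = ∫ r in s..t, Q r :=
      intervalIntegral.integral_interval_sub_left (hii hQi 0 t le_rfl (hs.trans hst) ht)
        (hii hQi 0 s le_rfl hs (hst.trans ht))
    have a3 : (∫ r in 0..t, k r) - ∫ r in 0..s, k r = ∫ r in s..t, k r :=
      intervalIntegral.integral_interval_sub_left (hii hki 0 t le_rfl (hs.trans hst) ht)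
        (hii hki 0 s le_rfl hs (hst.trans ht))
    rw [intervalIntegral.integral_const_mul] at b3
    have hNN : ε * (N t - N s) = ε * (t - s) + ε * (t - s) + 2 * ε * ∫ r in s..t, k r := by
      rw [← a3]; simp only [hN]; ring
    rw [hNN]
    have hRe : R t - R s = (A t - A s) - (∫ r in s..t, P r) - ∫ r in s..t, Q r := by
      rw [← a1, ← a2]; simp only [hR]; ring
    rw [hRe, e1]
    rw [abs_le] at b1 b2 b3 ⊢
    constructor <;> linarith [b1.1, b1.2, b2.1, b2.2, b3.1, b3.2]
  have h0 := hzero 0 (fun h => lt_irrefl _ h.1)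
  have h1 := hzero T (fun h => lt_irrefl _ h.2)
  simp only [hR, h0, h1, intervalIntegral.integral_same] at hRR
  linarith

theorem gce (he : e < 1) (hT : 0 < T) (h : IsDensitySolution e 0 T f u) :
    GCE e T f fun t => (prodOff (f t)).withDensityᵥ fun p => u (t, p) := by
  have hum : ∀ t, Measurable fun p => u (t, p) := fun t => h.meas.comp measurable_prodMk_left
  refine ⟨⟨fun g => ?_, fun g => ?_, ?_, fun Φ hΦ hc hsupp => ?_⟩, h.cont.continuousOn⟩
  · have := (ProbabilityMeasure.continuous_integral_boundedContinuousFunction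
      (X := ℝ) g.toBCF).comp (h.cont.comp (continuous_subtype_val (p := (· ∈ Icc 0 T))))
    exact this.measurable
  · classical
    -- At times where the density is not integrable the flux is zero by convention, hence the case
    -- distinction.
    have hm : Measurable fun t => if Integrable (fun p => u (t, p)) (prodOff (f t)) then
        ∫ p, g p * u (t, p) ∂prodOff (f t) else 0 := by
      refine Measurable.ite (measurableSet_integrable_prodOff h.cont h.meas) ?_ measurable_const
      exact measurable_integral_prodOff h.cont (h := fun q => g q.2 * u q)
        ((g.continuous.measurable.comp measurable_snd).mul h.meas)
    refine Eq.mpr (congrArg Measurable (funext fun t => ?_))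
      (hm.comp (measurable_subtype_coe (p := (· ∈ Icc 0 T))))
    simp only [Function.comp]
    split_ifs with hi
    · refine integral_withDensityᵥ hi (hum t) g.continuous.measurable ?_
      exact hi.bdd_mul (c := ‖g.toBCF‖) g.continuous.aestronglyMeasurable
        (ae_of_all _ fun p => g.toBCF.norm_coe_le_norm p)
    · rw [Measure.withDensityᵥ, dif_neg hi, VectorMeasure.integral_zero_vectorMeasure]
  · refine lt_of_eq_of_lt (lintegral_congr_ae ?_) h.mass
    filter_upwards [h.fin] with t ht
    rw [totalVariation_withDensityᵥ ht, lintegral_withDensity_eq_lintegral_mul₀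
      (hum t).enorm.aemeasurable (measurable_weight e).ennreal_ofReal.aemeasurable, fluxMass]
    congr with p
    rw [Pi.mul_apply, ENNReal.ofReal_mul (weight_nonneg he p), Real.enorm_eq_ofReal_abs, mul_comm]
  · have h0 := h.weak_form he hT hΦ hc hsupp
    rw [intervalIntegral.integral_of_le hT.le, intervalIntegral.integral_of_le hT.le,
      ← integral_Icc_eq_integral_Ioc, ← integral_Icc_eq_integral_Ioc] at h0
    refine Eq.trans ?_ h0
    congr 1
    · refine setIntegral_congr_fun measurableSet_Icc fun t _ => ?_
      simp only [(hasDerivAt_fst hΦ t _).deriv]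
    · refine integral_congr_ae ?_
      filter_upwards [h.fin, h.ae_mass_lt_top] with t ht htm
      obtain ⟨C, hC⟩ := exists_deriv_bound (ψ := fun v => Φ (t, v)) (hΦ.comp (by fun_prop))
        (hasCompactSupport_slice hc t)
      exact integral_withDensityᵥ ht (hum t)
        ((measurable_weight e).mul (measurable_nlGrad _)) (integrable_fluxPair he (hum t) htm hC)

end IsDensitySolution

/-- The change of time with speed `1 / ρ`. -/
theorem exists_timeChange {ρ : ℝ → ℝ} (hρi : ∀ x y, IntervalIntegrable ρ volume x y) {c : ℝ}
    (hc : 0 < c) (hρ : ∀ t, c ≤ ρ t) (a : ℝ) :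
    ∃ τ : ℝ ≃o ℝ, (∀ t, τ.symm t = ∫ r in a..t, ρ r) ∧ ∀ x y,
      Measure.map τ (volume.restrict (Icc (τ.symm x) (τ.symm y)))
        = (volume.restrict (Icc x y)).withDensity fun t => ENNReal.ofReal (ρ t) := by
  set s : ℝ → ℝ := fun t => ∫ r in a..t, ρ r with hs
  have hdiff : ∀ x y, s y - s x = ∫ r in x..y, ρ r := fun x y =>
    intervalIntegral.integral_interval_sub_left (hρi _ _) (hρi _ _)
  have hlow : ∀ x y, x ≤ y → c * (y - x) ≤ s y - s x := fun x y hxy => by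
    rw [hdiff]
    have := intervalIntegral.integral_mono_on hxy (by simp) (hρi x y) (fun t _ => hρ t)
    simpa [mul_comm] using this
  have hmono : StrictMono s := fun x y hxy => by
    have := hlow x y hxy.le
    have : 0 < c * (y - x) := mul_pos hc (sub_pos.2 hxy)
    linarith
  have hcont : Continuous s := intervalIntegral.continuous_primitive hρi a
  have hsurj : Function.Surjective s := by
    refine hcont.surjective ?_ ?_
    · refine tendsto_atTop_mono' _ (f₁ := fun t => s a + c * (t - a)) ?_ ?_
      · filter_upwards [eventually_ge_atTop a] with t ht
        linarith [hlow a t ht]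
      · exact tendsto_atTop_add_const_left _ _
          ((tendsto_atTop_add_const_right _ (-a) tendsto_id).const_mul_atTop hc)
    · refine tendsto_atBot_mono' _ (f₁ := fun t => s a + c * (t - a)) ?_ ?_
      · filter_upwards [eventually_le_atBot a] with t ht
        linarith [hlow t a ht]
      · exact tendsto_atBot_add_const_left _ _
          ((tendsto_atBot_add_const_right _ (-a) tendsto_id).const_mul_atBot hc)
  set τ : ℝ ≃o ℝ := (hmono.orderIsoOfSurjective s hsurj).symm with hτ
  have hτs : ∀ t, τ.symm t = s t := fun t => rfl
  have hτm : Measurable τ := τ.continuous.measurable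
  have hpre : ∀ x y, τ ⁻¹' Icc x y = Icc (τ.symm x) (τ.symm y) := fun x y => by
    ext r; simp [τ.symm_apply_le, τ.le_symm_apply]
  have hpre' : ∀ x y, τ ⁻¹' Ioc x y = Ioc (τ.symm x) (τ.symm y) := fun x y => by
    ext r; simp [τ.symm_apply_lt, τ.le_symm_apply]
  -- Both measures give the interval `(x, y]` the mass `∫ ρ` over it.
  have hmap : Measure.map τ volume = volume.withDensity fun t => ENNReal.ofReal (ρ t) := by
    refine Measure.ext_of_Ioc' _ _ (fun x y _ => ?_) fun x y hxy => ?_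
    · rw [Measure.map_apply hτm measurableSet_Ioc, hpre', Real.volume_Ioc]
      exact ENNReal.ofReal_ne_top
    · rw [Measure.map_apply hτm measurableSet_Ioc, hpre', Real.volume_Ioc,
        withDensity_apply _ measurableSet_Ioc, hτs, hτs, hdiff,
        intervalIntegral.integral_of_le hxy.le,
        ofReal_integral_eq_lintegral_ofReal ((intervalIntegrable_iff_integrableOn_Ioc_of_le
          hxy.le).1 (hρi x y)) (ae_of_all _ fun t => hc.le.trans (hρ t))]
  refine ⟨τ, hτs, fun x y => ?_⟩
  rw [← hpre, ← Measure.restrict_map hτm measurableSet_Icc, hmap,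
    restrict_withDensity measurableSet_Icc]

/-! ### Change of time, reversal and concatenation of solutions -/

section Scaling

variable (e : ℝ) (f : ProbabilityMeasure ℝ) {w : OffDiag → ℝ} (hw : Measurable w) (c : ℝ)

include hw in
theorem fluxMass_mul_const : fluxMass e f (fun p => w p * c)
    = fluxMass e f w * ENNReal.ofReal |c| := by
  have := measurable_weight e
  rw [fluxMass, fluxMass, ← lintegral_mul_const _ (by fun_prop)]
  congr with p
  rw [abs_mul, ← mul_assoc, ENNReal.ofReal_mul' (abs_nonneg c)]

include hw in
theorem energy_mul_const : energy e f (fun p => w p * c)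
    = energy e f w * ENNReal.ofReal (c ^ 2) := by
  have := measurable_weight e
  rw [energy, energy, ← lintegral_mul_const _ (by fun_prop)]
  congr with p
  rw [mul_pow, ← mul_assoc, ENNReal.ofReal_mul' (sq_nonneg c)]

theorem fluxPair_mul_const (ψ : ℝ → ℝ) : fluxPair e f (fun p => w p * c) ψ
    = fluxPair e f w ψ * c := by
  rw [fluxPair, fluxPair, ← integral_mul_const]
  congr with p
  ring

end Scaling

namespace IsDensitySolution

variable {e a b : ℝ} {f : ℝ → ProbabilityMeasure ℝ} {u : ℝ × OffDiag → ℝ}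

theorem mono (h : IsDensitySolution e a b f u) {x y : ℝ} (hx : a ≤ x) (hy : y ≤ b) :
    IsDensitySolution e x y f u :=
  ⟨h.cont, h.meas, ae_restrict_of_ae_restrict_of_subset (Icc_subset_Icc hx hy) h.fin,
    (lintegral_mono_set (Icc_subset_Icc hx hy)).trans_lt h.mass,
    fun ψ h1 h2 s t hs hst ht => h.eq ψ h1 h2 s t (hx.trans hs) hst (ht.trans hy)⟩

/-- The new clock runs at speed `1 / ρ`, so the density of the flux is divided by `ρ`. Weighted mass
and pairings are invariant, while the energy acquires `ρ⁻²` from the density and `ρ` from the time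
element. -/
theorem timeChange (h : IsDensitySolution e a b f u) {ρ : ℝ → ℝ} (hρm : Measurable ρ)
    (hρi : ∀ x y, IntervalIntegrable ρ volume x y) {c : ℝ} (hc : 0 < c) (hρ : ∀ t, c ≤ ρ t)
    (hI : ∫ r in a..b, ρ r = 1) :
    ∃ f' u', IsDensitySolution e 0 1 f' u' ∧ f' 0 = f a ∧ f' 1 = f b ∧
      ∫⁻ t in Icc 0 1, energy e (f' t) (fun p => u' (t, p))
        = ∫⁻ t in Icc a b, energy e (f t) (fun p => u (t, p)) * ENNReal.ofReal (ρ t)⁻¹ := by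
  obtain ⟨τ, hτs, hmap⟩ := exists_timeChange hρi hc hρ a
  have hum : ∀ t, Measurable fun p => u (t, p) := fun t => h.meas.comp measurable_prodMk_left
  have hτm : Measurable τ := τ.continuous.measurable
  have hpos : ∀ t, 0 < ρ t := fun t => hc.trans_le (hρ t)
  have s0 : τ.symm a = 0 := by rw [hτs]; simp
  have s1 : τ.symm b = 1 := by rw [hτs, hI]
  have hab := hmap a b
  rw [s0, s1] at hab
  have hlint : ∀ F : ℝ → ℝ≥0∞, Measurable F → ∫⁻ s in Icc 0 1, F (τ s)
      = ∫⁻ t in Icc a b, ENNReal.ofReal (ρ t) * F t := fun F hF => by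
    rw [← lintegral_map hF hτm, hab,
      lintegral_withDensity_eq_lintegral_mul _ hρm.ennreal_ofReal hF]
    rfl
  have hτ0 : τ 0 = a := by rw [← s0, τ.apply_symm_apply]
  have hτ1 : τ 1 = b := by rw [← s1, τ.apply_symm_apply]
  refine ⟨fun s => f (τ s), fun q => u (τ q.1, q.2) * (ρ (τ q.1))⁻¹,
    ⟨h.cont.comp τ.continuous, ?_, ?_, ?_, ?_⟩, ?_, ?_, ?_⟩
  · have := h.meas
    fun_prop
  · have h1 : ∀ᵐ t ∂(Measure.map τ (volume.restrict (Icc 0 1))),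
        Integrable (fun p => u (t, p)) (prodOff (f t)) := by
      rw [hab]
      exact (withDensity_absolutelyContinuous _ _).ae_le h.fin
    filter_upwards [ae_of_ae_map hτm.aemeasurable h1] with s hs
    exact hs.mul_const _
  · simp_rw [fluxMass_mul_const e _ (hum _)]
    rw [hlint (fun t => fluxMass e (f t) (fun p => u (t, p)) * ENNReal.ofReal |(ρ t)⁻¹|)
      ((measurable_fluxMass e h.cont h.meas).mul (by fun_prop))]
    refine lt_of_eq_of_lt (lintegral_congr fun t => ?_) h.mass
    rw [abs_of_pos (inv_pos.2 (hpos t)), mul_left_comm, ← ENNReal.ofReal_mul (hpos t).le,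
      mul_inv_cancel₀ (hpos t).ne', ENNReal.ofReal_one, mul_one]
  · intro ψ hψ hψc s₁ s₂ h0 h12 h1
    have hx : a ≤ τ s₁ := by rw [← hτ0]; exact τ.monotone h0
    have hy : τ s₂ ≤ b := by rw [← hτ1]; exact τ.monotone h1
    rw [h.eq ψ hψ hψc _ _ hx (τ.monotone h12) hy, intervalIntegral.integral_of_le h12,
      intervalIntegral.integral_of_le (τ.monotone h12), ← integral_Icc_eq_integral_Ioc,
      ← integral_Icc_eq_integral_Ioc]
    simp_rw [fluxPair_mul_const]
    have h12' := hmap (τ s₁) (τ s₂)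
    rw [τ.symm_apply_apply, τ.symm_apply_apply] at h12'
    have e1 : ∫ r in Icc s₁ s₂, fluxPair e (f (τ r)) (fun p => u (τ r, p)) ψ * (ρ (τ r))⁻¹
        = ∫ t, fluxPair e (f t) (fun p => u (t, p)) ψ * (ρ t)⁻¹
          ∂(Measure.map τ (volume.restrict (Icc s₁ s₂))) := by
      rw [integral_map hτm.aemeasurable]
      exact ((measurable_fluxPair e h.cont h.meas ψ).mul hρm.inv).aestronglyMeasurable
    rw [e1, h12', integral_withDensity_eq_integral_toReal_smul hρm.ennreal_ofReal
      (ae_of_all _ fun _ => ENNReal.ofReal_lt_top)]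
    refine integral_congr_ae (ae_of_all _ fun t => ?_)
    simp only
    rw [ENNReal.toReal_ofReal (hpos t).le, smul_eq_mul, mul_left_comm,
      mul_inv_cancel₀ (hpos t).ne', mul_one]
  · simp only [hτ0]
  · simp only [hτ1]
  · simp_rw [energy_mul_const e _ (hum _)]
    rw [hlint (fun t => energy e (f t) (fun p => u (t, p)) * ENNReal.ofReal ((ρ t)⁻¹ ^ 2))
      ((measurable_energy e h.cont h.meas).mul (by fun_prop))]
    refine lintegral_congr fun t => ?_
    rw [mul_left_comm, ← ENNReal.ofReal_mul (hpos t).le]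
    congr 2
    have := (hpos t).ne'
    field_simp

/-- Reversal of time. -/
theorem reflect (h : IsDensitySolution e a b f u) (c : ℝ) :
    IsDensitySolution e (c - b) (c - a) (fun t => f (c - t)) (fun q => -u (c - q.1, q.2)) := by
  have hmp := Measure.measurePreserving_sub_left (volume : Measure ℝ) c
  have hpre : (fun t => c - t) ⁻¹' Icc a b = Icc (c - b) (c - a) := by
    ext t; simp only [mem_preimage, mem_Icc]; constructor <;> rintro ⟨h1, h2⟩ <;>
      constructor <;> linarith
  refine ⟨h.cont.comp (by fun_prop), ?_, ?_, ?_, ?_⟩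
  · have := h.meas
    fun_prop
  · have := (hmp.restrict_preimage (measurableSet_Icc (a := a) (b := b))).quasiMeasurePreserving.ae
      h.fin
    rw [hpre] at this
    filter_upwards [this] with t ht
    exact ht.neg
  · have h1 := hmp.setLIntegral_comp_preimage (measurableSet_Icc (a := a) (b := b))
      (measurable_fluxMass e h.cont h.meas)
    rw [hpre] at h1
    refine lt_of_eq_of_lt ?_ h.mass
    rw [← h1]
    simp only [fluxMass, abs_neg]
  · intro ψ hψ hψc s t hs hst ht
    have h1 := h.eq ψ hψ hψc (c - t) (c - s) (by linarith) (by linarith) (by linarith)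
    have h2 := intervalIntegral.integral_comp_sub_left (a := s) (b := t)
      (fun r => fluxPair e (f r) (fun p => u (r, p)) ψ) c
    have h3 : ∀ r, fluxPair e (f (c - r)) (fun p => -u (c - r, p)) ψ
        = -fluxPair e (f (c - r)) (fun p => u (c - r, p)) ψ := fun r => by
      simp only [fluxPair, mul_neg, integral_neg]
    simp_rw [h3]
    rw [intervalIntegral.integral_neg, h2, ← h1]
    ring

theorem lintegral_energy_reflect (h : IsDensitySolution e a b f u) (c : ℝ) {F : ℝ≥0∞ → ℝ≥0∞}
    (hF : Measurable F) :
    ∫⁻ t in Icc (c - b) (c - a), F (energy e (f (c - t)) (fun p => -u (c - t, p)))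
      = ∫⁻ t in Icc a b, F (energy e (f t) (fun p => u (t, p))) := by
  have hmp := Measure.measurePreserving_sub_left (volume : Measure ℝ) c
  have hpre : (fun t => c - t) ⁻¹' Icc a b = Icc (c - b) (c - a) := by
    ext t; simp only [mem_preimage, mem_Icc]; constructor <;> rintro ⟨h1, h2⟩ <;>
      constructor <;> linarith
  have h1 := hmp.setLIntegral_comp_preimage (measurableSet_Icc (a := a) (b := b))
    (hF.comp (measurable_energy e h.cont h.meas))
  rw [hpre] at h1
  refine Eq.trans ?_ h1
  simp only [energy, neg_sq, Function.comp]

open scoped Classical in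
/-- Concatenation of solutions. -/
theorem concat (he : e < 1) {c : ℝ} {g : ℝ → ProbabilityMeasure ℝ} {w : ℝ × OffDiag → ℝ}
    (h : IsDensitySolution e a b f u) (h' : IsDensitySolution e b c g w) (hfg : f b = g b)
    (hab : a ≤ b) (hbc : b ≤ c) :
    IsDensitySolution e a c (fun t => if t ≤ b then f t else g t)
      (fun q => if q.1 ≤ b then u q else w q) := by
  have hun : Icc a c = Icc a b ∪ Ioc b c := (Icc_union_Ioc_eq_Icc hab hbc).symm
  have hIoc : ∀ {p : ℝ → Prop}, (∀ᵐ t ∂(volume.restrict (Icc b c)), p t) →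
      ∀ᵐ t ∂(volume.restrict (Ioc b c)), p t := fun hp =>
    ae_restrict_of_ae_restrict_of_subset Ioc_subset_Icc_self hp
  refine ⟨Continuous.if_le h.cont h'.cont continuous_id continuous_const (fun t ht => by
    have ht' : t = b := ht; rw [ht', hfg]), ?_, ?_, ?_, ?_⟩
  · exact Measurable.ite (measurableSet_le measurable_fst measurable_const) h.meas h'.meas
  · rw [hun, ae_restrict_union_iff]
    constructor
    · filter_upwards [h.fin, ae_restrict_mem measurableSet_Icc] with t ht htm
      simpa [htm.2] using ht
    · filter_upwards [hIoc h'.fin, ae_restrict_mem measurableSet_Ioc] with t ht htm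
      simpa [not_le.2 htm.1] using ht
  · rw [hun]
    refine (lintegral_union_le _ _ _).trans_lt (ENNReal.add_lt_top.2 ⟨?_, ?_⟩)
    · refine lt_of_eq_of_lt (setLIntegral_congr_fun measurableSet_Icc fun t ht => ?_) h.mass
      simp [ht.2]
    · refine lt_of_le_of_lt ?_ h'.mass
      refine le_trans (le_of_eq (setLIntegral_congr_fun measurableSet_Ioc
        (g := fun t => fluxMass e (g t) fun p => w (t, p)) fun t ht => ?_))
        (lintegral_mono_set Ioc_subset_Icc_self)
      simp [not_le.2 ht.1]
  · intro ψ hψ hψc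
    set F : ℝ → ℝ := fun r => fluxPair e (if r ≤ b then f r else g r)
      (fun p => if r ≤ b then u (r, p) else w (r, p)) ψ with hF
    have left : ∀ s t, a ≤ s → s ≤ t → t ≤ b → (∫ v, ψ v ∂(f t : Measure ℝ))
        - ∫ v, ψ v ∂(f s : Measure ℝ) = ∫ r in s..t, F r := fun s t hs hst ht => by
      rw [h.eq ψ hψ hψc s t hs hst ht]
      refine intervalIntegral.integral_congr fun r hr => ?_
      rw [uIcc_of_le hst] at hr
      simp [hF, hr.2.trans ht]
    have right : ∀ s t, b ≤ s → s ≤ t → t ≤ c → (∫ v, ψ v ∂(g t : Measure ℝ))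
        - ∫ v, ψ v ∂(g s : Measure ℝ) = ∫ r in s..t, F r := fun s t hs hst ht => by
      rw [h'.eq ψ hψ hψc s t hs hst ht, intervalIntegral.integral_of_le hst,
        intervalIntegral.integral_of_le hst]
      refine setIntegral_congr_fun measurableSet_Ioc fun r hr => ?_
      simp [hF, not_le.2 (hs.trans_lt hr.1)]
    intro s t hs hst ht
    rcases le_or_gt t b with htb | htb
    · rw [if_pos htb, if_pos (hst.trans htb)]
      exact left s t hs hst htb
    · rw [if_neg (not_le.2 htb)]
      rcases le_or_gt s b with hsb | hsb
      · rw [if_pos hsb]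
        have l := left s b hs hsb le_rfl
        have r := right b t le_rfl htb.le ht
        obtain ⟨C, hC⟩ := exists_deriv_bound hψ hψc
        have hFm : IntegrableOn F (Icc a b) := (h.integrableOn_fluxPair he hC).congr_fun
          (fun r hr => by simp [hF, hr.2]) measurableSet_Icc
        have hFm' : IntegrableOn F (Ioc b c) :=
          ((h'.integrableOn_fluxPair he hC).mono_set Ioc_subset_Icc_self).congr_fun
          (fun r hr => by simp [hF, not_le.2 hr.1]) measurableSet_Ioc
        have hs1 : IntervalIntegrable F volume s b := (hFm.mono_set (by
          rw [uIcc_of_le hsb]; exact Icc_subset_Icc hs le_rfl)).intervalIntegrable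
        have hs2 : IntervalIntegrable F volume b t :=
          (intervalIntegrable_iff_integrableOn_Ioc_of_le htb.le).2
            (hFm'.mono_set (Ioc_subset_Ioc le_rfl ht))
        rw [← intervalIntegral.integral_add_adjacent_intervals hs1 hs2, ← l, ← r, hfg]
        ring
      · rw [if_neg (not_le.2 hsb)]
        exact right s t hsb.le hst ht

end IsDensitySolution

/-! ### The cost as a pseudometric bounded by length -/

theorem lintegral_rpow_half_le {X : Type*} [MeasurableSpace X] (μ : Measure X) [IsFiniteMeasure μ]
    {F : X → ℝ≥0∞} (h : ∫⁻ t, F t ∂μ < ⊤) : ∫⁻ t, F t ^ (1 / 2 : ℝ) ∂μ < ⊤ := by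
  have : ∀ x : ℝ≥0∞, x ^ (1 / 2 : ℝ) ≤ 1 + x := fun x => by
    rcases le_total x 1 with hx | hx
    · exact (ENNReal.rpow_le_one hx (by norm_num)).trans le_self_add
    · exact (ENNReal.rpow_le_rpow_of_exponent_le hx
          (show (1 / 2 : ℝ) ≤ 1 by norm_num)).trans
        (by rw [ENNReal.rpow_one]; exact le_add_self)
  refine (lintegral_mono fun t => this (F t)).trans_lt ?_
  rw [lintegral_add_left measurable_const]
  refine ENNReal.add_lt_top.2 ⟨?_, h⟩
  simp

theorem lintegral_rpow_half_le_of_unit {F : ℝ → ℝ≥0∞} (hF : Measurable F) :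
    ∫⁻ t in Icc (0 : ℝ) 1, F t ^ (1 / 2 : ℝ) ≤ (∫⁻ t in Icc (0 : ℝ) 1, F t) ^ (1 / 2 : ℝ) := by
  have h := ENNReal.lintegral_mul_le_Lp_mul_Lq (volume.restrict (Icc (0 : ℝ) 1))
    Real.HolderConjugate.two_two (f := fun t => F t ^ (1 / 2 : ℝ)) (g := fun _ => 1)
    (hF.pow_const _).aemeasurable aemeasurable_const
  have e1 : ∀ t, (F t ^ (1 / 2 : ℝ)) ^ (2 : ℝ) = F t := fun t => by
    rw [← ENNReal.rpow_mul]; norm_num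
  simp only [Pi.mul_apply, mul_one, e1, ENNReal.one_rpow, lintegral_const,
    Measure.restrict_apply_univ, Real.volume_Icc, sub_zero, ENNReal.ofReal_one] at h
  exact h

section Distance

variable {e : ℝ}

theorem dA_le_of_solution (he : e < 1) {f : ℝ → ProbabilityMeasure ℝ} {u : ℝ × OffDiag → ℝ}
    (h : IsDensitySolution e 0 1 f u) :
    dA e (f 0) (f 1)
      ≤ (∫⁻ t in Icc (0 : ℝ) 1, energy e (f t) (fun p => u (t, p))) ^ (1 / 2 : ℝ) := by
  refine ENNReal.rpow_le_rpow ?_ (by norm_num)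
  have hmem : (∫⁻ t in Icc (0 : ℝ) 1,
      action e (f t) ((prodOff (f t)).withDensityᵥ fun p => u (t, p)))
        ∈ connectingActions e (f 0) (f 1) := ⟨f, _, h.gce he one_pos, rfl, rfl, rfl⟩
  refine (sInf_le hmem).trans ?_
  exact lintegral_mono fun t => action_withDensityᵥ_le e (f t)
    (h.meas.comp measurable_prodMk_left)

theorem exists_solution_of_dA_lt (he : e < 1) {μ ν : ProbabilityMeasure ℝ} {c : ℝ≥0∞}
    (h : dA e μ ν < c) :
    ∃ f u, IsDensitySolution e 0 1 f u ∧ f 0 = μ ∧ f 1 = ν ∧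
      ∫⁻ t in Icc (0 : ℝ) 1, energy e (f t) (fun p => u (t, p)) < c ^ 2 := by
  have h1 : sInf (connectingActions e μ ν) < c ^ 2 := by
    rw [dA] at h
    have := ENNReal.rpow_lt_rpow h (show (0 : ℝ) < 2 by norm_num)
    rw [← ENNReal.rpow_mul] at this
    norm_num at this
    exact_mod_cast this
  obtain ⟨_, ⟨f, U, hU, h0, h1', rfl⟩, hlt⟩ := sInf_lt_iff.1 h1
  obtain ⟨u, hu, hae⟩ := exists_density_of_GCE he one_pos hU
    (lintegral_rpow_half_le _ (hlt.trans_le le_top))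
  refine ⟨_, u, hu, ?_, ?_, lt_of_eq_of_lt (lintegral_congr_ae ?_) hlt⟩
  · simp only [projIcc_of_mem (zero_le_one' ℝ) (left_mem_Icc.2 zero_le_one)]; exact h0
  · simp only [projIcc_of_mem (zero_le_one' ℝ) (right_mem_Icc.2 zero_le_one)]; exact h1'
  · filter_upwards [hae, ae_restrict_mem measurableSet_Icc] with t ht htm
    rw [ht.2.2, projIcc_of_mem zero_le_one htm]

/-- For curves of constant speed action is squared length, so the solution is reparametrised by a
clock proportional to its speed. Only the square root of the energy is assumed measurable with
finite integral, in the one case that is not trivial. -/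
theorem dA_le_length (he : e < 1) {a b : ℝ} (hab : a < b) {f : ℝ → ProbabilityMeasure ℝ}
    {u : ℝ × OffDiag → ℝ} (h : IsDensitySolution e a b f u) :
    dA e (f a) (f b)
      ≤ ∫⁻ t in Icc a b, energy e (f t) (fun p => u (t, p)) ^ (1 / 2 : ℝ) := by
  set E : ℝ → ℝ≥0∞ := fun t => energy e (f t) (fun p => u (t, p)) with hE
  have hEm : Measurable E := measurable_energy e h.cont h.meas
  rcases eq_or_ne (∫⁻ t in Icc a b, E t ^ (1 / 2 : ℝ)) ⊤ with htop | hfin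
  · rw [htop]; exact le_top
  have hfin' : ∀ᵐ t ∂(volume.restrict (Icc a b)), E t ^ (1 / 2 : ℝ) < ⊤ :=
    ae_lt_top (hEm.pow_const _) hfin
  set g : ℝ → ℝ := (Icc a b).indicator fun t => (E t ^ (1 / 2 : ℝ)).toReal with hg
  have hgm : Measurable g := ((hEm.pow_const _).ennreal_toReal).indicator measurableSet_Icc
  have hg0 : ∀ t, 0 ≤ g t := fun t => indicator_nonneg (fun _ _ => ENNReal.toReal_nonneg) t
  have hgi : Integrable g := by
    rw [hg, integrable_indicator_iff measurableSet_Icc]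
    exact integrable_toReal_of_lintegral_ne_top (hEm.pow_const _).aemeasurable hfin
  set l := (∫⁻ t in Icc a b, E t ^ (1 / 2 : ℝ)).toReal with hl
  have hl0 : 0 ≤ l := ENNReal.toReal_nonneg
  have hlint : ∫ t in a..b, g t = l := by
    rw [intervalIntegral.integral_of_le hab.le, ← integral_Icc_eq_integral_Ioc, hg,
      setIntegral_indicator measurableSet_Icc, inter_self,
      integral_toReal (hEm.pow_const _).aemeasurable hfin']
  have key : ∀ ε > 0, dA e (f a) (f b)
      ≤ ENNReal.ofReal ((l + ε * (b - a)) * l) ^ (1 / 2 : ℝ) := by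
    intro ε hε
    set Z := l + ε * (b - a) with hZ
    have hZ0 : 0 < Z := by have := mul_pos hε (sub_pos.2 hab); linarith
    -- The `ε` keeps the new clock nondegenerate where the speed vanishes, and `Z` normalises the
    -- total time to 1. The new action integrand `g² Z / (g + ε)` is at most `Z g`.
    set ρ : ℝ → ℝ := fun t => (g t + ε) / Z with hρ
    have hρ0 : ∀ t, ε / Z ≤ ρ t := fun t => by
      simp only [hρ]; have := hg0 t; gcongr; linarith
    have hgI : ∀ x y, IntervalIntegrable g volume x y := fun x y => hgi.intervalIntegrable
    obtain ⟨f', u', h', h0, h1, hen⟩ := h.timeChange (ρ := ρ) ((hgm.add_const _).div_const _)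
      (fun x y => ((hgI x y).add (by simp)).div_const _) (div_pos hε hZ0) hρ0 (by
        simp only [hρ]
        rw [intervalIntegral.integral_div, intervalIntegral.integral_add (hgI _ _) (by simp),
          hlint, intervalIntegral.integral_const, smul_eq_mul, mul_comm (b - a), ← hZ,
          div_self hZ0.ne'])
    rw [← h0, ← h1]
    refine (dA_le_of_solution he h').trans (ENNReal.rpow_le_rpow ?_ (by norm_num))
    rw [hen, ENNReal.ofReal_mul hZ0.le, hl, ENNReal.ofReal_toReal hfin,
      ← lintegral_const_mul _ (hEm.pow_const _)]
    refine lintegral_mono_ae ?_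
    filter_upwards [hfin', ae_restrict_mem measurableSet_Icc] with t ht htm
    have hgt : E t ^ (1 / 2 : ℝ) = ENNReal.ofReal (g t) := by
      rw [hg, indicator_of_mem htm, ENNReal.ofReal_toReal ht.ne]
    have hEt : E t = ENNReal.ofReal (g t ^ 2) := by
      rw [ENNReal.ofReal_pow (hg0 t), ← hgt, ← ENNReal.rpow_natCast, ← ENNReal.rpow_mul]
      norm_num
    change E t * _ ≤ _
    rw [hgt, hEt, ← ENNReal.ofReal_mul (sq_nonneg _), ← ENNReal.ofReal_mul hZ0.le]
    refine ENNReal.ofReal_le_ofReal ?_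
    simp only [hρ]
    have := hg0 t
    rw [inv_div, ← mul_div_assoc, div_le_iff₀ (by linarith)]
    nlinarith [mul_nonneg (mul_nonneg hZ0.le this) hε.le]
  have hcont : Tendsto (fun ε : ℝ => ENNReal.ofReal ((l + ε * (b - a)) * l) ^ (1 / 2 : ℝ))
      (𝓝[>] 0) (𝓝 (ENNReal.ofReal ((l + 0 * (b - a)) * l) ^ (1 / 2 : ℝ))) := by
    refine Tendsto.mono_left ?_ nhdsWithin_le_nhds
    have : Continuous fun ε : ℝ => ENNReal.ofReal ((l + ε * (b - a)) * l) ^ (1 / 2 : ℝ) :=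
      (ENNReal.continuous_rpow_const).comp (ENNReal.continuous_ofReal.comp (by fun_prop))
    exact this.tendsto 0
  have h1 := ge_of_tendsto hcont (by
    filter_upwards [self_mem_nhdsWithin] with ε hε using key ε hε)
  refine h1.trans (le_of_eq ?_)
  rw [zero_mul, add_zero, ← sq, ENNReal.ofReal_pow hl0, ← ENNReal.rpow_natCast,
    ← ENNReal.rpow_mul, hl, ENNReal.ofReal_toReal hfin]
  norm_num
  rfl

theorem dA_self (he : e < 1) (μ : ProbabilityMeasure ℝ) : dA e μ μ = 0 := by
  have h : IsDensitySolution e 0 1 (fun _ => μ) (fun _ => 0) := by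
    refine ⟨continuous_const, measurable_const, ?_, ?_, ?_⟩
    · simp
    · simp [fluxMass]
    · intro ψ _ _ s t _ _ _
      simp [fluxPair]
  have := dA_le_of_solution he h
  simpa [energy] using this

theorem dA_comm_le (he : e < 1) (μ ν : ProbabilityMeasure ℝ) : dA e ν μ ≤ dA e μ ν := by
  refine le_of_forall_gt fun c hc => ?_
  obtain ⟨c', hc1, hc2⟩ := exists_between hc
  obtain ⟨f, u, h, h0, h1, hE⟩ := exists_solution_of_dA_lt he hc1
  have h' := h.reflect 1
  rw [sub_self, sub_zero] at h'
  have hE' := h.lintegral_energy_reflect 1 measurable_id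
  rw [sub_self, sub_zero] at hE'
  have h2 := dA_le_of_solution he h'
  simp only [id] at hE'
  rw [hE', sub_zero, sub_self, h0, h1] at h2
  refine (h2.trans ?_).trans_lt hc2
  refine (ENNReal.rpow_le_rpow hE.le (by norm_num)).trans (le_of_eq ?_)
  rw [← ENNReal.rpow_natCast, ← ENNReal.rpow_mul]
  norm_num

theorem dA_comm (he : e < 1) (μ ν : ProbabilityMeasure ℝ) : dA e μ ν = dA e ν μ :=
  le_antisymm (dA_comm_le he ν μ) (dA_comm_le he μ ν)

/-- Near-optimal curves are joined on `[0, 2]`. Length is used because, unlike action, it is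
additive and insensitive to the time interval. -/
theorem dA_triangle (he : e < 1) (μ ν π : ProbabilityMeasure ℝ) :
    dA e μ π ≤ dA e μ ν + dA e ν π := by
  have hroot : ∀ c : ℝ≥0∞, (c ^ 2) ^ (1 / 2 : ℝ) = c := fun c => by
    rw [← ENNReal.rpow_natCast, ← ENNReal.rpow_mul]; norm_num
  rcases eq_or_ne (dA e μ ν) ⊤ with h | hμν
  · simp [h]
  rcases eq_or_ne (dA e ν π) ⊤ with h | hνπ
  · simp [h]
  refine ENNReal.le_of_forall_pos_le_add fun ε hε _ => ?_
  have hε2 : (ε / 2 : ℝ≥0∞) ≠ 0 := by simpa using hε.ne'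
  -- The second curve is taken from `π` to `ν`: reflecting it at time 2 both reverses it and moves
  -- it to `[1, 2]`.
  rw [dA_comm he ν π] at hνπ ⊢
  obtain ⟨f, u, h, h0, h1, hE⟩ := exists_solution_of_dA_lt he (ENNReal.lt_add_right hμν hε2)
  obtain ⟨g, w, k, k0, k1, hK⟩ := exists_solution_of_dA_lt he (ENNReal.lt_add_right hνπ hε2)
  have k' := k.reflect 2
  rw [show (2 : ℝ) - 1 = 1 by norm_num, sub_zero] at k'
  have hc := h.concat he k' (by norm_num [h1, k1]) zero_le_one one_le_two
  have hlen := dA_le_length he (two_pos) hc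
  have e2 : ((if (2 : ℝ) ≤ 1 then f 2 else g (2 - 2)) : ProbabilityMeasure ℝ) = π := by
    norm_num [k0]
  have e0 : ((if (0 : ℝ) ≤ 1 then f 0 else g (2 - 0)) : ProbabilityMeasure ℝ) = μ := by
    norm_num [h0]
  rw [e2, e0] at hlen
  have b1 : ∫⁻ t in Icc (0 : ℝ) 1, energy e (f t) (fun p => u (t, p)) ^ (1 / 2 : ℝ)
      ≤ dA e μ ν + ε / 2 :=
    (lintegral_rpow_half_le_of_unit (measurable_energy e h.cont h.meas)).trans
      ((ENNReal.rpow_le_rpow hE.le (by norm_num)).trans (hroot _).le)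
  have b2 : ∫⁻ t in Icc (0 : ℝ) 1, energy e (g t) (fun p => w (t, p)) ^ (1 / 2 : ℝ)
      ≤ dA e π ν + ε / 2 :=
    (lintegral_rpow_half_le_of_unit (measurable_energy e k.cont k.meas)).trans
      ((ENNReal.rpow_le_rpow hK.le (by norm_num)).trans (hroot _).le)
  have b2' := k.lintegral_energy_reflect 2 (F := fun x => x ^ (1 / 2 : ℝ))
    (by fun_prop)
  rw [show (2 : ℝ) - 1 = 1 by norm_num, sub_zero] at b2'
  rw [← b2'] at b2
  refine hlen.trans ?_
  rw [← Icc_union_Ioc_eq_Icc (zero_le_one' ℝ) one_le_two]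
  refine (lintegral_union_le _ _ _).trans ?_
  calc _ ≤ (dA e μ ν + ε / 2) + (dA e π ν + ε / 2) := by
        refine add_le_add (le_trans (le_of_eq ?_) b1) (le_trans (le_trans (le_of_eq ?_)
          (lintegral_mono_set Ioc_subset_Icc_self)) b2)
        · refine setLIntegral_congr_fun measurableSet_Icc fun t ht => ?_
          simp [ht.2]
        · refine setLIntegral_congr_fun measurableSet_Ioc fun t ht => ?_
          simp [not_le.2 ht.1]
    _ = dA e μ ν + dA e π ν + (ε / 2 + ε / 2) := by ring
    _ = _ := by rw [ENNReal.add_halves]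

end Distance

/-! ### Metric derivatives of absolutely continuous curves -/

theorem absolutelyContinuousOnInterval_of_dist_le {φ M : ℝ → ℝ} {a b : ℝ}
    (hM : AbsolutelyContinuousOnInterval M a b)
    (h : ∀ x ∈ uIcc a b, ∀ y ∈ uIcc a b, dist (φ x) (φ y) ≤ dist (M x) (M y)) :
    AbsolutelyContinuousOnInterval φ a b := by
  rw [absolutelyContinuousOnInterval_iff] at hM ⊢
  intro ε hε
  obtain ⟨δ, hδ, hM⟩ := hM ε hε
  refine ⟨δ, hδ, fun E hE hlt => lt_of_le_of_lt (Finset.sum_le_sum fun i hi => ?_) (hM E hE hlt)⟩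
  exact h _ (hE.1 i hi).1 _ (hE.1 i hi).2

theorem abs_le_of_hasDerivAt_of_dist_le {φ M : ℝ → ℝ} {x a b : ℝ} (hφ : HasDerivAt φ a x)
    (hM : HasDerivAt M b x) (h : ∀ᶠ y in 𝓝 x, dist (φ y) (φ x) ≤ dist (M y) (M x)) :
    |a| ≤ |b| := by
  refine le_of_tendsto_of_tendsto hφ.tendsto_slope.abs hM.tendsto_slope.abs ?_
  filter_upwards [nhdsWithin_le_nhds h] with y hy
  rw [slope_def_field, slope_def_field, abs_div, abs_div]
  exact div_le_div_of_nonneg_right hy (abs_nonneg _)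

theorem ae_mem_Ioo_of_forall_rat {T : ℝ} {P : ℝ → Prop}
    (h : ∀ a b : ℝ, 0 < a → a < b → b < T → ∀ᵐ x, x ∈ uIcc a b → P x) :
    ∀ᵐ x, x ∈ Ioo 0 T → P x := by
  have h' : ∀ᵐ x, ∀ q : ℚ × ℚ, 0 < (q.1 : ℝ) → (q.1 : ℝ) < q.2 → (q.2 : ℝ) < T →
      x ∈ uIcc (q.1 : ℝ) q.2 → P x := by
    rw [ae_all_iff]
    intro q
    by_cases hq : 0 < (q.1 : ℝ) ∧ (q.1 : ℝ) < q.2 ∧ (q.2 : ℝ) < T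
    · filter_upwards [h _ _ hq.1 hq.2.1 hq.2.2] with x hx _ _ _ using hx
    · exact ae_of_all _ fun x h1 h2 h3 => absurd ⟨h1, h2, h3⟩ hq
  filter_upwards [h'] with x hx hxT
  obtain ⟨a, ha, hax⟩ := exists_rat_btwn hxT.1
  obtain ⟨b, hb, hbx⟩ := exists_rat_btwn hxT.2
  exact hx (a, b) ha (hax.trans hb) hbx (mem_uIcc_of_le hax.le hb.le)

/-- The metric derivative of an absolutely continuous curve in a pseudometric space. -/
theorem exists_metricDeriv {T : ℝ} {d : ℝ → ℝ → ℝ} {m : ℝ → ℝ}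
    (hm0 : ∀ t, 0 ≤ m t) (hm : IntegrableOn m (Ioo 0 T))
    (d_self : ∀ s, d s s = 0) (d_comm : ∀ s t, d s t = d t s)
    (d_triangle : ∀ r ∈ Ioo 0 T, ∀ s ∈ Ioo 0 T, ∀ t ∈ Ioo 0 T, d r t ≤ d r s + d s t)
    (hd : ∀ s t, 0 < s → s ≤ t → t < T → d s t ≤ ∫ r in s..t, m r) :
    ∃ n : ℝ → ℝ, Measurable n ∧ (∀ t, 0 ≤ n t) ∧ IntegrableOn n (Ioo 0 T) ∧
      (∀ᵐ t, t ∈ Ioo 0 T → n t ≤ m t) ∧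
      (∀ s t, 0 < s → s ≤ t → t < T → d s t ≤ ∫ r in s..t, n r) ∧
      ∀ᵐ t, t ∈ Ioo 0 T → Tendsto (fun h => d (t + h) t / |h|) (𝓝[≠] 0) (𝓝 (n t)) := by
  classical
  set g : ℝ → ℝ := (Ioo 0 T).indicator m with hg
  have hg0 : ∀ t, 0 ≤ g t := indicator_nonneg fun t _ => hm0 t
  have hgi : Integrable g := (integrable_indicator_iff measurableSet_Ioo).2 hm
  have hgI : ∀ x y, IntervalIntegrable g volume x y := fun x y => hgi.intervalIntegrable
  set M : ℝ → ℝ := fun x => ∫ r in (0 : ℝ)..x, g r with hM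
  have hMM : ∀ s t, M t - M s = ∫ r in s..t, g r := fun s t =>
    intervalIntegral.integral_interval_sub_left (hgI _ _) (hgI _ _)
  have hgm : ∀ s t, 0 < s → s ≤ t → t < T → d s t ≤ M t - M s := by
    intro s t hs hst ht
    rw [hMM]
    refine (hd s t hs hst ht).trans (le_of_eq (intervalIntegral.integral_congr fun x hx => ?_))
    rw [uIcc_of_le hst] at hx
    exact (indicator_of_mem (s := Ioo 0 T) ⟨hs.trans_le hx.1, hx.2.trans_lt ht⟩ m).symm
  have hMmono : Monotone M := fun s t hst => by
    rw [← sub_nonneg, hMM]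
    exact intervalIntegral.integral_nonneg hst fun r _ => hg0 r
  have hdM : ∀ s ∈ Ioo 0 T, ∀ t ∈ Ioo 0 T, d s t ≤ dist (M s) (M t) := by
    intro s hs t ht
    rcases le_total s t with h | h
    · rw [dist_comm, Real.dist_eq, abs_of_nonneg (sub_nonneg.2 (hMmono h))]
      exact hgm s t hs.1 h ht.2
    · rw [d_comm, Real.dist_eq, abs_of_nonneg (sub_nonneg.2 (hMmono h))]
      exact hgm t s ht.1 h hs.2
  have hMac : ∀ a b, 0 < a → a < b → AbsolutelyContinuousOnInterval M a b := fun a b ha hab =>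
    ((hgI 0 b).absolutelyContinuousOnInterval_intervalIntegral left_mem_uIcc).mono (by
      rw [uIcc_of_le hab.le, uIcc_of_le (ha.trans hab).le]
      exact Icc_subset_Icc_left ha.le)
  -- The distances to the rational times of the curve are countably many real functions that
  -- determine `d` along it. Rational numbers outside `(0, T)` get the zero function, which is
  -- harmless in the supremum below.
  set φ : ℚ → ℝ → ℝ := fun q => if (q : ℝ) ∈ Ioo 0 T then d q else 0 with hφ
  have hφM : ∀ q, ∀ x ∈ Ioo 0 T, ∀ y ∈ Ioo 0 T, dist (φ q x) (φ q y) ≤ dist (M x) (M y) := by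
    intro q x hx y hy
    simp only [hφ]
    split_ifs with hq
    · refine le_trans ?_ (hdM x hx y hy)
      rw [Real.dist_eq, abs_le]
      have h1 := d_triangle q hq x hx y hy
      have h2 := d_triangle q hq y hy x hx
      rw [d_comm y x] at h2
      constructor <;> linarith
    · simp
  have hφac : ∀ q a b, 0 < a → a < b → b < T → AbsolutelyContinuousOnInterval (φ q) a b := by
    intro q a b ha hab hb
    refine absolutelyContinuousOnInterval_of_dist_le (hMac a b ha hab) fun x hx y hy => ?_
    rw [uIcc_of_le hab.le] at hx hy
    exact hφM q x ⟨ha.trans_le hx.1, hx.2.trans_lt hb⟩ y ⟨ha.trans_le hy.1, hy.2.trans_lt hb⟩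
  have hφd : ∀ᵐ x, ∀ q, x ∈ Ioo 0 T → DifferentiableAt ℝ (φ q) x := by
    rw [ae_all_iff]
    exact fun q => ae_mem_Ioo_of_forall_rat fun a b ha hab hb =>
      (hφac q a b ha hab hb).ae_differentiableAt
  have hbd : ∀ᵐ x, x ∈ Ioo 0 T → ∀ q, |deriv (φ q) x| ≤ m x := by
    filter_upwards [hφd, LocallyIntegrable.ae_hasDerivAt_integral hgi.locallyIntegrable] with x hx hxM hxT q
    have := abs_le_of_hasDerivAt_of_dist_le (hx q hxT).hasDerivAt (hxM 0) (by
      filter_upwards [isOpen_Ioo.mem_nhds hxT] with y hy using hφM q y hy x hxT)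
    rwa [hg, indicator_of_mem hxT, abs_of_nonneg (hm0 x)] at this
  -- The candidate for the metric derivative is the supremum of the slopes of these functions; it is
  -- measurable and dominated by `m`.
  set N : ℝ → ℝ≥0∞ := fun x => ⨆ q : ℚ, ENNReal.ofReal |deriv (φ q) x| with hN
  have hNm : Measurable N := Measurable.iSup fun q => (measurable_deriv _).abs.ennreal_ofReal
  set n : ℝ → ℝ := fun x => (N x).toReal with hn
  have hnm : Measurable n := hNm.ennreal_toReal
  have hn0 : ∀ t, 0 ≤ n t := fun t => ENNReal.toReal_nonneg
  have hNle : ∀ᵐ x, x ∈ Ioo 0 T → N x ≤ ENNReal.ofReal (m x) := by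
    filter_upwards [hbd] with x hx hxT
    exact iSup_le fun q => ENNReal.ofReal_le_ofReal (hx hxT q)
  have hnle : ∀ᵐ x, x ∈ Ioo 0 T → n x ≤ m x := by
    filter_upwards [hNle] with x hx hxT
    exact ENNReal.toReal_le_of_le_ofReal (hm0 x) (hx hxT)
  have hφn : ∀ᵐ x, x ∈ Ioo 0 T → ∀ q, |deriv (φ q) x| ≤ n x := by
    filter_upwards [hNle] with x hx hxT q
    rw [hn, ← ENNReal.ofReal_le_iff_le_toReal ((hx hxT).trans_lt ENNReal.ofReal_lt_top).ne]
    exact le_iSup (fun q : ℚ => ENNReal.ofReal |deriv (φ q) x|) q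
  have hni : IntegrableOn n (Ioo 0 T) := by
    refine Integrable.mono' hm hnm.aestronglyMeasurable ?_
    rw [ae_restrict_iff' measurableSet_Ioo]
    filter_upwards [hnle] with x hx hxT
    rw [Real.norm_eq_abs, abs_of_nonneg (hn0 x)]
    exact hx hxT
  have hnI : ∀ s ∈ Ioo 0 T, ∀ t ∈ Ioo 0 T, IntervalIntegrable n volume s t := fun s hs t ht =>
    (hni.mono_set (ordConnected_Ioo.uIcc_subset hs ht)).intervalIntegrable
  have hφint : ∀ (q : ℚ) s t, 0 < s → s ≤ t → t < T → φ q t - φ q s ≤ ∫ r in s..t, n r := by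
    intro q s t hs hst ht
    rcases hst.eq_or_lt with rfl | hlt
    · simp
    have hac := hφac q s t hs hlt ht
    rw [← hac.integral_deriv_eq_sub]
    refine intervalIntegral.integral_mono_ae_restrict hst hac.intervalIntegrable_deriv
      (hnI s ⟨hs, hst.trans_lt ht⟩ t ⟨hs.trans_le hst, ht⟩) ?_
    rw [EventuallyLE, ae_restrict_iff' measurableSet_Icc]
    filter_upwards [hφn] with x hx hxI
    exact (le_abs_self _).trans (hx ⟨hs.trans_le hxI.1, hxI.2.trans_lt ht⟩ q)
  have hdn : ∀ s t, 0 < s → s ≤ t → t < T → d s t ≤ ∫ r in s..t, n r := by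
    intro s t hs hst ht
    have hsT : s ∈ Ioo 0 T := ⟨hs, hst.trans_lt ht⟩
    have htT : t ∈ Ioo 0 T := ⟨hs.trans_le hst, ht⟩
    refine le_of_forall_pos_le_add fun ε hε => ?_
    have hMc : Continuous M := intervalIntegral.continuous_primitive hgI 0
    -- Through a rational time `q` close to `s`, `d s t` is at most `2 d q s` plus the integral of
    -- `n`.
    obtain ⟨δ, hδ, hδM⟩ := Metric.continuous_iff.1 hMc s (ε / 2) (half_pos hε)
    obtain ⟨q, hq1, hq2⟩ := exists_rat_btwn (lt_min (lt_add_of_pos_right s hδ) hsT.2)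
    have hqT : (q : ℝ) ∈ Ioo 0 T := ⟨hs.trans hq1, hq2.trans_le (min_le_right _ _)⟩
    have h1 := hφint q s t hs hst ht
    simp only [hφ, if_pos hqT] at h1
    have h2 := d_triangle s hsT q hqT t htT
    have h3 := hdM q hqT s hsT
    have h4 := hδM q (by
      rw [Real.dist_eq, abs_of_nonneg (by linarith)]
      linarith [hq2.trans_le (min_le_left _ _)])
    rw [d_comm s q] at h2
    linarith
  refine ⟨n, hnm, hn0, hni, hnle, hdn, ?_⟩
  set k : ℝ → ℝ := (Ioo 0 T).indicator n with hk
  have hki : Integrable k := (integrable_indicator_iff measurableSet_Ioo).2 hni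
  filter_upwards [hφd, hNle, LocallyIntegrable.ae_hasDerivAt_integral hki.locallyIntegrable] with t htd htN htk htT
  have hnbhd : ∀ᶠ h in 𝓝[≠] (0 : ℝ), t + h ∈ Ioo 0 T := by
    refine nhdsWithin_le_nhds ?_
    have : Tendsto (fun h : ℝ => t + h) (𝓝 0) (𝓝 t) := by
      simpa using (continuous_const_add t).tendsto 0
    exact this (isOpen_Ioo.mem_nhds htT)
  have hslope : ∀ {F : ℝ → ℝ} {F' : ℝ}, HasDerivAt F F' t →
      Tendsto (fun h => |F (t + h) - F t| / |h|) (𝓝[≠] 0) (𝓝 |F'|) := by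
    intro F F' hF
    have := (hasDerivAt_iff_tendsto_slope_zero.1 hF).abs
    refine this.congr fun h => ?_
    rw [smul_eq_mul, abs_mul, abs_inv, mul_comm, div_eq_mul_inv]
  rw [tendsto_order]
  constructor
  -- Lower bound: some slope exceeds `c`, and increments of `d(q, ·)` are at most `d` by the
  -- triangle inequality.
  · intro c hc
    have hNt : N t ≠ ⊤ := ((htN htT).trans_lt ENNReal.ofReal_lt_top).ne
    obtain ⟨q, hq⟩ : ∃ q : ℚ, c < |deriv (φ q) t| := by
      by_contra! hcon
      rcases lt_or_ge c 0 with hc0 | hc0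
      · exact absurd (hcon 0) (not_le.2 (hc0.trans_le (abs_nonneg _)))
      · exact absurd (ENNReal.toReal_le_of_le_ofReal hc0
          (iSup_le fun q => ENNReal.ofReal_le_ofReal (hcon q))) (not_le.2 hc)
    filter_upwards [(tendsto_order.1 (hslope (htd q htT).hasDerivAt)).1 c hq, hnbhd,
      self_mem_nhdsWithin] with h hh hhT hh0
    refine hh.trans_le (div_le_div_of_nonneg_right ?_ (abs_nonneg h))
    simp only [hφ]
    split_ifs with hqT
    · have h1 := d_triangle q hqT t htT (t + h) hhT
      have h2 := d_triangle q hqT (t + h) hhT t htT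
      rw [d_comm t (t + h)] at h1
      rw [abs_le]
      constructor <;> linarith
    · have h1 := d_triangle t htT (t + h) hhT t htT
      rw [d_self, d_comm t (t + h)] at h1
      simp only [Pi.zero_apply, sub_self, abs_zero]
      linarith
  -- Upper bound: `d (t + h) t` is at most the absolute integral of `n`, and almost every `t` is a
  -- differentiability point of that integral.
  · intro c hc
    have hkt : k t = n t := indicator_of_mem htT _
    have := hslope (htk 0)
    rw [hkt, abs_of_nonneg (hn0 t)] at this
    filter_upwards [(tendsto_order.1 this).2 c hc, hnbhd, self_mem_nhdsWithin] with h hh hhT hh0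
    refine lt_of_le_of_lt (div_le_div_of_nonneg_right ?_ (abs_nonneg h)) hh
    have hkI : ∀ x y, IntervalIntegrable k volume x y := fun x y => hki.intervalIntegrable
    rw [intervalIntegral.integral_interval_sub_left (hkI _ _) (hkI _ _)]
    have hcongr : ∀ x ∈ Ioo 0 T, ∀ y ∈ Ioo 0 T, ∫ r in x..y, k r = ∫ r in x..y, n r :=
      fun x hx y hy => intervalIntegral.integral_congr fun r hr =>
        indicator_of_mem (ordConnected_Ioo.uIcc_subset hx hy hr) _
    rw [hcongr t htT _ hhT]
    rcases le_total 0 h with h0 | h0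
    · rw [d_comm]
      exact (hdn _ _ htT.1 (by linarith) hhT.2).trans (le_abs_self _)
    · rw [intervalIntegral.integral_symm, abs_neg]
      exact (hdn _ _ hhT.1 (by linarith) htT.2).trans (le_abs_self _)

theorem HasMetricDeriv.unique {e t : ℝ} {f : ℝ → ProbabilityMeasure ℝ} {r r' : ℝ≥0∞}
    (h : HasMetricDeriv e f t r) (h' : HasMetricDeriv e f t r') : r = r' :=
  tendsto_nhds_unique h h'

theorem ae_Icc_of_ae_Ioo {T : ℝ} {P : ℝ → Prop} (h : ∀ᵐ t, t ∈ Ioo 0 T → P t) :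
    ∀ᵐ t ∂(volume.restrict (Icc 0 T)), P t := by
  rw [← restrict_Ioo_eq_restrict_Icc, ae_restrict_iff' measurableSet_Ioo]
  exact h

/-- The cost may be infinite in general, but between interior times of the curve it is finite, so
its real value obeys the triangle inequality there. -/
theorem exists_hasMetricDeriv {e T : ℝ} (he : e < 1) {f : ℝ → ProbabilityMeasure ℝ} {m : ℝ → ℝ}
    (hm0 : ∀ t, 0 ≤ m t) (hm : IntegrableOn m (Ioo 0 T))
    (hd : ∀ s t : ℝ, 0 < s → s ≤ t → t < T →
      dA e (f s) (f t) ≤ ENNReal.ofReal (∫ r in s..t, m r)) :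
    ∃ n : ℝ → ℝ, Measurable n ∧ (∀ t, 0 ≤ n t) ∧ IntegrableOn n (Ioo 0 T) ∧
      (∀ᵐ t ∂(volume.restrict (Icc 0 T)), n t ≤ m t) ∧
      (∀ s t, 0 < s → s ≤ t → t < T → dA e (f s) (f t) ≤ ENNReal.ofReal (∫ r in s..t, n r)) ∧
      ∀ᵐ t ∂(volume.restrict (Icc 0 T)), HasMetricDeriv e f t (ENNReal.ofReal (n t)) := by
  have hfin : ∀ s ∈ Ioo 0 T, ∀ t ∈ Ioo 0 T, dA e (f s) (f t) ≠ ⊤ := by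
    intro s hs t ht
    rcases le_total s t with h | h
    · exact ((hd s t hs.1 h ht.2).trans_lt ENNReal.ofReal_lt_top).ne
    · rw [dA_comm he]
      exact ((hd t s ht.1 h hs.2).trans_lt ENNReal.ofReal_lt_top).ne
  obtain ⟨n, hnm, hn0, hni, hnle, hnd, hnt⟩ := exists_metricDeriv
    (d := fun s t => (dA e (f s) (f t)).toReal) hm0 hm (by simp [dA_self he])
    (fun s t => by rw [dA_comm he])
    (fun r hr s hs t ht => by
      rw [← ENNReal.toReal_add (hfin r hr s hs) (hfin s hs t ht)]
      exact ENNReal.toReal_mono (ENNReal.add_ne_top.2 ⟨hfin r hr s hs, hfin s hs t ht⟩)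
        (dA_triangle he _ _ _))
    (fun s t hs hst ht => ENNReal.toReal_le_of_le_ofReal
      (intervalIntegral.integral_nonneg hst fun r _ => hm0 r) (hd s t hs hst ht))
  refine ⟨n, hnm, hn0, hni, ae_Icc_of_ae_Ioo hnle, fun s t hs hst ht => ?_, ?_⟩
  · rw [← ENNReal.ofReal_toReal (hfin s ⟨hs, hst.trans_lt ht⟩ t ⟨hs.trans_le hst, ht⟩)]
    exact ENNReal.ofReal_le_ofReal (hnd s t hs hst ht)
  · refine ae_Icc_of_ae_Ioo ?_
    filter_upwards [hnt] with t ht htT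
    refine (ENNReal.tendsto_ofReal (ht htT)).congr' ?_
    have : Tendsto (fun h : ℝ => t + h) (𝓝 0) (𝓝 t) := by
      simpa using (continuous_const_add t).tendsto 0
    filter_upwards [nhdsWithin_le_nhds (this (isOpen_Ioo.mem_nhds htT)), self_mem_nhdsWithin]
      with h hh h0
    rw [ENNReal.ofReal_div_of_pos (abs_pos.2 h0), ENNReal.ofReal_toReal (hfin _ hh _ htT)]

/-! ### Curves with a flux are absolutely continuous -/

section DensitySolution

variable {e T : ℝ} {f : ℝ → ProbabilityMeasure ℝ} {u : ℝ × OffDiag → ℝ}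

theorem integrableOn_sqrt_energy (h : IsDensitySolution e 0 T f u)
    (hE : ∫⁻ t in Icc 0 T, energy e (f t) (fun p => u (t, p)) ^ (1 / 2 : ℝ) < ⊤) :
    IntegrableOn (fun t => (energy e (f t) (fun p => u (t, p)) ^ (1 / 2 : ℝ)).toReal)
      (Icc 0 T) :=
  integrable_toReal_of_lintegral_ne_top
    ((measurable_energy e h.cont h.meas).pow_const _).aemeasurable hE.ne

theorem ae_sqrt_energy_lt_top (h : IsDensitySolution e 0 T f u)
    (hE : ∫⁻ t in Icc 0 T, energy e (f t) (fun p => u (t, p)) ^ (1 / 2 : ℝ) < ⊤) :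
    ∀ᵐ t ∂(volume.restrict (Icc 0 T)), energy e (f t) (fun p => u (t, p)) ^ (1 / 2 : ℝ) < ⊤ :=
  ae_lt_top ((measurable_energy e h.cont h.meas).pow_const _) hE.ne

theorem dA_le_integral_sqrt_energy (he : e < 1) (h : IsDensitySolution e 0 T f u)
    (hE : ∫⁻ t in Icc 0 T, energy e (f t) (fun p => u (t, p)) ^ (1 / 2 : ℝ) < ⊤) {s t : ℝ}
    (hs : 0 ≤ s) (hst : s ≤ t) (ht : t ≤ T) :
    dA e (f s) (f t) ≤ ENNReal.ofReal
      (∫ r in s..t, (energy e (f r) (fun p => u (r, p)) ^ (1 / 2 : ℝ)).toReal) := by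
  rcases hst.eq_or_lt with rfl | hlt
  · simp [dA_self he]
  refine (dA_le_length he hlt (h.mono hs ht)).trans (le_of_eq ?_)
  have hsub : Icc s t ⊆ Icc 0 T := Icc_subset_Icc hs ht
  rw [intervalIntegral.integral_of_le hst, ← integral_Icc_eq_integral_Ioc,
    ofReal_integral_eq_lintegral_ofReal ((integrableOn_sqrt_energy h hE).mono_set hsub)
      (ae_of_all _ fun _ => ENNReal.toReal_nonneg)]
  refine lintegral_congr_ae ?_
  filter_upwards [ae_restrict_of_ae_restrict_of_subset hsub (ae_sqrt_energy_lt_top h hE)]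
    with r hr
  rw [ENNReal.ofReal_toReal hr.ne]

theorem sq_sqrt_energy {x : ℝ≥0∞} (hx : x ^ (1 / 2 : ℝ) < ⊤) :
    ENNReal.ofReal (x ^ (1 / 2 : ℝ)).toReal ^ 2 = x := by
  rw [ENNReal.ofReal_toReal hx.ne, ← ENNReal.rpow_natCast, ← ENNReal.rpow_mul]
  norm_num

end DensitySolution

theorem memLp_two_of_lintegral_sq {T : ℝ} {m : ℝ → ℝ} (hm : AEStronglyMeasurable m
    (volume.restrict (Ioo 0 T))) (hm0 : ∀ t, 0 ≤ m t)
    (h : ∫⁻ t in Ioo 0 T, ENNReal.ofReal (m t) ^ 2 < ⊤) : MemLp m 2 (volume.restrict (Ioo 0 T)) := by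
  rw [memLp_two_iff_integrable_sq hm]
  refine ⟨hm.pow 2, ?_⟩
  rw [hasFiniteIntegral_iff_ofReal (ae_of_all _ fun t => sq_nonneg _)]
  refine lt_of_eq_of_lt (lintegral_congr fun t => ?_) h
  rw [ENNReal.ofReal_pow (hm0 t)]

/-- The square root of the action is an admissible bound `m` for the increments, and the metric
derivative is the least one. The same `m` serves both exponents. -/
theorem isAC_and_metricDeriv_of_GCE {e T : ℝ} (he : e < 1) (hT : 0 < T)
    {f : ℝ → ProbabilityMeasure ℝ} {U : ℝ → SignedMeasure OffDiag} (h : GCE e T f U)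
    (hA : ∫⁻ t in Icc 0 T, action e (f t) (U t) ^ (1 / 2 : ℝ) < ⊤) :
    IsAC e 1 T f ∧ (∫⁻ t in Icc 0 T, action e (f t) (U t) < ⊤ → IsAC e 2 T f) ∧
      HasFluxDensity T f U ∧
      ∀ᵐ t ∂(volume.restrict (Icc 0 T)), ∃ r : ℝ≥0∞,
        HasMetricDeriv e f t r ∧ r ^ 2 ≤ action e (f t) (U t) := by
  obtain ⟨u, hu, hae⟩ := exists_density_of_GCE he hT h hA
  have hclamp : ∀ t ∈ Icc 0 T, f (projIcc 0 T hT.le t) = f t := fun t ht => by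
    rw [projIcc_of_mem hT.le ht]
  have hEA : ∀ᵐ t ∂(volume.restrict (Icc 0 T)),
      energy e (f (projIcc 0 T hT.le t)) (fun p => u (t, p)) = action e (f t) (U t) := by
    filter_upwards [hae, ae_restrict_mem measurableSet_Icc] with t ht htm
    rw [hclamp t htm, ht.2.2]
  have hE : ∫⁻ t in Icc 0 T, energy e (f (projIcc 0 T hT.le t)) (fun p => u (t, p))
      ^ (1 / 2 : ℝ) < ⊤ := by
    refine lt_of_eq_of_lt (lintegral_congr_ae ?_) hA
    filter_upwards [hEA] with t ht
    rw [ht]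
  set m : ℝ → ℝ := fun t =>
    (energy e (f (projIcc 0 T hT.le t)) (fun p => u (t, p)) ^ (1 / 2 : ℝ)).toReal with hm
  have hm0 : ∀ t, 0 ≤ m t := fun t => ENNReal.toReal_nonneg
  have hmi : IntegrableOn m (Ioo 0 T) :=
    (integrableOn_sqrt_energy hu hE).mono_set Ioo_subset_Icc_self
  have hmsq : ∀ᵐ t ∂(volume.restrict (Icc 0 T)),
      ENNReal.ofReal (m t) ^ 2 = action e (f t) (U t) := by
    filter_upwards [ae_sqrt_energy_lt_top hu hE, hEA] with t ht ht'
    rw [hm, sq_sqrt_energy ht, ht']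
  have hd : ∀ s t : ℝ, 0 < s → s ≤ t → t < T →
      dA e (f s) (f t) ≤ ENNReal.ofReal (∫ r in s..t, m r) := by
    intro s t hs hst ht
    have := dA_le_integral_sqrt_energy he hu hE hs.le hst ht.le
    rwa [hclamp s ⟨hs.le, hst.trans ht.le⟩, hclamp t ⟨hs.le.trans hst, ht.le⟩] at this
  refine ⟨⟨m, hm0, memLp_one_iff_integrable.2 hmi, hd⟩, fun h2 => ⟨m, hm0, ?_, hd⟩,
    ⟨u, hu.meas, hae.mono fun t ht => ⟨ht.1, ht.2.1⟩⟩, ?_⟩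
  · refine memLp_two_of_lintegral_sq hmi.aestronglyMeasurable hm0 ?_
    rw [restrict_Ioo_eq_restrict_Icc]
    rwa [lintegral_congr_ae hmsq]
  · obtain ⟨n, -, hn0, -, hnm, -, hnd⟩ := exists_hasMetricDeriv he hm0 hmi hd
    filter_upwards [hnm, hnd, hmsq] with t h1 h2 h3
    refine ⟨_, h2, ?_⟩
    rw [← h3]
    gcongr

/-- The bracket `√(1 + v ^ 2)`. -/
def bracket (v : ℝ) : ℝ := √(1 + v ^ 2)

/-! ### First moments and truncated observables -/

theorem contDiff_bracket {n : ℕ∞} : ContDiff ℝ n bracket := by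
  unfold bracket
  exact (contDiff_const.add (contDiff_id.pow 2)).sqrt fun v => by positivity

theorem one_le_bracket (v : ℝ) : 1 ≤ bracket v :=
  Real.one_le_sqrt.2 (by nlinarith [sq_nonneg v])

theorem bracket_nonneg (v : ℝ) : 0 ≤ bracket v := zero_le_one.trans (one_le_bracket v)

theorem abs_le_bracket (v : ℝ) : |v| ≤ bracket v :=
  Real.abs_le_sqrt (by linarith)

theorem bracket_le (v : ℝ) : bracket v ≤ 1 + |v| := by
  unfold bracket
  rw [Real.sqrt_le_left (by positivity)]
  nlinarith [abs_nonneg v, sq_abs v]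

theorem abs_deriv_bracket_le (v : ℝ) : |deriv bracket v| ≤ 1 := by
  have h : HasDerivAt bracket (2 * v / (2 * √(1 + v ^ 2))) v := by
    have := ((hasDerivAt_id' v).pow 2).const_add 1 |>.sqrt (show (1 : ℝ) + v ^ 2 ≠ 0 by positivity)
    refine this.congr_deriv ?_
    simp
  rw [h.deriv, mul_div_mul_left _ _ two_ne_zero, abs_div, abs_of_nonneg (Real.sqrt_nonneg _)]
  exact div_le_one_of_le₀ (abs_le_bracket v) (bracket_nonneg v)

theorem measurable_bracket : Measurable bracket :=
  (contDiff_bracket (n := 0)).continuous.measurable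

/-- The first moment, up to comparison. -/
def moment (x : ProbabilityMeasure ℝ) : ℝ≥0∞ := ∫⁻ v, ENNReal.ofReal (bracket v) ∂(x : Measure ℝ)

theorem integrable_bracket {x : ProbabilityMeasure ℝ} (h : moment x < ⊤) :
    Integrable bracket (x : Measure ℝ) := by
  refine ⟨measurable_bracket.aestronglyMeasurable, ?_⟩
  rwa [hasFiniteIntegral_iff_ofReal (ae_of_all _ bracket_nonneg)]

theorem integral_bracket {x : ProbabilityMeasure ℝ} :
    ∫ v, bracket v ∂(x : Measure ℝ) = (moment x).toReal := by
  rw [integral_eq_lintegral_of_nonneg_ae (ae_of_all _ bracket_nonneg)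
    measurable_bracket.aestronglyMeasurable]
  rfl

theorem moment_lt_top {x : ProbabilityMeasure ℝ}
    (h : Integrable (fun v : ℝ => v) (x : Measure ℝ)) : moment x < ⊤ := by
  have : Integrable bracket (x : Measure ℝ) :=
    Integrable.mono' ((integrable_const 1).add h.abs) measurable_bracket.aestronglyMeasurable
      (ae_of_all _ fun v => by
        rw [Real.norm_eq_abs, abs_of_nonneg (bracket_nonneg v)]; exact bracket_le v)
  have h2 := this.2
  rwa [hasFiniteIntegral_iff_ofReal (ae_of_all _ bracket_nonneg)] at h2

theorem integrable_of_le_bracket {x : ProbabilityMeasure ℝ} (h : moment x < ⊤) {θ : ℝ → ℝ}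
    (hθ : Measurable θ) {C : ℝ} (hC : ∀ v, |θ v| ≤ C * bracket v) :
    Integrable θ (x : Measure ℝ) :=
  Integrable.mono' ((integrable_bracket h).const_mul C) hθ.aestronglyMeasurable
    (ae_of_all _ hC)

/-- Smooth compactly supported truncations of the identity. -/
theorem exists_truncations : ∃ (C : ℝ) (τ : ℕ → ℝ → ℝ), 1 ≤ C ∧ (∀ k, ContDiff ℝ 1 (τ k)) ∧
    (∀ k, HasCompactSupport (τ k)) ∧ (∀ k v, |deriv (τ k) v| ≤ C) ∧
    (∀ k v, |τ k v| ≤ C * |v|) ∧ ∀ v, Tendsto (fun k => τ k v) atTop (𝓝 v) := by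
  -- The factor is 1 for `|s| ≤ 1` and 0 for `s² ≥ 2`.
  set χ : ℝ → ℝ := fun s => s * Real.smoothTransition (2 - s ^ 2) with hχ
  have hχd : ContDiff ℝ 1 χ :=
    contDiff_id.mul (Real.smoothTransition.contDiff.comp (contDiff_const.sub (contDiff_id.pow 2)))
  have hχ0 : ∀ s, 2 ≤ |s| → χ s = 0 := fun s hs => by
    simp only [hχ]
    rw [Real.smoothTransition.zero_of_nonpos (by nlinarith [sq_abs s]), mul_zero]
  have hχc : HasCompactSupport χ := HasCompactSupport.intro (isCompact_Icc (a := -2) (b := 2))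
    fun s hs => hχ0 s (by
      by_contra! h
      exact hs ⟨by linarith [(abs_lt.1 h).1], by linarith [(abs_lt.1 h).2]⟩)
  obtain ⟨C', hC'⟩ := exists_deriv_bound hχd hχc
  set C := max C' 1
  have hC : ∀ v, |deriv χ v| ≤ C := fun v => (hC' v).trans (le_max_left _ _)
  have hk : ∀ k : ℕ, (0 : ℝ) < k + 1 := fun k => by positivity
  -- This scaling leaves the bound on the derivative unchanged while the region of identity grows.
  set τ : ℕ → ℝ → ℝ := fun k v => (k + 1) * χ (v / (k + 1)) with hτ
  have hτd : ∀ k v, HasDerivAt (τ k) (deriv χ (v / (k + 1))) v := fun k v => by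
    have h1 := ((hχd.differentiable one_ne_zero _).hasDerivAt (x := v / (k + 1))).comp v
      ((hasDerivAt_id v).div_const ((k : ℝ) + 1))
    have h2 := h1.const_mul ((k : ℝ) + 1)
    refine h2.congr_deriv ?_
    field_simp [(hk k).ne']
  have hτC : ∀ k, ContDiff ℝ 1 (τ k) := fun k =>
    contDiff_const.mul (hχd.comp (contDiff_id.div_const _))
  refine ⟨C, τ, le_max_right _ _, hτC, fun k => ?_, fun k v => ?_, fun k v => ?_, fun v => ?_⟩
  · refine HasCompactSupport.intro (isCompact_Icc (a := -(2 * ((k : ℝ) + 1)))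
      (b := 2 * (k + 1))) fun s hs => ?_
    simp only [hτ]
    rw [hχ0, mul_zero]
    by_contra! h
    rw [abs_div, abs_of_pos (hk k), div_lt_iff₀ (hk k)] at h
    exact hs ⟨by linarith [(abs_lt.1 h).1], by linarith [(abs_lt.1 h).2]⟩
  · rw [(hτd k v).deriv]; exact hC _
  · have := Convex.norm_image_sub_le_of_norm_deriv_le (f := τ k) (C := C) (s := univ) (x := 0)
      (y := v) (fun x _ => (hτC k).differentiable one_ne_zero x)
      (fun x _ => by rw [(hτd k x).deriv]; exact hC _) convex_univ (mem_univ _) (mem_univ _)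
    have h0 : τ k 0 = 0 := by simp [hτ, hχ]
    simpa [h0] using this
  · refine tendsto_const_nhds.congr' ?_
    obtain ⟨N, hN⟩ := exists_nat_gt |v|
    filter_upwards [eventually_ge_atTop N] with k hkN
    have h1 : |v / (k + 1)| ≤ 1 := by
      rw [abs_div, abs_of_pos (hk k), div_le_one (hk k)]
      have : (N : ℝ) ≤ k := by exact_mod_cast hkN
      linarith
    simp only [hτ, hχ]
    have h2 : (v / ((k : ℝ) + 1)) ^ 2 ≤ 1 := by
      rw [← sq_abs]; exact pow_le_one₀ (abs_nonneg _) h1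
    rw [Real.smoothTransition.one_of_one_le (by linarith), mul_one]
    field_simp [(hk k).ne']

/-- A bound for the derivatives of smooth truncations of the identity. -/
def truncBound : ℝ := exists_truncations.choose

/-- Smooth compactly supported truncations of the identity. -/
def trunc : ℕ → ℝ → ℝ := exists_truncations.choose_spec.choose

theorem one_le_truncBound : 1 ≤ truncBound := exists_truncations.choose_spec.choose_spec.1

theorem contDiff_trunc (k : ℕ) : ContDiff ℝ 1 (trunc k) :=
  exists_truncations.choose_spec.choose_spec.2.1 k

theorem hasCompactSupport_trunc (k : ℕ) : HasCompactSupport (trunc k) :=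
  exists_truncations.choose_spec.choose_spec.2.2.1 k

theorem abs_deriv_trunc_le (k : ℕ) (v : ℝ) : |deriv (trunc k) v| ≤ truncBound :=
  exists_truncations.choose_spec.choose_spec.2.2.2.1 k v

theorem abs_trunc_le (k : ℕ) (v : ℝ) : |trunc k v| ≤ truncBound * |v| :=
  exists_truncations.choose_spec.choose_spec.2.2.2.2.1 k v

theorem tendsto_trunc (v : ℝ) : Tendsto (fun k => trunc k v) atTop (𝓝 v) :=
  exists_truncations.choose_spec.choose_spec.2.2.2.2.2 v

theorem abs_sub_le_of_deriv_bound {θ : ℝ → ℝ} (hθ : ContDiff ℝ 1 θ) {C : ℝ}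
    (hC : ∀ v, |deriv θ v| ≤ C) (v w : ℝ) : |θ v - θ w| ≤ C * |v - w| :=
  Convex.norm_image_sub_le_of_norm_deriv_le (f := θ) (C := C) (s := univ) (x := w) (y := v)
    (fun x _ => hθ.differentiable one_ne_zero x) (fun x _ => hC x) convex_univ (mem_univ _)
    (mem_univ _)

theorem abs_le_of_deriv_bound {θ : ℝ → ℝ} (hθ : ContDiff ℝ 1 θ) {C : ℝ}
    (hC : ∀ v, |deriv θ v| ≤ C) (v : ℝ) : |θ v| ≤ (|θ 0| + C) * bracket v := by
  have h1 := abs_sub_le_of_deriv_bound hθ hC v 0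
  have h2 : |θ v| ≤ |θ v - θ 0| + |θ 0| := by
    have := abs_add_le (θ v - θ 0) (θ 0); simpa using this
  have h3 : 0 ≤ C := (abs_nonneg _).trans (hC 0)
  rw [sub_zero] at h1
  nlinarith [abs_le_bracket v, one_le_bracket v, abs_nonneg (θ 0), abs_nonneg v]

section Truncated

variable {θ : ℝ → ℝ} {C : ℝ}

/-- Composition with a truncation makes a Lipschitz observable admissible as a test function: after
subtracting `θ 0` it has compact support, and its derivative is bounded uniformly in `k`. -/
theorem contDiff_comp_trunc (hθ : ContDiff ℝ 1 θ) (k : ℕ) :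
    ContDiff ℝ 1 fun v => θ (trunc k v) - θ 0 :=
  (hθ.comp (contDiff_trunc k)).sub contDiff_const

theorem hasCompactSupport_comp_trunc (k : ℕ) :
    HasCompactSupport fun v => θ (trunc k v) - θ 0 := by
  refine (hasCompactSupport_trunc k).comp_left (g := fun s => θ s - θ 0) (sub_self _)

theorem abs_deriv_comp_trunc_le (hθ : ContDiff ℝ 1 θ) (hC : ∀ v, |deriv θ v| ≤ C) (k : ℕ)
    (v : ℝ) : |deriv (fun v => θ (trunc k v) - θ 0) v| ≤ C * truncBound := by
  have h := (((hθ.differentiable one_ne_zero _).hasDerivAt (x := trunc k v)).comp v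
    ((contDiff_trunc k).differentiable one_ne_zero v).hasDerivAt).sub_const (θ 0)
  have h' : deriv (fun v => θ (trunc k v) - θ 0) v = _ := h.deriv
  rw [h', abs_mul]
  exact mul_le_mul (hC _) (abs_deriv_trunc_le k v) (abs_nonneg _) ((abs_nonneg _).trans (hC 0))

end Truncated

/-! ### Propagation of moments and of Lipschitz observables -/

namespace IsDensitySolution

variable {e : ℝ} {g : ℝ → ProbabilityMeasure ℝ} {u : ℝ × OffDiag → ℝ}

/-- The total mass of the weighted flux. -/
def totalMass (e : ℝ) (g : ℝ → ProbabilityMeasure ℝ) (u : ℝ × OffDiag → ℝ) : ℝ :=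
  (∫⁻ t in Icc (0 : ℝ) 1, fluxMass e (g t) (fun p => u (t, p))).toReal

theorem totalMass_nonneg : 0 ≤ totalMass e g u := ENNReal.toReal_nonneg

theorem integral_mass (h : IsDensitySolution e 0 1 g u) :
    ∫ t in Icc (0 : ℝ) 1, (fluxMass e (g t) (fun p => u (t, p))).toReal = totalMass e g u :=
  integral_toReal (measurable_fluxMass e h.cont h.meas).aemeasurable h.ae_mass_lt_top

theorem abs_integral_sub_le (he : e < 1) (h : IsDensitySolution e 0 1 g u) {ψ : ℝ → ℝ}
    (hψ : ContDiff ℝ 1 ψ) (hc : HasCompactSupport ψ) {C : ℝ} (hC : ∀ v, |deriv ψ v| ≤ C)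
    {r : ℝ} (hr : r ∈ Icc (0 : ℝ) 1) :
    |(∫ v, ψ v ∂(g r : Measure ℝ)) - ∫ v, ψ v ∂(g 0 : Measure ℝ)| ≤ 2 * C * totalMass e g u := by
  have hC0 : 0 ≤ C := (abs_nonneg _).trans (hC 0)
  rw [h.eq ψ hψ hc 0 r le_rfl hr.1 hr.2, intervalIntegral.integral_of_le hr.1, ← h.integral_mass,
    ← integral_const_mul, ← Real.norm_eq_abs]
  have hsub : Ioc 0 r ⊆ Icc (0 : ℝ) 1 := Ioc_subset_Icc_self.trans (Icc_subset_Icc_right hr.2)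
  have hi : IntegrableOn (fun t => 2 * C * (fluxMass e (g t) (fun p => u (t, p))).toReal)
      (Icc 0 1) := h.integrableOn_mass.const_mul (2 * C)
  refine (norm_integral_le_of_norm_le (hi.mono_set hsub) ?_).trans
    (setIntegral_mono_set hi ?_ hsub.eventuallyLE)
  · filter_upwards [ae_restrict_of_ae_restrict_of_subset hsub h.ae_mass_lt_top] with t ht
    exact abs_fluxPair_le he (h.meas.comp measurable_prodMk_left) ht hC
  · exact ae_of_all _ fun t => mul_nonneg (by positivity) ENNReal.toReal_nonneg

theorem tendsto_integral_comp_trunc {x : ProbabilityMeasure ℝ} (hx : moment x < ⊤) {θ : ℝ → ℝ}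
    (hθ : ContDiff ℝ 1 θ) {C : ℝ} (hC : ∀ v, |deriv θ v| ≤ C) :
    Tendsto (fun k => ∫ v, θ (trunc k v) - θ 0 ∂(x : Measure ℝ)) atTop
      (𝓝 (∫ v, θ v - θ 0 ∂(x : Measure ℝ))) := by
  have hC0 : 0 ≤ C := (abs_nonneg _).trans (hC 0)
  refine tendsto_integral_of_dominated_convergence (fun v => C * truncBound * bracket v)
    (fun k => (contDiff_comp_trunc hθ k).continuous.aestronglyMeasurable)
    ((integrable_bracket hx).const_mul _) (fun k => ae_of_all _ fun v => ?_)
    (ae_of_all _ fun v => ?_)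
  · rw [Real.norm_eq_abs, mul_assoc]
    refine (abs_sub_le_of_deriv_bound hθ hC _ _).trans (mul_le_mul_of_nonneg_left ?_ hC0)
    rw [sub_zero]
    exact (abs_trunc_le k v).trans (mul_le_mul_of_nonneg_left (abs_le_bracket v)
      (zero_le_one.trans one_le_truncBound))
  · exact ((hθ.continuous.tendsto v).comp (tendsto_trunc v)).sub_const _

/-- The truncated bracket grows along the curve by at most twice its Lipschitz bound times the mass
of the flux. Fatou's lemma removes the truncation at the later time and dominated convergence at the
initial one. -/
theorem moment_le (he : e < 1) (h : IsDensitySolution e 0 1 g u) (h0 : moment (g 0) < ⊤)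
    {r : ℝ} (hr : r ∈ Icc (0 : ℝ) 1) :
    moment (g r) ≤ moment (g 0) + ENNReal.ofReal (2 * truncBound * totalMass e g u) := by
  set a : ℕ → ℝ → ℝ := fun k v => bracket (trunc k v) - bracket 0 with ha
  have hJ : ContDiff ℝ 1 bracket := contDiff_bracket (n := 1)
  have hb0 : bracket 0 = 1 := by simp [bracket]
  have ha0 : ∀ k v, 0 ≤ a k v := fun k v => by
    simp only [ha, hb0]; linarith [one_le_bracket (trunc k v)]
  have hac : ∀ k, Continuous (a k) := fun k => (contDiff_comp_trunc hJ k).continuous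
  have hai : ∀ k (x : ProbabilityMeasure ℝ), Integrable (a k) (x : Measure ℝ) := fun k x =>
    (hac k).integrable_of_hasCompactSupport (hasCompactSupport_comp_trunc k)
  have hstep : ∀ k, ∫ v, a k v ∂(g r : Measure ℝ)
      ≤ ∫ v, a k v ∂(g 0 : Measure ℝ) + 2 * truncBound * totalMass e g u := fun k => by
    have := (abs_le.1 (h.abs_integral_sub_le he (contDiff_comp_trunc hJ k)
      (hasCompactSupport_comp_trunc k) (abs_deriv_comp_trunc_le hJ abs_deriv_bracket_le k) hr)).2
    rw [one_mul] at this
    linarith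
  have hint : ∀ v, ENNReal.ofReal (bracket v) = 1 + ENNReal.ofReal (bracket v - bracket 0) :=
    fun v => by
      rw [← ENNReal.ofReal_one, ← ENNReal.ofReal_add zero_le_one
        (by rw [hb0]; linarith [one_le_bracket v]), hb0]
      congr 1; ring
  have hfat : ∫⁻ v, ENNReal.ofReal (bracket v - bracket 0) ∂(g r : Measure ℝ)
      ≤ ENNReal.ofReal (∫ v, bracket v - bracket 0 ∂(g 0 : Measure ℝ)
        + 2 * truncBound * totalMass e g u) := by
    have h1 : ∀ v, ENNReal.ofReal (bracket v - bracket 0)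
        = liminf (fun k => ENNReal.ofReal (a k v)) atTop := fun v =>
      (((ENNReal.continuous_ofReal.tendsto _).comp
        (((hJ.continuous.tendsto v).comp (tendsto_trunc v)).sub_const _)).liminf_eq).symm
    simp_rw [h1]
    refine (lintegral_liminf_le fun k => (hac k).measurable.ennreal_ofReal).trans ?_
    have h2 : Tendsto (fun k => ENNReal.ofReal (∫ v, a k v ∂(g 0 : Measure ℝ)
        + 2 * truncBound * totalMass e g u)) atTop (𝓝 _) :=
      ENNReal.tendsto_ofReal
        ((tendsto_integral_comp_trunc h0 hJ abs_deriv_bracket_le).add_const _)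
    rw [← h2.liminf_eq]
    refine liminf_le_liminf (Eventually.of_forall fun k => ?_)
    rw [← ofReal_integral_eq_lintegral_ofReal (hai k _) (ae_of_all _ (ha0 k))]
    exact ENNReal.ofReal_le_ofReal (hstep k)
  have hnn : 0 ≤ 2 * truncBound * totalMass e g u :=
    mul_nonneg (by linarith [one_le_truncBound]) totalMass_nonneg
  have hb : ∀ v, 0 ≤ bracket v - bracket 0 := fun v => by
    rw [hb0]; linarith [one_le_bracket v]
  unfold moment
  simp_rw [hint]
  rw [lintegral_add_left measurable_const, lintegral_add_left measurable_const, add_assoc]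
  simp only [lintegral_const, measure_univ, mul_one]
  refine add_le_add_right (hfat.trans (le_of_eq ?_)) _
  have hbi : Integrable (fun v => bracket v - bracket 0) (g 0 : Measure ℝ) :=
    (integrable_bracket h0).sub (integrable_const _)
  rw [ENNReal.ofReal_add (integral_nonneg hb) hnn,
    ofReal_integral_eq_lintegral_ofReal hbi (ae_of_all _ hb)]

theorem moment_lt_top' (he : e < 1) (h : IsDensitySolution e 0 1 g u) (h0 : moment (g 0) < ⊤)
    {r : ℝ} (hr : r ∈ Icc (0 : ℝ) 1) : moment (g r) < ⊤ :=
  (h.moment_le he h0 hr).trans_lt (ENNReal.add_lt_top.2 ⟨h0, ENNReal.ofReal_lt_top⟩)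

/-- The estimate for truncated observables passes to the limit, since both measures have finite
first moment. The truncation costs the factor `truncBound`. -/
theorem abs_integral_sub_le_of_deriv_bound (he : e < 1) (h : IsDensitySolution e 0 1 g u)
    (h0 : moment (g 0) < ⊤) {θ : ℝ → ℝ} (hθ : ContDiff ℝ 1 θ) {C : ℝ}
    (hC : ∀ v, |deriv θ v| ≤ C) {r : ℝ} (hr : r ∈ Icc (0 : ℝ) 1) :
    |(∫ v, θ v ∂(g r : Measure ℝ)) - ∫ v, θ v ∂(g 0 : Measure ℝ)|
      ≤ 2 * truncBound * totalMass e g u * C := by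
  have hr' := h.moment_lt_top' he h0 hr
  have hlim := ((tendsto_integral_comp_trunc hr' hθ hC).sub
    (tendsto_integral_comp_trunc h0 hθ hC)).abs
  have hi : ∀ {x : ProbabilityMeasure ℝ}, moment x < ⊤ → Integrable θ (x : Measure ℝ) := fun hx =>
    integrable_of_le_bracket hx hθ.continuous.measurable (abs_le_of_deriv_bound hθ hC)
  rw [integral_sub (hi hr') (integrable_const _), integral_sub (hi h0) (integrable_const _)] at hlim
  simp only [integral_const, probReal_univ, one_smul, sub_sub_sub_cancel_right] at hlim
  refine le_of_tendsto hlim (Eventually.of_forall fun k => ?_)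
  refine (h.abs_integral_sub_le he (contDiff_comp_trunc hθ k)
      (hasCompactSupport_comp_trunc k) (abs_deriv_comp_trunc_le hθ hC k) hr).trans (le_of_eq ?_)
  ring

end IsDensitySolution

/-! ### Cauchy–Schwarz estimates by the energy -/

theorem lintegral_weight_mul_le {e : ℝ} (he : e < 1) (x : ProbabilityMeasure ℝ)
    {a b : OffDiag → ℝ} (ha : Measurable a) (hb : Measurable b) :
    ∫⁻ p, ENNReal.ofReal (weight e p * |a p * b p|) ∂prodOff x
      ≤ energy e x a ^ (1 / 2 : ℝ) * energy e x b ^ (1 / 2 : ℝ) := by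
  have hw := measurable_weight e
  have h := ENNReal.lintegral_mul_le_Lp_mul_Lq (prodOff x) Real.HolderConjugate.two_two
    (f := fun p => ENNReal.ofReal (√(weight e p) * |a p|))
    (g := fun p => ENNReal.ofReal (√(weight e p) * |b p|))
    (by fun_prop) (by fun_prop)
  have e1 : ∀ (c : OffDiag → ℝ) p, ENNReal.ofReal (√(weight e p) * |c p|) ^ (2 : ℝ)
      = ENNReal.ofReal (weight e p * c p ^ 2) := fun c p => by
    rw [ENNReal.ofReal_rpow_of_nonneg (by positivity) zero_le_two, Real.rpow_two, mul_pow,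
      Real.sq_sqrt (weight_nonneg he p), sq_abs]
  simp only [e1] at h
  refine le_trans (le_of_eq (lintegral_congr fun p => ?_)) h
  rw [Pi.mul_apply, ← ENNReal.ofReal_mul (by positivity), abs_mul]
  congr 1
  have := Real.mul_self_sqrt (weight_nonneg he p)
  linear_combination (-|a p| * |b p|) * this

theorem energy_one_le {e : ℝ} (he₀ : 0 ≤ e) (he : e < 1) (x : ProbabilityMeasure ℝ) :
    energy e x (fun _ => 1) ≤ 2 * moment x := by
  have hb := measurable_bracket
  have hm := measurable_bracket.ennreal_ofReal
  calc energy e x (fun _ => 1)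
      ≤ ∫⁻ p, (ENNReal.ofReal (bracket p.1.1) + ENNReal.ofReal (bracket p.1.2)) ∂prodOff x := by
        refine lintegral_mono fun p => ?_
        rw [← ENNReal.ofReal_add (bracket_nonneg _) (bracket_nonneg _)]
        refine ENNReal.ofReal_le_ofReal ?_
        have := weight_le he₀ he p
        have := abs_le_bracket p.1.1
        have := abs_le_bracket p.1.2
        simp only [one_pow, mul_one]
        linarith
    _ ≤ ∫⁻ p, (ENNReal.ofReal (bracket p.1) + ENNReal.ofReal (bracket p.2))
          ∂((x : Measure ℝ).prod (x : Measure ℝ)) :=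
        lintegral_prodOff_le x fun p => ENNReal.ofReal (bracket p.1) + ENNReal.ofReal (bracket p.2)
    _ = _ := by
        rw [lintegral_add_left (f := fun p : ℝ × ℝ => ENNReal.ofReal (bracket p.1))
            (hm.comp measurable_fst),
          lintegral_prod _ (by fun_prop), lintegral_prod _ (by fun_prop)]
        simp [moment, two_mul]

/-- Cauchy–Schwarz against the constant 1. The weight grows linearly, which is where the first
moment is needed. -/
theorem fluxMass_le {e : ℝ} (he₀ : 0 ≤ e) (he : e < 1) (x : ProbabilityMeasure ℝ)
    {w : OffDiag → ℝ} (hw : Measurable w) :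
    fluxMass e x w ≤ (2 * moment x) ^ (1 / 2 : ℝ) * energy e x w ^ (1 / 2 : ℝ) := by
  have h := lintegral_weight_mul_le he x (a := fun _ => 1) measurable_const hw
  simp only [one_mul] at h
  exact h.trans (mul_le_mul_left (ENNReal.rpow_le_rpow (energy_one_le he₀ he x) (by norm_num)) _)

theorem energy_nlGrad_le {e : ℝ} (he : e < 1) (x : ProbabilityMeasure ℝ) {ψ : ℝ → ℝ} {C : ℝ}
    (hC : ∀ v, |deriv ψ v| ≤ C) :
    energy e x (nlGrad ψ) ≤ ENNReal.ofReal ((2 * C) ^ 2) * energy e x (fun _ => 1) := by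
  rw [energy, energy, ← lintegral_const_mul' _ _ ENNReal.ofReal_ne_top]
  refine lintegral_mono fun p => ?_
  rw [← ENNReal.ofReal_mul (sq_nonneg _)]
  refine ENNReal.ofReal_le_ofReal ?_
  have h2 : nlGrad ψ p ^ 2 ≤ (2 * C) ^ 2 := sq_le_sq' (by linarith [(abs_le.1 (abs_nlGrad_le hC p)).1])
    (abs_le.1 (abs_nlGrad_le hC p)).2
  nlinarith [weight_nonneg he p]

theorem energy_nlGrad_lt_top {e : ℝ} (he₀ : 0 ≤ e) (he : e < 1) {x : ProbabilityMeasure ℝ}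
    (hx : moment x < ⊤) {ψ : ℝ → ℝ} {C : ℝ} (hC : ∀ v, |deriv ψ v| ≤ C) :
    energy e x (nlGrad ψ) < ⊤ :=
  (energy_nlGrad_le he x hC).trans_lt (ENNReal.mul_lt_top ENNReal.ofReal_lt_top
    ((energy_one_le he₀ he x).trans_lt (ENNReal.mul_lt_top (by simp) hx)))

theorem ofReal_abs_fluxPair_le {e : ℝ} (he : e < 1) (x : ProbabilityMeasure ℝ) {w : OffDiag → ℝ}
    (hw : Measurable w) (ψ : ℝ → ℝ) :
    ENNReal.ofReal |fluxPair e x w ψ|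
      ≤ energy e x (nlGrad ψ) ^ (1 / 2 : ℝ) * energy e x w ^ (1 / 2 : ℝ) := by
  refine le_trans ?_ (lintegral_weight_mul_le he x (measurable_nlGrad ψ) hw)
  rw [← Real.norm_eq_abs, fluxPair, ofReal_norm]
  refine (enorm_integral_le_lintegral_enorm _).trans (le_of_eq (lintegral_congr fun p => ?_))
  rw [← ofReal_norm, Real.norm_eq_abs, mul_assoc, abs_mul, abs_of_pos (weight_pos he p)]

namespace IsDensitySolution

variable {e : ℝ} {g : ℝ → ProbabilityMeasure ℝ} {u : ℝ × OffDiag → ℝ}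

/-- The estimate is circular: the mass bounds the moments along the curve, and the moments with the
energy bound the mass. The mass enters the right side only linearly, so the circle can be closed. -/
theorem totalMass_sq_le (he₀ : 0 ≤ e) (he : e < 1) (h : IsDensitySolution e 0 1 g u)
    (h0 : moment (g 0) < ⊤) {D : ℝ}
    (hE : ∫⁻ t in Icc (0 : ℝ) 1, energy e (g t) (fun p => u (t, p)) ≤ ENNReal.ofReal (D ^ 2)) :
    totalMass e g u ^ 2
      ≤ 2 * ((moment (g 0)).toReal + 2 * truncBound * totalMass e g u) * D ^ 2 := by
  set K := totalMass e g u with hK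
  have hK0 : 0 ≤ K := totalMass_nonneg
  have hT : 0 ≤ 2 * truncBound * K := mul_nonneg (by linarith [one_le_truncBound]) hK0
  set B : ℝ := (moment (g 0)).toReal + 2 * truncBound * K with hB
  have hB0 : 0 ≤ B := add_nonneg ENNReal.toReal_nonneg hT
  have hmom : ∀ r ∈ Icc (0 : ℝ) 1, moment (g r) ≤ ENNReal.ofReal B := fun r hr => by
    rw [hB, ENNReal.ofReal_add ENNReal.toReal_nonneg hT, ENNReal.ofReal_toReal h0.ne]
    exact h.moment_le he h0 hr
  have hEm := measurable_energy e h.cont h.meas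
  have h1 : ENNReal.ofReal K ≤ (2 * ENNReal.ofReal B) ^ (1 / 2 : ℝ)
      * ENNReal.ofReal (D ^ 2) ^ (1 / 2 : ℝ) := by
    rw [hK, totalMass, ENNReal.ofReal_toReal h.mass.ne]
    calc _ ≤ ∫⁻ t in Icc (0 : ℝ) 1, (2 * ENNReal.ofReal B) ^ (1 / 2 : ℝ)
          * energy e (g t) (fun p => u (t, p)) ^ (1 / 2 : ℝ) := by
          refine setLIntegral_mono' measurableSet_Icc fun t ht => ?_
          refine (fluxMass_le he₀ he (g t) (h.meas.comp measurable_prodMk_left)).trans ?_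
          refine mul_le_mul_left (ENNReal.rpow_le_rpow ?_ (by norm_num)) _
          exact mul_le_mul_right (hmom t ht) _
      _ = (2 * ENNReal.ofReal B) ^ (1 / 2 : ℝ)
          * ∫⁻ t in Icc (0 : ℝ) 1, energy e (g t) (fun p => u (t, p)) ^ (1 / 2 : ℝ) :=
          lintegral_const_mul _ (hEm.pow_const _)
      _ ≤ _ := by
          refine mul_le_mul_right ((lintegral_rpow_half_le_of_unit hEm).trans ?_) _
          exact ENNReal.rpow_le_rpow hE (by norm_num)
  rw [← ENNReal.mul_rpow_of_nonneg _ _ (by norm_num), ← ENNReal.ofReal_ofNat 2,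
    ← ENNReal.ofReal_mul zero_le_two, ← ENNReal.ofReal_mul (by positivity),
    ENNReal.ofReal_rpow_of_nonneg (by positivity) (by norm_num),
    ENNReal.ofReal_le_ofReal_iff (by positivity), ← Real.sqrt_eq_rpow] at h1
  calc K ^ 2 ≤ √(2 * B * D ^ 2) ^ 2 := pow_le_pow_left₀ hK0 h1 2
    _ = _ := Real.sq_sqrt (by positivity)

/-- The mass of a flux is controlled by its energy and the initial moment. -/
theorem totalMass_le (he₀ : 0 ≤ e) (he : e < 1) (h : IsDensitySolution e 0 1 g u)
    (h0 : moment (g 0) < ⊤) {D : ℝ} (hD : 0 ≤ D)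
    (hE : ∫⁻ t in Icc (0 : ℝ) 1, energy e (g t) (fun p => u (t, p)) ≤ ENNReal.ofReal (D ^ 2)) :
    totalMass e g u ≤ 4 * truncBound * D ^ 2 + √(2 * (moment (g 0)).toReal) * D := by
  have h1 := h.totalMass_sq_le he₀ he h0 hE
  set K := totalMass e g u
  set M := (moment (g 0)).toReal
  have hM : 0 ≤ M := ENNReal.toReal_nonneg
  have hc := one_le_truncBound
  have hs := Real.sq_sqrt (show 0 ≤ 2 * M by positivity)
  have hs0 := Real.sqrt_nonneg (2 * M)
  set s := √(2 * M)
  have hK0 : 0 ≤ K := totalMass_nonneg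
  -- With `K` above the sum, `K²` exceeds `4 truncBound D² K + (s D) K`, and `s D ≤ K` turns the
  -- last term into at least `2 M D²`. This contradicts the quadratic inequality.
  by_contra! hlt
  have hb : 0 ≤ 4 * truncBound * D ^ 2 := by positivity
  have hsD : 0 ≤ s * D := by positivity
  have hKs : s * D ≤ K := by linarith
  nlinarith [mul_le_mul_of_nonneg_left hKs hsD]

end IsDensitySolution

/-- A regularisation of `|v - s| * (ψ' s - ψ' v) ^ 2`. -/
def regEnergy (ψ : ℝ → ℝ) (δ s v : ℝ) : ℝ := √(δ ^ 2 + (v - s) ^ 2) * (deriv ψ s - deriv ψ v) ^ 2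

/-! ### Dependence of the gradient energy on the measure -/

theorem regEnergy_comm (ψ : ℝ → ℝ) (δ s v : ℝ) : regEnergy ψ δ s v = regEnergy ψ δ v s := by
  unfold regEnergy
  rw [show (v - s) ^ 2 = (s - v) ^ 2 by ring]
  ring

theorem sqrt_add_sq_le {δ : ℝ} (hδ : 0 ≤ δ) (a : ℝ) : √(δ ^ 2 + a ^ 2) ≤ δ + |a| := by
  rw [Real.sqrt_le_left (by positivity)]
  nlinarith [abs_nonneg a, sq_abs a, mul_nonneg hδ (abs_nonneg a)]

theorem sq_sub_deriv_le {ψ : ℝ → ℝ} {C : ℝ} (hC : ∀ v, |deriv ψ v| ≤ C) (s v : ℝ) :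
    (deriv ψ s - deriv ψ v) ^ 2 ≤ 4 * C ^ 2 := by
  have h1 := abs_le.1 (hC s)
  have h2 := abs_le.1 (hC v)
  nlinarith [sq_le_sq' (show -(2 * C) ≤ deriv ψ s - deriv ψ v by linarith)
    (show deriv ψ s - deriv ψ v ≤ 2 * C by linarith)]

theorem regEnergy_nonneg (ψ : ℝ → ℝ) (δ s v : ℝ) : 0 ≤ regEnergy ψ δ s v :=
  mul_nonneg (Real.sqrt_nonneg _) (sq_nonneg _)

theorem regEnergy_le {ψ : ℝ → ℝ} {C δ : ℝ} (hC : ∀ v, |deriv ψ v| ≤ C) (hδ : 0 ≤ δ) (s v : ℝ) :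
    regEnergy ψ δ s v ≤ regEnergy ψ 0 s v + 4 * C ^ 2 * δ := by
  have h1 := sqrt_add_sq_le hδ (v - s)
  have h2 := sq_sub_deriv_le hC s v
  have h3 : √(0 ^ 2 + (v - s) ^ 2) = |v - s| := by
    rw [zero_pow two_ne_zero, zero_add, Real.sqrt_sq_eq_abs]
  unfold regEnergy
  rw [h3]
  nlinarith [sq_nonneg (deriv ψ s - deriv ψ v)]

theorem regEnergy_zero_le (ψ : ℝ → ℝ) (δ s v : ℝ) : regEnergy ψ 0 s v ≤ regEnergy ψ δ s v := by
  unfold regEnergy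
  exact mul_le_mul_of_nonneg_right (Real.sqrt_le_sqrt (by nlinarith [sq_nonneg δ])) (sq_nonneg _)

theorem continuous_regEnergy {ψ : ℝ → ℝ} (hψ : ContDiff ℝ 1 ψ) (δ : ℝ) :
    Continuous fun p : ℝ × ℝ => regEnergy ψ δ p.1 p.2 := by
  unfold regEnergy
  have := hψ.continuous_deriv le_rfl
  fun_prop

theorem contDiff_regEnergy {ψ : ℝ → ℝ} (hψ : ContDiff ℝ 2 ψ) {δ : ℝ} (hδ : 0 < δ) (s : ℝ) :
    ContDiff ℝ 1 (regEnergy ψ δ s) := by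
  have h1 : ContDiff ℝ 1 (deriv ψ) := by
    have := (contDiff_succ_iff_deriv (n := 1) (f := ψ)).1 (by rw [one_add_one_eq_two]; exact hψ)
    exact this.2.2
  unfold regEnergy
  refine ContDiff.mul (ContDiff.sqrt ?_ fun v => by positivity) ((contDiff_const.sub h1).pow 2)
  exact contDiff_const.add ((contDiff_id.sub contDiff_const).pow 2)

/-- The bound is uniform in `δ`, so the regularisation can be removed later. It is uniform in `v`
because the compact support of `ψ''` absorbs the growth of the square root in `v`; the growth in `s`
remains and is paid for by the first moment. -/
theorem exists_deriv_regEnergy_bound {ψ : ℝ → ℝ} (hψ : ContDiff ℝ 2 ψ)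
    (hc : HasCompactSupport ψ) : ∃ L, 0 ≤ L ∧ ∀ δ, 0 < δ → δ ≤ 1 → ∀ s v,
      |deriv (regEnergy ψ δ s) v| ≤ L * bracket s := by
  have hψ1 : ContDiff ℝ 1 ψ := hψ.of_le one_le_two
  have h1 : ContDiff ℝ 1 (deriv ψ) := by
    have := (contDiff_succ_iff_deriv (n := 1) (f := ψ)).1 (by rw [one_add_one_eq_two]; exact hψ)
    exact this.2.2
  obtain ⟨C, hC⟩ := exists_deriv_bound hψ1 hc
  have hC0 : 0 ≤ C := (abs_nonneg _).trans (hC 0)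
  have hc2 : HasCompactSupport fun v => deriv (deriv ψ) v * (1 + |v|) := hc.deriv.deriv.mul_right
  obtain ⟨B, hB⟩ := ((h1.continuous_deriv le_rfl).mul
    (continuous_const.add continuous_abs)).bounded_above_of_compact_support hc2
  have hB0 : 0 ≤ B := (norm_nonneg _).trans (hB 0)
  refine ⟨4 * C ^ 2 + 8 * C * B, by positivity, fun δ hδ hδ1 s v => ?_⟩
  set R := √(δ ^ 2 + (v - s) ^ 2) with hR
  have hRpos : 0 < R := Real.sqrt_pos.2 (by positivity)
  set Δ := deriv ψ s - deriv ψ v with hΔ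
  have hd : HasDerivAt (regEnergy ψ δ s)
      ((2 * (v - s)) / (2 * R) * Δ ^ 2 + R * (2 * Δ * (-deriv (deriv ψ) v))) v := by
    have a1 := ((((hasDerivAt_id' v).sub_const s).pow 2).const_add (δ ^ 2)).sqrt
      (show δ ^ 2 + (v - s) ^ 2 ≠ 0 by positivity)
    have a2 := (((h1.differentiable one_ne_zero v).hasDerivAt).const_sub (deriv ψ s)).pow 2
    refine (a1.mul a2).congr_deriv ?_
    simp [hR, hΔ]
  rw [hd.deriv]
  have hvR : |v - s| ≤ R := Real.abs_le_sqrt (by nlinarith [sq_nonneg δ])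
  have b1 : |(2 * (v - s)) / (2 * R) * Δ ^ 2| ≤ 4 * C ^ 2 := by
    rw [mul_div_mul_left _ _ two_ne_zero, abs_mul, abs_div, abs_of_pos hRpos,
      abs_of_nonneg (sq_nonneg Δ)]
    have := div_le_one_of_le₀ hvR hRpos.le
    have h3 := sq_sub_deriv_le hC s v
    nlinarith [sq_nonneg Δ]
  have hΔ2 : |Δ| ≤ 2 * C := by
    have := abs_sub (deriv ψ s) (deriv ψ v)
    linarith [hC s, hC v]
  have b2 : |R * (2 * Δ * (-deriv (deriv ψ) v))| ≤ 8 * C * B * bracket s := by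
    rw [abs_mul, abs_mul, abs_mul, abs_neg, abs_of_pos hRpos, abs_two]
    have hR2 : R ≤ (1 + |v|) * (2 * bracket s) := by
      have := sqrt_add_sq_le hδ.le (v - s)
      have := abs_sub v s
      have := abs_le_bracket s
      have := one_le_bracket s
      nlinarith [abs_nonneg v]
    have hB' := hB v
    change |deriv (deriv ψ) v * (1 + |v|)| ≤ B at hB'
    rw [abs_mul, abs_of_nonneg (show (0 : ℝ) ≤ 1 + |v| by positivity)] at hB'
    have hbs := bracket_nonneg s
    calc R * (2 * |Δ| * |deriv (deriv ψ) v|)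
        ≤ ((1 + |v|) * (2 * bracket s)) * (2 * (2 * C) * |deriv (deriv ψ) v|) := by gcongr
      _ = 8 * C * (|deriv (deriv ψ) v| * (1 + |v|)) * bracket s := by ring
      _ ≤ 8 * C * B * bracket s := by
        gcongr
  have h3 := one_le_bracket s
  have h4 := abs_add_le ((2 * (v - s)) / (2 * R) * Δ ^ 2) (R * (2 * Δ * (-deriv (deriv ψ) v)))
  nlinarith [sq_nonneg C]

section Products

variable {x y : ProbabilityMeasure ℝ}

theorem integrable_regEnergy {ψ : ℝ → ℝ} (hψ : ContDiff ℝ 1 ψ) {C : ℝ}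
    (hC : ∀ v, |deriv ψ v| ≤ C) {δ : ℝ} (hδ : 0 ≤ δ) (hx : moment x < ⊤) (hy : moment y < ⊤) :
    Integrable (fun p : ℝ × ℝ => regEnergy ψ δ p.1 p.2) ((x : Measure ℝ).prod (y : Measure ℝ)) := by
  have hi : Integrable (fun p : ℝ × ℝ => 4 * C ^ 2 * (δ + (bracket p.1 + bracket p.2)))
      ((x : Measure ℝ).prod (y : Measure ℝ)) :=
    ((integrable_const _).add (((integrable_bracket hx).comp_fst _).add
      ((integrable_bracket hy).comp_snd _))).const_mul _
  refine hi.mono' (continuous_regEnergy hψ δ).aestronglyMeasurable (ae_of_all _ fun p => ?_)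
  rw [Real.norm_eq_abs, abs_of_nonneg (regEnergy_nonneg _ _ _ _), regEnergy, mul_comm]
  have h1 := sqrt_add_sq_le hδ (p.2 - p.1)
  have h2 := abs_sub p.2 p.1
  have h3 := abs_le_bracket p.1
  have h4 := abs_le_bracket p.2
  exact mul_le_mul (sq_sub_deriv_le hC _ _) (by linarith) (Real.sqrt_nonneg _) (by positivity)

theorem energy_nlGrad_eq {e : ℝ} (he : e < 1) (ψ : ℝ → ℝ) :
    (energy e x (nlGrad ψ)).toReal
      = (1 - e) / 4 * ∫ p, regEnergy ψ 0 p.1 p.2 ∂(x : Measure ℝ).prod (x : Measure ℝ) := by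
  have hm : Measurable fun p => weight e p * nlGrad ψ p ^ 2 :=
    (measurable_weight e).mul ((measurable_nlGrad ψ).pow_const 2)
  rw [energy, ← integral_eq_lintegral_of_nonneg_ae
    (ae_of_all _ fun p => mul_nonneg (weight_nonneg he p) (sq_nonneg _)) hm.aestronglyMeasurable,
    ← integral_const_mul, ← integral_prodOff]
  · refine integral_congr_ae (ae_of_all _ fun p => ?_)
    simp only [weight, sigma, nlGrad, regEnergy]
    rw [zero_pow two_ne_zero, zero_add, Real.sqrt_sq_eq_abs, abs_sub_comm]
    ring
  · simp [regEnergy]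

/-- For each frozen `s` the regularised integrand is a Lipschitz observable of the other variable,
to which the hypothesis on the two measures applies. -/
theorem integral_regEnergy_sub_le {ψ : ℝ → ℝ} (hψ : ContDiff ℝ 2 ψ) {C L δ κ : ℝ}
    (hC : ∀ v, |deriv ψ v| ≤ C) (hδ : 0 < δ) (hL : ∀ s v, |deriv (regEnergy ψ δ s) v| ≤ L * bracket s)
    (hx : moment x < ⊤) (hy : moment y < ⊤)
    (hκ : ∀ (θ : ℝ → ℝ) (A : ℝ), ContDiff ℝ 1 θ → (∀ v, |deriv θ v| ≤ A) →
      |(∫ v, θ v ∂(y : Measure ℝ)) - ∫ v, θ v ∂(x : Measure ℝ)| ≤ κ * A)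
    {z : ProbabilityMeasure ℝ} (hz : moment z < ⊤) :
    (∫ p, regEnergy ψ δ p.1 p.2 ∂(z : Measure ℝ).prod (y : Measure ℝ))
        - ∫ p, regEnergy ψ δ p.1 p.2 ∂(z : Measure ℝ).prod (x : Measure ℝ)
      ≤ κ * L * (moment z).toReal := by
  have hψ1 : ContDiff ℝ 1 ψ := hψ.of_le one_le_two
  have h1 := integrable_regEnergy hψ1 hC hδ.le hz hy
  have h2 := integrable_regEnergy hψ1 hC hδ.le hz hx
  rw [integral_prod _ h1, integral_prod _ h2, ← integral_sub h1.integral_prod_left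
    h2.integral_prod_left, ← integral_bracket, ← integral_const_mul]
  refine integral_mono (h1.integral_prod_left.sub h2.integral_prod_left)
    ((integrable_bracket hz).const_mul _) fun s => ?_
  have := hκ (regEnergy ψ δ s) _ (contDiff_regEnergy hψ hδ s) (hL s)
  exact (le_abs_self _).trans (this.trans (by rw [mul_assoc]))

/-- The two factors of the product measure are exchanged one after the other, through the mixed
product `y ⊗ x`, which symmetry identifies with `x ⊗ y`. The regularisation costs `4 C² δ`, and `δ`
tends to 0. -/
theorem exists_energy_nlGrad_le {e : ℝ} (he₀ : 0 ≤ e) (he : e < 1) {ψ : ℝ → ℝ}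
    (hψ : ContDiff ℝ 2 ψ) (hc : HasCompactSupport ψ) : ∃ L, 0 ≤ L ∧
    ∀ (x y : ProbabilityMeasure ℝ) (κ : ℝ), 0 ≤ κ → moment x < ⊤ → moment y < ⊤ →
      (∀ (θ : ℝ → ℝ) (A : ℝ), ContDiff ℝ 1 θ → (∀ v, |deriv θ v| ≤ A) →
        |(∫ v, θ v ∂(y : Measure ℝ)) - ∫ v, θ v ∂(x : Measure ℝ)| ≤ κ * A) →
      (energy e y (nlGrad ψ)).toReal ≤ (energy e x (nlGrad ψ)).toReal
        + L * κ * ((moment x).toReal + (moment y).toReal) := by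
  have hψ1 : ContDiff ℝ 1 ψ := hψ.of_le one_le_two
  obtain ⟨C, hC⟩ := exists_deriv_bound hψ1 hc
  obtain ⟨L, hL0, hL⟩ := exists_deriv_regEnergy_bound hψ hc
  refine ⟨L, hL0, fun x y κ hκ0 hx hy hκ => ?_⟩
  rw [energy_nlGrad_eq he ψ, energy_nlGrad_eq he ψ]
  set Mx := (moment x).toReal with hMx
  set My := (moment y).toReal with hMy
  have hM : 0 ≤ Mx + My := add_nonneg ENNReal.toReal_nonneg ENNReal.toReal_nonneg
  have key : ∀ δ, 0 < δ → δ ≤ 1 →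
      ∫ p, regEnergy ψ 0 p.1 p.2 ∂(y : Measure ℝ).prod (y : Measure ℝ)
        ≤ (∫ p, regEnergy ψ 0 p.1 p.2 ∂(x : Measure ℝ).prod (x : Measure ℝ))
          + L * κ * (Mx + My) + 4 * C ^ 2 * δ := by
    intro δ hδ hδ1
    have a1 := integral_regEnergy_sub_le hψ hC hδ (hL δ hδ hδ1) hx hy hκ hy
    have a2 := integral_regEnergy_sub_le hψ hC hδ (hL δ hδ hδ1) hx hy hκ hx
    have a3 : ∫ p, regEnergy ψ δ p.1 p.2 ∂(y : Measure ℝ).prod (x : Measure ℝ)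
        = ∫ p, regEnergy ψ δ p.1 p.2 ∂(x : Measure ℝ).prod (y : Measure ℝ) := by
      rw [← integral_prod_swap]
      exact integral_congr_ae (ae_of_all _ fun p => regEnergy_comm _ _ _ _)
    have a4 : ∫ p, regEnergy ψ 0 p.1 p.2 ∂(y : Measure ℝ).prod (y : Measure ℝ)
        ≤ ∫ p, regEnergy ψ δ p.1 p.2 ∂(y : Measure ℝ).prod (y : Measure ℝ) :=
      integral_mono (integrable_regEnergy hψ1 hC le_rfl hy hy)
        (integrable_regEnergy hψ1 hC hδ.le hy hy) fun p => regEnergy_zero_le _ _ _ _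
    have a5 : ∫ p, regEnergy ψ δ p.1 p.2 ∂(x : Measure ℝ).prod (x : Measure ℝ)
        ≤ ∫ p, (regEnergy ψ 0 p.1 p.2 + 4 * C ^ 2 * δ) ∂(x : Measure ℝ).prod (x : Measure ℝ) :=
      integral_mono (integrable_regEnergy hψ1 hC hδ.le hx hx)
        ((integrable_regEnergy hψ1 hC le_rfl hx hx).add (integrable_const _))
        fun p => regEnergy_le hC hδ.le _ _
    rw [integral_add (integrable_regEnergy hψ1 hC le_rfl hx hx) (integrable_const _)] at a5
    simp only [integral_const, probReal_univ, one_smul] at a5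
    rw [a3] at a1
    linarith
  have key' : ∫ p, regEnergy ψ 0 p.1 p.2 ∂(y : Measure ℝ).prod (y : Measure ℝ)
      ≤ (∫ p, regEnergy ψ 0 p.1 p.2 ∂(x : Measure ℝ).prod (x : Measure ℝ))
        + L * κ * (Mx + My) := by
    have hcont : Tendsto (fun δ : ℝ => (∫ p, regEnergy ψ 0 p.1 p.2
        ∂(x : Measure ℝ).prod (x : Measure ℝ)) + L * κ * (Mx + My) + 4 * C ^ 2 * δ) (𝓝[>] 0)
        (𝓝 ((∫ p, regEnergy ψ 0 p.1 p.2
        ∂(x : Measure ℝ).prod (x : Measure ℝ)) + L * κ * (Mx + My) + 4 * C ^ 2 * 0)) :=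
      Tendsto.mono_left (Continuous.tendsto (by fun_prop) 0) nhdsWithin_le_nhds
    rw [mul_zero, add_zero] at hcont
    refine ge_of_tendsto hcont ?_
    filter_upwards [Ioc_mem_nhdsGT one_pos] with δ hδ using key δ hδ.1 hδ.2
  have h1 : (1 - e) / 4 ≤ 1 := by linarith
  have h2 : 0 ≤ (1 - e) / 4 := by linarith
  have h3 : 0 ≤ L * κ * (Mx + My) := by positivity
  calc _ ≤ (1 - e) / 4 * ((∫ p, regEnergy ψ 0 p.1 p.2 ∂(x : Measure ℝ).prod (x : Measure ℝ))
        + L * κ * (Mx + My)) := mul_le_mul_of_nonneg_left key' h2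
    _ ≤ _ := by rw [mul_add]; exact add_le_add_right (mul_le_of_le_one_left h3 h1) _

end Products

/-- The modulus controlling Lipschitz test functions along curves of length `D` that start at a
measure of moment `M`. -/
def modulus (M D : ℝ) : ℝ := 2 * truncBound * (4 * truncBound * D ^ 2 + √(2 * M) * D)

theorem modulus_nonneg {M D : ℝ} (hD : 0 ≤ D) : 0 ≤ modulus M D := by
  have := one_le_truncBound
  unfold modulus
  positivity

theorem continuous_modulus (M : ℝ) : Continuous (modulus M) := by
  unfold modulus; fun_prop

/-! ### Estimates in terms of the cost -/

section Competitors

variable {e : ℝ} {x y : ProbabilityMeasure ℝ}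

theorem exists_solution_of_lt (he : e < 1) (h : dA e x y ≠ ⊤) {D : ℝ} (hD : (dA e x y).toReal < D) :
    ∃ g u, IsDensitySolution e 0 1 g u ∧ g 0 = x ∧ g 1 = y ∧
      ∫⁻ t in Icc (0 : ℝ) 1, energy e (g t) (fun p => u (t, p)) ≤ ENNReal.ofReal (D ^ 2) := by
  have hD0 : 0 ≤ D := ENNReal.toReal_nonneg.trans hD.le
  obtain ⟨g, u, hg, h0, h1, hE⟩ := exists_solution_of_dA_lt he
    ((ENNReal.lt_ofReal_iff_toReal_lt h).2 hD)
  refine ⟨g, u, hg, h0, h1, hE.le.trans ?_⟩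
  rw [ENNReal.ofReal_pow hD0]

/-- The infimum in the cost is not known to be attained, so estimates are made along competitors of
action at most `D²` for every `D` above the cost, and `D` then decreases to it. -/
theorem le_of_forall_gt_of_continuous {a d : ℝ} {F : ℝ → ℝ} (hF : Continuous F)
    (h : ∀ D, d < D → a ≤ F D) : a ≤ F d :=
  ge_of_tendsto (x := 𝓝[>] d) ((hF.tendsto d).mono_left nhdsWithin_le_nhds)
    (by filter_upwards [self_mem_nhdsWithin] with D hD using h D hD)

theorem two_mul_totalMass_le (he₀ : 0 ≤ e) (he : e < 1) {g : ℝ → ProbabilityMeasure ℝ}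
    {u : ℝ × OffDiag → ℝ} (h : IsDensitySolution e 0 1 g u) (h0 : moment (g 0) < ⊤) {D : ℝ}
    (hD : 0 ≤ D)
    (hE : ∫⁻ t in Icc (0 : ℝ) 1, energy e (g t) (fun p => u (t, p)) ≤ ENNReal.ofReal (D ^ 2)) :
    2 * truncBound * IsDensitySolution.totalMass e g u ≤ modulus (moment (g 0)).toReal D :=
  mul_le_mul_of_nonneg_left (h.totalMass_le he₀ he h0 hD hE)
    (by linarith [one_le_truncBound])

theorem abs_integral_sub_le_modulus (he₀ : 0 ≤ e) (he : e < 1) (hx : moment x < ⊤)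
    (h : dA e x y ≠ ⊤) {θ : ℝ → ℝ} (hθ : ContDiff ℝ 1 θ) {A : ℝ} (hA : ∀ v, |deriv θ v| ≤ A) :
    |(∫ v, θ v ∂(y : Measure ℝ)) - ∫ v, θ v ∂(x : Measure ℝ)|
      ≤ modulus (moment x).toReal (dA e x y).toReal * A := by
  have hA0 : 0 ≤ A := (abs_nonneg _).trans (hA 0)
  refine le_of_forall_gt_of_continuous (F := fun D => modulus (moment x).toReal D * A)
    ((continuous_modulus _).mul continuous_const) fun D hD => ?_
  have hD0 : 0 ≤ D := ENNReal.toReal_nonneg.trans hD.le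
  obtain ⟨g, u, hg, rfl, rfl, hE⟩ := exists_solution_of_lt he h hD
  exact (hg.abs_integral_sub_le_of_deriv_bound he hx hθ hA (right_mem_Icc.2 zero_le_one)).trans
    (mul_le_mul_of_nonneg_right (two_mul_totalMass_le he₀ he hg hx hD0 hE) hA0)

theorem toReal_moment_le_of_solution (he₀ : 0 ≤ e) (he : e < 1) {g : ℝ → ProbabilityMeasure ℝ}
    {u : ℝ × OffDiag → ℝ} (h : IsDensitySolution e 0 1 g u) (h0 : moment (g 0) < ⊤) {D : ℝ}
    (hD : 0 ≤ D)
    (hE : ∫⁻ t in Icc (0 : ℝ) 1, energy e (g t) (fun p => u (t, p)) ≤ ENNReal.ofReal (D ^ 2))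
    {r : ℝ} (hr : r ∈ Icc (0 : ℝ) 1) :
    (moment (g r)).toReal ≤ (moment (g 0)).toReal + modulus (moment (g 0)).toReal D := by
  refine ENNReal.toReal_le_of_le_ofReal
    (add_nonneg ENNReal.toReal_nonneg (modulus_nonneg hD)) ?_
  rw [ENNReal.ofReal_add ENNReal.toReal_nonneg (modulus_nonneg hD), ENNReal.ofReal_toReal h0.ne]
  exact (h.moment_le he h0 hr).trans (add_le_add_right
    (ENNReal.ofReal_le_ofReal (two_mul_totalMass_le he₀ he h h0 hD hE)) _)

theorem toReal_moment_le (he₀ : 0 ≤ e) (he : e < 1) (hx : moment x < ⊤) (h : dA e x y ≠ ⊤) :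
    (moment y).toReal ≤ (moment x).toReal + modulus (moment x).toReal (dA e x y).toReal := by
  refine le_of_forall_gt_of_continuous
    (F := fun D => (moment x).toReal + modulus (moment x).toReal D)
    (continuous_const.add (continuous_modulus _)) fun D hD => ?_
  have hD0 : 0 ≤ D := ENNReal.toReal_nonneg.trans hD.le
  obtain ⟨g, u, hg, rfl, rfl, hE⟩ := exists_solution_of_lt he h hD
  exact toReal_moment_le_of_solution he₀ he hg hx hD0 hE (right_mem_Icc.2 zero_le_one)

/-- The increments of a smooth observable are controlled by the cost, to leading order with the
sharp constant. -/
theorem exists_sq_integral_sub_le (he₀ : 0 ≤ e) (he : e < 1) {ψ : ℝ → ℝ} (hψ : ContDiff ℝ 2 ψ)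
    (hc : HasCompactSupport ψ) : ∃ L, 0 ≤ L ∧
    ∀ x y : ProbabilityMeasure ℝ, moment x < ⊤ → dA e x y ≠ ⊤ →
      ((∫ v, ψ v ∂(y : Measure ℝ)) - ∫ v, ψ v ∂(x : Measure ℝ)) ^ 2
        ≤ ((energy e x (nlGrad ψ)).toReal + L * modulus (moment x).toReal (dA e x y).toReal
          * (2 * (moment x).toReal + modulus (moment x).toReal (dA e x y).toReal))
          * (dA e x y).toReal ^ 2 := by
  have hψ1 : ContDiff ℝ 1 ψ := hψ.of_le one_le_two
  obtain ⟨C, hC⟩ := exists_deriv_bound hψ1 hc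
  obtain ⟨L, hL0, hL⟩ := exists_energy_nlGrad_le he₀ he hψ hc
  refine ⟨L, hL0, fun x y hx h => ?_⟩
  have hm := continuous_modulus (moment x).toReal
  refine le_of_forall_gt_of_continuous (F := fun D => ((energy e x (nlGrad ψ)).toReal
    + L * modulus (moment x).toReal D * (2 * (moment x).toReal + modulus (moment x).toReal D))
    * D ^ 2) (by fun_prop) fun D hD => ?_
  have hD0 : 0 ≤ D := ENNReal.toReal_nonneg.trans hD.le
  obtain ⟨g, u, hg, rfl, rfl, hE⟩ := exists_solution_of_lt he h hD
  set M := (moment (g 0)).toReal with hM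
  have hM0 : 0 ≤ M := ENNReal.toReal_nonneg
  have hmod0 : 0 ≤ modulus M D := modulus_nonneg hD0
  -- `Q` bounds the gradient energy along the whole competitor. The factor `2 * M + modulus M D`
  -- bounds the sum of the moments at time 0 and at a later time.
  set Q := (energy e (g 0) (nlGrad ψ)).toReal + L * modulus M D * (2 * M + modulus M D) with hQ
  have hQ0 : 0 ≤ Q := add_nonneg ENNReal.toReal_nonneg (by positivity)
  have hN : ∀ r ∈ Icc (0 : ℝ) 1, energy e (g r) (nlGrad ψ) ≤ ENNReal.ofReal Q := by
    intro r hr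
    have hrM := hg.moment_lt_top' he hx hr
    rw [ENNReal.le_ofReal_iff_toReal_le (energy_nlGrad_lt_top he₀ he hrM hC).ne hQ0]
    refine (hL (g 0) (g r) (modulus M D) hmod0 hx hrM fun θ A hθ hA => ?_).trans ?_
    · exact (hg.abs_integral_sub_le_of_deriv_bound he hx hθ hA hr).trans
        (mul_le_mul_of_nonneg_right (two_mul_totalMass_le he₀ he hg hx hD0 hE)
          ((abs_nonneg _).trans (hA 0)))
    · refine add_le_add_right (mul_le_mul_of_nonneg_left ?_ (by positivity)) _
      linarith [toReal_moment_le_of_solution he₀ he hg hx hD0 hE hr]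
  have hEm := measurable_energy e hg.cont hg.meas
  -- Cauchy–Schwarz at each time, followed by Cauchy–Schwarz in time on the unit interval.
  have h1 : ENNReal.ofReal |(∫ v, ψ v ∂(g 1 : Measure ℝ)) - ∫ v, ψ v ∂(g 0 : Measure ℝ)|
      ≤ ENNReal.ofReal Q ^ (1 / 2 : ℝ) * ENNReal.ofReal (D ^ 2) ^ (1 / 2 : ℝ) := by
    rw [hg.eq ψ hψ1 hc 0 1 le_rfl zero_le_one le_rfl, intervalIntegral.integral_of_le zero_le_one,
      ← integral_Icc_eq_integral_Ioc, ← Real.norm_eq_abs, ofReal_norm]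
    refine (enorm_integral_le_lintegral_enorm _).trans ?_
    calc _ ≤ ∫⁻ t in Icc (0 : ℝ) 1, ENNReal.ofReal Q ^ (1 / 2 : ℝ)
          * energy e (g t) (fun p => u (t, p)) ^ (1 / 2 : ℝ) := by
          refine setLIntegral_mono' measurableSet_Icc fun t ht => ?_
          rw [← ofReal_norm, Real.norm_eq_abs]
          refine (ofReal_abs_fluxPair_le he (g t) (hg.meas.comp measurable_prodMk_left) ψ).trans ?_
          exact mul_le_mul_left (ENNReal.rpow_le_rpow (hN t ht) (by norm_num)) _
      _ = ENNReal.ofReal Q ^ (1 / 2 : ℝ)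
          * ∫⁻ t in Icc (0 : ℝ) 1, energy e (g t) (fun p => u (t, p)) ^ (1 / 2 : ℝ) :=
          lintegral_const_mul _ (hEm.pow_const _)
      _ ≤ _ := by
          refine mul_le_mul_right ((lintegral_rpow_half_le_of_unit hEm).trans ?_) _
          exact ENNReal.rpow_le_rpow hE (by norm_num)
  rw [← ENNReal.mul_rpow_of_nonneg _ _ (by norm_num), ← ENNReal.ofReal_mul hQ0,
    ENNReal.ofReal_rpow_of_nonneg (by positivity) (by norm_num),
    ENNReal.ofReal_le_ofReal_iff (by positivity), ← Real.sqrt_eq_rpow] at h1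
  rw [← sq_abs]
  calc _ ≤ √(Q * D ^ 2) ^ 2 := pow_le_pow_left₀ (abs_nonneg _) h1 2
    _ = _ := Real.sq_sqrt (by positivity)

end Competitors

open scoped Manifold ContDiff in
/-- Probability measures converge narrowly if the integrals of compactly supported test functions
converge. -/
theorem tendsto_of_forall_contDiff {ι : Type*} {L : Filter ι} [L.IsCountablyGenerated]
    {y : ι → ProbabilityMeasure ℝ} {x : ProbabilityMeasure ℝ}
    (h : ∀ ψ : ℝ → ℝ, ContDiff ℝ 2 ψ → HasCompactSupport ψ →
      Tendsto (fun i => ∫ v, ψ v ∂(y i : Measure ℝ)) L (𝓝 (∫ v, ψ v ∂(x : Measure ℝ)))) :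
    Tendsto y L (𝓝 x) := by
  rcases L.eq_or_neBot with rfl | hL
  · exact tendsto_bot
  refine tendsto_of_forall_isOpen_le_liminf' fun G hG => ?_
  refine le_of_forall_lt fun r hr => ?_
  obtain ⟨K, hKG, hK, hrK⟩ := hG.exists_lt_isCompact hr
  refine hrK.trans_le ?_
  obtain ⟨R, hR⟩ := hK.isBounded.subset_ball 0
  -- A smooth bump between `K` and `G`, cut off by a ball to have compact support. Its integrals
  -- compare the mass of `K` under the limit with the masses of `G`; tightness is not needed since
  -- the limit is a probability measure.
  obtain ⟨ψ, hψd, hψr, hψs, hψ1⟩ := exists_contMDiff_support_eq_eq_one_iff 𝓘(ℝ) (n := 2)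
    (hG.inter (Metric.isOpen_ball (x := (0 : ℝ)) (ε := R))) hK.isClosed (subset_inter hKG hR)
  have hψd' : ContDiff ℝ 2 ψ := contMDiff_iff_contDiff.1 hψd
  have hψc : HasCompactSupport ψ :=
    HasCompactSupport.of_support_subset_isCompact (isCompact_closedBall (0 : ℝ) R)
      (hψs.subset.trans (inter_subset_right.trans Metric.ball_subset_closedBall))
  have hψ0 : ∀ v, 0 ≤ ψ v := fun v => (hψr (mem_range_self v)).1
  have hψle : ∀ v, ψ v ≤ 1 := fun v => (hψr (mem_range_self v)).2
  have hint : ∀ z : ProbabilityMeasure ℝ, ENNReal.ofReal (∫ v, ψ v ∂(z : Measure ℝ))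
      = ∫⁻ v, ENNReal.ofReal (ψ v) ∂(z : Measure ℝ) := fun z =>
    ofReal_integral_eq_lintegral_ofReal
      (hψd'.continuous.integrable_of_hasCompactSupport hψc) (ae_of_all _ hψ0)
  have h1 : (x : Measure ℝ) K ≤ ENNReal.ofReal (∫ v, ψ v ∂(x : Measure ℝ)) := by
    rw [hint, ← lintegral_indicator_one hK.isClosed.measurableSet]
    refine lintegral_mono fun v => ?_
    by_cases hv : v ∈ K
    · rw [indicator_of_mem hv, (hψ1 v).1 hv]; simp
    · rw [indicator_of_notMem hv]; exact zero_le
  have h2 : ∀ i, ENNReal.ofReal (∫ v, ψ v ∂(y i : Measure ℝ)) ≤ (y i : Measure ℝ) G := by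
    intro i
    rw [hint, ← lintegral_indicator_one hG.measurableSet]
    refine lintegral_mono fun v => ?_
    by_cases hv : v ∈ G
    · rw [indicator_of_mem hv, Pi.one_apply, ← ENNReal.ofReal_one]
      exact ENNReal.ofReal_le_ofReal (hψle v)
    · have : v ∉ Function.support ψ := fun h => hv (hψs.subset h).1
      rw [Function.notMem_support.1 this]; simp
  refine h1.trans ?_
  rw [← (ENNReal.tendsto_ofReal (h ψ hψd' hψc)).liminf_eq]
  exact liminf_le_liminf (Eventually.of_forall h2)

/-- A curve of finite first moment, absolutely continuous in the interior and narrowly continuous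
at the end points. -/
structure IsACCurve (e T : ℝ) (f : ℝ → ProbabilityMeasure ℝ) (m : ℝ → ℝ) : Prop where
  nonneg : ∀ t, 0 ≤ m t
  integrable : IntegrableOn m (Ioo 0 T)
  dA_le : ∀ s t : ℝ, 0 < s → s ≤ t → t < T →
    dA e (f s) (f t) ≤ ENNReal.ofReal (∫ r in s..t, m r)
  moment : ∀ t ∈ Icc 0 T, moment (f t) < ⊤
  left : ContinuousWithinAt f (Icc 0 T) 0
  right : ContinuousWithinAt f (Icc 0 T) T

theorem modulus_mono {M M' D D' : ℝ} (hM : M ≤ M') (hD0 : 0 ≤ D) (hD : D ≤ D') :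
    modulus M D ≤ modulus M' D' := by
  have := one_le_truncBound
  unfold modulus
  have hD' := hD0.trans hD
  gcongr

/-! ### Observables along absolutely continuous curves -/

namespace IsACCurve

variable {e T : ℝ} {f : ℝ → ProbabilityMeasure ℝ} {m : ℝ → ℝ}

theorem intervalIntegrable (h : IsACCurve e T f m) {s t : ℝ} (hs : s ∈ Icc 0 T)
    (ht : t ∈ Icc 0 T) : IntervalIntegrable m volume s t := by
  have := h.integrable
  rw [IntegrableOn, restrict_Ioo_eq_restrict_Icc] at this
  exact (IntegrableOn.mono_set (t := Icc 0 T) this (uIcc_subset_Icc hs ht)).intervalIntegrable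

theorem integral_le (h : IsACCurve e T f m) {s t : ℝ} (hs : 0 ≤ s) (hst : s ≤ t) (ht : t ≤ T) :
    ∫ r in s..t, m r ≤ ∫ r in 0..T, m r := by
  have h0T : (0 : ℝ) ≤ T := hs.trans (hst.trans ht)
  exact intervalIntegral.integral_mono_interval hs hst ht (ae_of_all _ h.nonneg)
    (h.intervalIntegrable (left_mem_Icc.2 h0T) (right_mem_Icc.2 h0T))

theorem integral_nonneg (h : IsACCurve e T f m) {s t : ℝ} (hst : s ≤ t) :
    0 ≤ ∫ r in s..t, m r := intervalIntegral.integral_nonneg hst fun r _ => h.nonneg r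

theorem dA_le_abs (he : e < 1) (h : IsACCurve e T f m) {s t : ℝ} (hs : s ∈ Ioo 0 T)
    (ht : t ∈ Ioo 0 T) : dA e (f s) (f t) ≤ ENNReal.ofReal |∫ r in s..t, m r| := by
  rcases le_total s t with hst | hst
  · rw [abs_of_nonneg (h.integral_nonneg hst)]; exact h.dA_le s t hs.1 hst ht.2
  · rw [intervalIntegral.integral_symm, abs_neg, abs_of_nonneg (h.integral_nonneg hst),
      dA_comm he]
    exact h.dA_le t s ht.1 hst hs.2

theorem dA_ne_top (he : e < 1) (h : IsACCurve e T f m) {s t : ℝ} (hs : s ∈ Ioo 0 T)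
    (ht : t ∈ Ioo 0 T) : dA e (f s) (f t) ≠ ⊤ :=
  ((h.dA_le_abs he hs ht).trans_lt ENNReal.ofReal_lt_top).ne

theorem toReal_dA_le (he : e < 1) (h : IsACCurve e T f m) {s t : ℝ} (hs : s ∈ Ioo 0 T)
    (ht : t ∈ Ioo 0 T) : (dA e (f s) (f t)).toReal ≤ |∫ r in s..t, m r| :=
  ENNReal.toReal_le_of_le_ofReal (abs_nonneg _) (h.dA_le_abs he hs ht)

theorem abs_integral_le (h : IsACCurve e T f m) {s t : ℝ} (hs : s ∈ Ioo 0 T)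
    (ht : t ∈ Ioo 0 T) : |∫ r in s..t, m r| ≤ ∫ r in 0..T, m r := by
  rcases le_total s t with hst | hst
  · rw [abs_of_nonneg (h.integral_nonneg hst)]; exact h.integral_le hs.1.le hst ht.2.le
  · rw [intervalIntegral.integral_symm, abs_neg, abs_of_nonneg (h.integral_nonneg hst)]
    exact h.integral_le ht.1.le hst hs.2.le

/-- Interior times are compared with the midpoint `T / 2`, whose cost to them is finite. The cost
says nothing about the end points, whose moments are added separately. -/
theorem exists_moment_bound (he₀ : 0 ≤ e) (he : e < 1) (h : IsACCurve e T f m) :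
    ∃ B, 0 ≤ B ∧ ∀ t ∈ Icc 0 T, (Collision.moment (f t)).toReal ≤ B := by
  set M := fun t => (Collision.moment (f t)).toReal with hM
  have hM0 : ∀ t, 0 ≤ M t := fun t => ENNReal.toReal_nonneg
  have hmod := modulus_nonneg (M := M (T / 2)) (abs_nonneg (∫ r in 0..T, m r))
  refine ⟨M 0 + M T + (M (T / 2) + modulus (M (T / 2)) |∫ r in 0..T, m r|), ?_, fun t ht => ?_⟩
  · have := hM0 0; have := hM0 T; have := hM0 (T / 2); positivity
  · rcases ht.1.eq_or_lt with rfl | h0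
    · linarith [hM0 T, hM0 (T / 2)]
    rcases ht.2.eq_or_lt with rfl | h1
    · linarith [hM0 0, hM0 (t / 2)]
    have hT : 0 < T := h0.trans h1
    have hT2 : T / 2 ∈ Ioo 0 T := ⟨by linarith, by linarith⟩
    have ht' : t ∈ Ioo 0 T := ⟨h0, h1⟩
    have a1 := toReal_moment_le he₀ he (h.moment _ ⟨hT2.1.le, hT2.2.le⟩) (h.dA_ne_top he hT2 ht')
    have a2 : modulus (M (T / 2)) (dA e (f (T / 2)) (f t)).toReal
        ≤ modulus (M (T / 2)) |∫ r in 0..T, m r| :=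
      modulus_mono le_rfl ENNReal.toReal_nonneg ((h.toReal_dA_le he hT2 ht').trans
        ((h.abs_integral_le hT2 ht').trans (le_abs_self _)))
    linarith [hM0 0, hM0 T]

/-- Observables along an absolutely continuous curve are absolutely continuous. -/
theorem exists_abs_integral_sub_le (he₀ : 0 ≤ e) (he : e < 1) (h : IsACCurve e T f m) :
    ∃ κ, 0 ≤ κ ∧ ∀ (θ : ℝ → ℝ) (A : ℝ), ContDiff ℝ 1 θ → (∀ v, |deriv θ v| ≤ A) →
      ∀ s ∈ Ioo 0 T, ∀ t ∈ Ioo 0 T,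
        |(∫ v, θ v ∂(f t : Measure ℝ)) - ∫ v, θ v ∂(f s : Measure ℝ)|
          ≤ κ * A * |∫ r in s..t, m r| := by
  obtain ⟨B, hB0, hB⟩ := h.exists_moment_bound he₀ he
  have hc := one_le_truncBound
  set D := |∫ r in 0..T, m r|
  refine ⟨2 * truncBound * (4 * truncBound * D + √(2 * B)), by positivity,
    fun θ A hθ hA s hs t ht => ?_⟩
  have hs' := Ioo_subset_Icc_self hs
  have hA0 : 0 ≤ A := (abs_nonneg _).trans (hA 0)
  refine (abs_integral_sub_le_modulus he₀ he (h.moment s hs') (h.dA_ne_top he hs ht) hθ hA).trans ?_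
  set d := |∫ r in s..t, m r|
  have hd0 : 0 ≤ d := abs_nonneg _
  have hdD : d ≤ D := (h.abs_integral_le hs ht).trans (le_abs_self _)
  -- The modulus is quadratic plus linear in the distance; since `d ≤ D` it is at most linear in
  -- `d`, as absolute continuity requires.
  calc _ ≤ modulus B d * A := mul_le_mul_of_nonneg_right
        (modulus_mono (hB s hs') ENNReal.toReal_nonneg (h.toReal_dA_le he hs ht)) hA0
    _ = (2 * truncBound * (4 * truncBound * d + √(2 * B))) * d * A := by unfold modulus; ring
    _ ≤ (2 * truncBound * (4 * truncBound * D + √(2 * B))) * d * A := by gcongr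
    _ = _ := by ring

/-- In the interior all smooth compactly supported observables are continuous, which determines
narrow convergence. At the end points continuity is part of the hypothesis. -/
theorem continuousOn (he₀ : 0 ≤ e) (he : e < 1) (h : IsACCurve e T f m) :
    ContinuousOn f (Icc 0 T) := by
  intro t ht
  rcases ht.1.eq_or_lt with rfl | h0
  · exact h.left
  rcases ht.2.eq_or_lt with rfl | h1
  · exact h.right
  have ht' : t ∈ Ioo 0 T := ⟨h0, h1⟩
  obtain ⟨κ, hκ0, hκ⟩ := h.exists_abs_integral_sub_le he₀ he
  refine ContinuousAt.continuousWithinAt (tendsto_of_forall_contDiff fun ψ hψ hc => ?_)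
  have hψ1 : ContDiff ℝ 1 ψ := hψ.of_le one_le_two
  obtain ⟨A, hA⟩ := exists_deriv_bound hψ1 hc
  rw [tendsto_iff_dist_tendsto_zero]
  have hg : Integrable ((Ioo 0 T).indicator m) :=
    (integrable_indicator_iff measurableSet_Ioo).2 h.integrable
  have hlim : Tendsto (fun s => κ * A * |∫ r in t..s, (Ioo 0 T).indicator m r|) (𝓝 t) (𝓝 0) := by
    have h1 : Continuous fun s => κ * A * |∫ r in t..s, (Ioo 0 T).indicator m r| :=
      continuous_const.mul (intervalIntegral.continuous_primitive
        (fun x y => hg.intervalIntegrable) t).abs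
    simpa using h1.tendsto t
  refine squeeze_zero' (Eventually.of_forall fun s => dist_nonneg) ?_ hlim
  filter_upwards [isOpen_Ioo.mem_nhds ht'] with s hs
  rw [Real.dist_eq]
  refine (hκ ψ A hψ1 hA t ht' s hs).trans (le_of_eq ?_)
  congr 2
  exact intervalIntegral.integral_congr fun r hr =>
    (indicator_of_mem (ordConnected_Ioo.uIcc_subset ht' hs hr) m).symm

/-- The sharp bound for the derivative of an observable at a time of metric differentiability. -/
theorem abs_deriv_le (he₀ : 0 ≤ e) (he : e < 1) (h : IsACCurve e T f m) {t n : ℝ}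
    (ht : t ∈ Ioo 0 T) (hn0 : 0 ≤ n) (hn : HasMetricDeriv e f t (ENNReal.ofReal n)) {ψ : ℝ → ℝ}
    (hψ : ContDiff ℝ 2 ψ) (hc : HasCompactSupport ψ) {a : ℝ}
    (ha : HasDerivAt (fun t => ∫ v, ψ v ∂(f t : Measure ℝ)) a t) :
    |a| ≤ n * √(energy e (f t) (nlGrad ψ)).toReal := by
  obtain ⟨L, hL0, hL⟩ := exists_sq_integral_sub_le he₀ he hψ hc
  set N := (energy e (f t) (nlGrad ψ)).toReal
  have hN0 : 0 ≤ N := ENNReal.toReal_nonneg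
  set M := (Collision.moment (f t)).toReal
  set d : ℝ → ℝ := fun k => (dA e (f t) (f (t + k))).toReal with hd
  have hmem : ∀ᶠ k in 𝓝[≠] (0 : ℝ), t + k ∈ Ioo 0 T := by
    have : Tendsto (fun h : ℝ => t + h) (𝓝 0) (𝓝 t) := by
      simpa using (continuous_const_add t).tendsto 0
    exact nhdsWithin_le_nhds (this (isOpen_Ioo.mem_nhds ht))
  have hdn : Tendsto (fun k => d k / |k|) (𝓝[≠] 0) (𝓝 n) := by
    have h1 := (ENNReal.tendsto_toReal ENNReal.ofReal_ne_top).comp hn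
    rw [ENNReal.toReal_ofReal hn0] at h1
    refine h1.congr fun k => ?_
    simp only [Function.comp_apply, hd]
    rw [ENNReal.toReal_div, ENNReal.toReal_ofReal (abs_nonneg k), dA_comm he]
  have hd0 : Tendsto d (𝓝[≠] 0) (𝓝 0) := by
    have h1 : Tendsto (fun k : ℝ => |k|) (𝓝[≠] 0) (𝓝 0) := by
      have := (continuous_abs (G := ℝ)).tendsto 0
      rw [abs_zero] at this
      exact this.mono_left nhdsWithin_le_nhds
    have h2 := hdn.mul h1
    rw [mul_zero] at h2
    refine h2.congr' ?_
    filter_upwards [self_mem_nhdsWithin] with k hk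
    exact div_mul_cancel₀ _ (abs_ne_zero.2 hk)
  -- The distance tends to 0 with the increment, so the correction terms vanish and the energy at `f
  -- t` itself remains.
  have hmod : Tendsto (fun k => N + L * modulus M (d k) * (2 * M + modulus M (d k))) (𝓝[≠] 0)
      (𝓝 N) := by
    have hm0 : modulus M 0 = 0 := by simp [modulus]
    have h1 := ((continuous_modulus M).tendsto 0).comp hd0
    rw [hm0] at h1
    have h2 := ((h1.const_mul L).mul (h1.const_add (2 * M))).const_add N
    simpa using h2
  have hlim := (hmod.mul (hdn.pow 2))
  have hlim' := (hasDerivAt_iff_tendsto_slope_zero.1 ha).pow 2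
  have hle : a ^ 2 ≤ N * n ^ 2 := by
    refine le_of_tendsto_of_tendsto hlim' hlim ?_
    filter_upwards [hmem, self_mem_nhdsWithin] with k hk hk0
    have := hL (f t) (f (t + k)) (h.moment t (Ioo_subset_Icc_self ht)) (h.dA_ne_top he ht hk)
    have hk2 : 0 < k ^ 2 := sq_pos_of_ne_zero hk0
    rw [smul_eq_mul, mul_pow, div_pow, sq_abs, inv_pow, mul_comm, ← div_eq_mul_inv,
      ← mul_div_assoc]
    exact div_le_div_of_nonneg_right this hk2.le
  calc |a| = √(a ^ 2) := (Real.sqrt_sq_eq_abs a).symm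
    _ ≤ √(n ^ 2 * N) := Real.sqrt_le_sqrt (by linarith)
    _ = n * √N := by rw [Real.sqrt_mul (sq_nonneg n), Real.sqrt_sq hn0]

end IsACCurve

/-! ### Riesz representation on the closure of a range -/

/-- The bound makes `l` vanish on the kernel of `G`, so it descends to the range and extends with
the same norm. The Riesz vector is projected onto the closed range: this keeps the pairings with the
range and does not increase the norm. -/
theorem exists_mem_closure_inner_eq {S H : Type*} [AddCommGroup S] [Module ℝ S]
    [NormedAddCommGroup H] [InnerProductSpace ℝ H] [CompleteSpace H] (G : S →ₗ[ℝ] H)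
    (l : S →ₗ[ℝ] ℝ) {K : ℝ} (hK : 0 ≤ K) (h : ∀ s, |l s| ≤ K * ‖G s‖) :
    ∃ v ∈ closure (range G), ‖v‖ ≤ K ∧ ∀ s, inner ℝ (G s) v = l s := by
  obtain ⟨j, hj⟩ := G.rangeRestrict.exists_rightInverse_of_surjective G.range_rangeRestrict
  have hGj : ∀ y, G (j y) = y := fun y => congrArg Subtype.val (LinearMap.congr_fun hj y)
  have hl : ∀ s, l (j (G.rangeRestrict s)) = l s := fun s => by
    have h1 := h (j (G.rangeRestrict s) - s)
    rw [map_sub, map_sub, hGj, LinearMap.codRestrict_apply, sub_self, norm_zero, mul_zero] at h1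
    exact sub_eq_zero.1 (abs_nonpos_iff.1 h1)
  set φ : StrongDual ℝ (LinearMap.range G) := (l.comp j).mkContinuous K fun y => by
    have := h (j y)
    rwa [hGj] at this
  obtain ⟨g, hg, hgn⟩ := exists_extension_norm_eq _ φ
  have hgK : ‖g‖ ≤ K := hgn.trans_le (LinearMap.mkContinuous_norm_le _ hK _)
  set v₀ := (InnerProductSpace.toDual ℝ H).symm g with hv₀
  set P := (LinearMap.range G).topologicalClosure
  refine ⟨P.starProjection v₀, ?_, ?_, fun s => ?_⟩
  · have := P.starProjection_apply_mem v₀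
    rwa [← SetLike.mem_coe, Submodule.topologicalClosure_coe, LinearMap.coe_range] at this
  · refine (P.norm_starProjection_apply_le v₀).trans ?_
    rwa [hv₀, LinearIsometryEquiv.norm_map]
  · have hs : G s ∈ P := Submodule.le_topologicalClosure _ (LinearMap.mem_range_self G s)
    rw [← Submodule.inner_starProjection_left_eq_right, Submodule.starProjection_eq_self_iff.2 hs,
      real_inner_comm, hv₀, InnerProductSpace.toDual_symm_apply,
      show G s = ((G.rangeRestrict s : LinearMap.range G) : H) from rfl, hg]
    exact hl s

/-! ### A weighted Poincaré inequality for gradients -/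

section Poincare

/-- Otherwise the half plane `v < v_*` is covered by countably many null rectangles with rational
corners, and the other half plane is null by symmetry. -/
theorem exists_separated_of_prodOff_ne_zero {x : ProbabilityMeasure ℝ} (h : prodOff x ≠ 0) :
    ∃ p q : ℝ, p < q ∧ (x : Measure ℝ) (Iic p) ≠ 0 ∧ (x : Measure ℝ) (Ici q) ≠ 0 := by
  by_contra! hcon
  apply h
  have h1 : ((x : Measure ℝ).prod (x : Measure ℝ)) {p : ℝ × ℝ | p.1 < p.2} = 0 := by
    have hsub : {p : ℝ × ℝ | p.1 < p.2}
        ⊆ ⋃ q : {q : ℚ × ℚ // q.1 < q.2}, Iic (q.1.1 : ℝ) ×ˢ Ici (q.1.2 : ℝ) := by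
      rintro ⟨a, b⟩ hab
      obtain ⟨r, hr1, hr2⟩ := exists_rat_btwn (show a < b from hab)
      obtain ⟨s, hs1, hs2⟩ := exists_rat_btwn hr2
      exact mem_iUnion.2 ⟨⟨(r, s), by exact_mod_cast hs1⟩, hr1.le, hs2.le⟩
    refine measure_mono_null hsub (measure_iUnion_null fun q => ?_)
    rw [Measure.prod_prod]
    by_cases hp : (x : Measure ℝ) (Iic (q.1.1 : ℝ)) = 0
    · rw [hp, zero_mul]
    · rw [hcon _ _ (by exact_mod_cast q.2) hp, mul_zero]
  have h2 : ((x : Measure ℝ).prod (x : Measure ℝ)) {p : ℝ × ℝ | p.2 < p.1} = 0 := by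
    rw [← Measure.prod_swap, Measure.map_apply measurable_swap
      (measurableSet_lt measurable_snd measurable_fst)]
    exact h1
  rw [← Measure.measure_univ_eq_zero]
  have h3 := MeasurableEmbedding.comap_apply (MeasurableEmbedding.subtype_coe measurableSet_offDiag)
    ((x : Measure ℝ).prod (x : Measure ℝ)) univ
  refine h3.trans (measure_mono_null ?_ (measure_union_null h1 h2))
  rintro _ ⟨⟨p, hp⟩, -, rfl⟩
  exact lt_or_gt_of_ne hp

/-- The weight is small only for nearby points. A difference of `g` is therefore routed through
distant reference points `a ≤ p` and `b ≥ q`: every `v` is at distance at least `(q - p) / 2` from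
one of them. The inequality is averaged over `a` and `b`; the constant is 4 from `c`, 4 from `hXab`
and 3 from the three terms. -/
theorem lintegral_sq_sub_le {x : ProbabilityMeasure ℝ} {p q : ℝ} (hpq : p < q) {g : ℝ → ℝ}
    (hg : Measurable g) :
    (x : Measure ℝ) (Iic p) * (x : Measure ℝ) (Ici q)
        * ∫⁻ r, ENNReal.ofReal ((g r.1 - g r.2) ^ 2) ∂(x : Measure ℝ).prod (x : Measure ℝ)
      ≤ ENNReal.ofReal (48 / (q - p))
        * ∫⁻ r, ENNReal.ofReal (|r.1 - r.2| * (g r.1 - g r.2) ^ 2)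
          ∂(x : Measure ℝ).prod (x : Measure ℝ) := by
  set μ := (x : Measure ℝ) with hμ
  set k : ℝ → ℝ → ℝ≥0∞ := fun v s => ENNReal.ofReal (|v - s| * (g v - g s) ^ 2) with hk
  have hkm : Measurable fun r : ℝ × ℝ => k r.1 r.2 := by simp only [hk]; fun_prop
  set X := ∫⁻ r, ENNReal.ofReal ((g r.1 - g r.2) ^ 2) ∂μ.prod μ with hX
  set Q := ∫⁻ r, k r.1 r.2 ∂μ.prod μ with hQ
  set c := ENNReal.ofReal (4 / (q - p)) with hc
  have hk1 : ∀ a, Measurable fun v => k v a := fun a => hkm.comp measurable_prodMk_right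
  have hpt : ∀ a ≤ p, ∀ b ≥ q, ∀ v, ENNReal.ofReal ((g v - g b) ^ 2)
      ≤ c * (k v b + k v a + k a b) := by
    intro a ha b hb v
    have hd : 0 < q - p := sub_pos.2 hpq
    simp only [hc, hk]
    rw [← ENNReal.ofReal_add (by positivity) (by positivity),
      ← ENNReal.ofReal_add (by positivity) (by positivity), ← ENNReal.ofReal_mul (by positivity)]
    refine ENNReal.ofReal_le_ofReal ?_
    rw [div_mul_eq_mul_div, le_div_iff₀ hd]
    have n1 : 0 ≤ |v - b| * (g v - g b) ^ 2 := by positivity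
    have n2 : 0 ≤ |v - a| * (g v - g a) ^ 2 := by positivity
    have n3 : 0 ≤ |a - b| * (g a - g b) ^ 2 := by positivity
    rcases le_total v ((p + q) / 2) with hv | hv
    · have h1 : (q - p) / 2 ≤ |v - b| := by
        rw [abs_sub_comm]; exact le_trans (by linarith) (le_abs_self _)
      have := mul_le_mul_of_nonneg_right h1 (sq_nonneg (g v - g b))
      linarith
    · have h1 : (q - p) / 2 ≤ |v - a| := le_trans (by linarith) (le_abs_self _)
      have h2 : (q - p) / 2 ≤ |a - b| := by
        rw [abs_sub_comm]; exact le_trans (by linarith) (le_abs_self _)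
      have h3 := mul_le_mul_of_nonneg_right h1 (sq_nonneg (g v - g a))
      have h4 := mul_le_mul_of_nonneg_right h2 (sq_nonneg (g a - g b))
      have h5 : (g v - g b) ^ 2 ≤ 2 * (g v - g a) ^ 2 + 2 * (g a - g b) ^ 2 := by
        nlinarith [sq_nonneg ((g v - g a) - (g a - g b))]
      have h6 := mul_le_mul_of_nonneg_right h5 hd.le
      linarith
  have hXab : ∀ a ≤ p, ∀ b ≥ q,
      X ≤ 4 * c * ((∫⁻ v, k v b ∂μ) + (∫⁻ v, k v a ∂μ) + k a b) := by
    intro a ha b hb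
    set r : ℝ → ℝ≥0∞ := fun v => ENNReal.ofReal ((g v - g b) ^ 2) with hr
    have hrm : Measurable r := by simp only [hr]; fun_prop
    have h1 : X ≤ ∫⁻ z, (2 * r z.1 + 2 * r z.2) ∂μ.prod μ := by
      refine lintegral_mono fun z => ?_
      simp only [hr]
      rw [← ENNReal.ofReal_ofNat 2, ← ENNReal.ofReal_mul zero_le_two,
        ← ENNReal.ofReal_mul zero_le_two, ← ENNReal.ofReal_add (by positivity) (by positivity)]
      refine ENNReal.ofReal_le_ofReal ?_
      nlinarith [sq_nonneg ((g z.1 - g b) + (g z.2 - g b))]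
    have h2 : ∫⁻ z, (2 * r z.1 + 2 * r z.2) ∂μ.prod μ = 4 * ∫⁻ v, r v ∂μ := by
      rw [lintegral_add_left (by fun_prop), lintegral_prod _ (by fun_prop),
        lintegral_prod _ (by fun_prop)]
      simp only [lintegral_const, measure_univ, mul_one]
      rw [lintegral_const_mul _ hrm, ← add_mul]
      norm_num
    have h3 : ∫⁻ v, r v ∂μ ≤ c * ((∫⁻ v, k v b ∂μ) + (∫⁻ v, k v a ∂μ) + k a b) := by
      refine (lintegral_mono fun v => hpt a ha b hb v).trans (le_of_eq ?_)
      have hcf : c ≠ ⊤ := ENNReal.ofReal_ne_top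
      rw [lintegral_const_mul' c _ hcf, lintegral_add_right _ measurable_const,
        lintegral_add_right _ (hk1 a)]
      simp
    rw [h2] at h1
    refine h1.trans ?_
    rw [mul_assoc]
    exact mul_le_mul_right h3 _
  have hQ1 : ∫⁻ b, ∫⁻ v, k v b ∂μ ∂μ = Q := (lintegral_prod_symm _ hkm.aemeasurable).symm
  have hQ2 : ∫⁻ a, ∫⁻ b, k a b ∂μ ∂μ = Q := (lintegral_prod _ hkm.aemeasurable).symm
  have hm1 : Measurable fun b => ∫⁻ v, k v b ∂μ := hkm.lintegral_prod_left'
  have hmi : Measurable fun a => ∫⁻ b, k a b ∂μ := hkm.lintegral_prod_right'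
  calc μ (Iic p) * μ (Ici q) * X = ∫⁻ _a in Iic p, ∫⁻ _b in Ici q, X ∂μ ∂μ := by
        simp only [lintegral_const, Measure.restrict_apply_univ]; ring
    _ ≤ ∫⁻ a in Iic p, ∫⁻ b in Ici q,
          4 * c * ((∫⁻ v, k v b ∂μ) + (∫⁻ v, k v a ∂μ) + k a b) ∂μ ∂μ :=
        setLIntegral_mono' measurableSet_Iic fun a ha =>
          setLIntegral_mono' measurableSet_Ici fun b hb => hXab a ha b hb
    _ ≤ ∫⁻ a, ∫⁻ b, 4 * c * ((∫⁻ v, k v b ∂μ) + (∫⁻ v, k v a ∂μ) + k a b) ∂μ ∂μ :=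
        (setLIntegral_le_lintegral _ _).trans
          (lintegral_mono fun a => setLIntegral_le_lintegral _ _)
    _ = 4 * c * (Q + Q + Q) := by
        have hcf : 4 * c ≠ ⊤ := ENNReal.mul_ne_top (by simp) ENNReal.ofReal_ne_top
        simp_rw [lintegral_const_mul' _ _ hcf]
        have hin : ∀ a, ∫⁻ b, ((∫⁻ v, k v b ∂μ) + (∫⁻ v, k v a ∂μ) + k a b) ∂μ
            = Q + (∫⁻ v, k v a ∂μ) + ∫⁻ b, k a b ∂μ := fun a => by
          rw [lintegral_add_left (f := fun b => (∫⁻ v, k v b ∂μ) + ∫⁻ v, k v a ∂μ)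
            (hm1.add measurable_const), lintegral_add_left hm1, hQ1]
          simp
        simp_rw [hin]
        rw [lintegral_add_left (f := fun a => Q + ∫⁻ v, k v a ∂μ) (measurable_const.add hm1),
          lintegral_add_left measurable_const,
          hQ1, hQ2]
        simp
    _ = ENNReal.ofReal (48 / (q - p)) * Q := by
        have hd : 0 < q - p := sub_pos.2 hpq
        have : ENNReal.ofReal (48 / (q - p)) = 12 * c := by
          rw [hc, ← ENNReal.ofReal_ofNat 12, ← ENNReal.ofReal_mul (by norm_num)]
          congr 1; ring
        rw [this]; ring

/-- A weighted Poincaré inequality. -/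
theorem exists_lintegral_nlGrad_sq_le {e : ℝ} (he : e < 1) (x : ProbabilityMeasure ℝ) :
    ∃ C : ℝ≥0∞, C ≠ ⊤ ∧ ∀ ψ : ℝ → ℝ,
      ∫⁻ p, ENNReal.ofReal (nlGrad ψ p ^ 2) ∂prodOff x ≤ C * energy e x (nlGrad ψ) := by
  rcases eq_or_ne (prodOff x) 0 with h0 | h0
  · exact ⟨0, ENNReal.zero_ne_top, fun ψ => by simp [h0]⟩
  obtain ⟨p, q, hpq, hp, hq⟩ := exists_separated_of_prodOff_ne_zero h0
  have hpq0 : (x : Measure ℝ) (Iic p) * (x : Measure ℝ) (Ici q) ≠ 0 := mul_ne_zero hp hq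
  have hpqt : (x : Measure ℝ) (Iic p) * (x : Measure ℝ) (Ici q) ≠ ⊤ :=
    ENNReal.mul_ne_top (measure_ne_top _ _) (measure_ne_top _ _)
  have hc : 0 < (1 - e) / 4 := by linarith
  refine ⟨((x : Measure ℝ) (Iic p) * (x : Measure ℝ) (Ici q))⁻¹
    * (ENNReal.ofReal (48 / (q - p)) * ENNReal.ofReal ((1 - e) / 4)⁻¹),
    ENNReal.mul_ne_top (ENNReal.inv_ne_top.2 hpq0)
      (ENNReal.mul_ne_top ENNReal.ofReal_ne_top ENNReal.ofReal_ne_top), fun ψ => ?_⟩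
  have hmain := lintegral_sq_sub_le (x := x) hpq (measurable_deriv ψ)
  have hen : ∫⁻ r, ENNReal.ofReal (|r.1 - r.2| * (deriv ψ r.1 - deriv ψ r.2) ^ 2)
      ∂(x : Measure ℝ).prod (x : Measure ℝ)
      = ENNReal.ofReal ((1 - e) / 4)⁻¹ * energy e x (nlGrad ψ) := by
    rw [energy, ← lintegral_const_mul' _ _ ENNReal.ofReal_ne_top]
    have h1 : ∀ r : OffDiag, ENNReal.ofReal ((1 - e) / 4)⁻¹
        * ENNReal.ofReal (weight e r * nlGrad ψ r ^ 2)
        = ENNReal.ofReal (|r.1.1 - r.1.2| * (deriv ψ r.1.1 - deriv ψ r.1.2) ^ 2) := fun r => by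
      rw [← ENNReal.ofReal_mul (inv_nonneg.2 hc.le)]
      congr 1
      simp only [weight, sigma, nlGrad]
      have he' : 1 - e ≠ 0 := by linarith
      field_simp
      ring
    simp_rw [h1]
    rw [lintegral_prodOff x fun r =>
      ENNReal.ofReal (|r.1 - r.2| * (deriv ψ r.1 - deriv ψ r.2) ^ 2)]
    rw [← lintegral_indicator measurableSet_offDiag]
    refine lintegral_congr fun r => ?_
    by_cases hr : r.1 = r.2
    · rw [indicator_of_notMem (by simpa using hr)]; simp [hr]
    · rw [indicator_of_mem (by simpa using hr)]
  rw [hen, ← mul_assoc] at hmain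
  calc _ ≤ ∫⁻ r, ENNReal.ofReal ((deriv ψ r.1 - deriv ψ r.2) ^ 2)
        ∂(x : Measure ℝ).prod (x : Measure ℝ) := by
        refine le_trans (le_of_eq (lintegral_congr fun r => ?_)) (lintegral_prodOff_le x fun r =>
          ENNReal.ofReal ((deriv ψ r.1 - deriv ψ r.2) ^ 2))
        rw [nlGrad, ← neg_sq, neg_sub]
    _ ≤ ((x : Measure ℝ) (Iic p) * (x : Measure ℝ) (Ici q))⁻¹
        * (ENNReal.ofReal (48 / (q - p)) * ENNReal.ofReal ((1 - e) / 4)⁻¹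
          * energy e x (nlGrad ψ)) := by
        rw [← ENNReal.mul_le_iff_le_inv hpq0 hpqt]
        exact hmain
    _ = _ := by simp only [mul_assoc]

end Poincare

/-- Twice continuously differentiable observables of compact support. -/
def TestFn : Type := {ψ : ℝ → ℝ // ContDiff ℝ 2 ψ ∧ HasCompactSupport ψ}

/-- The indicator function of a time interval. -/
def window (i : TestFn × ℝ × ℝ) : ℝ → ℝ := (Ioc i.2.1 i.2.2).indicator 1

/-- The value at time `t` of a step function with values in the observables. -/
def stepFn (s : TestFn × ℝ × ℝ →₀ ℝ) (t : ℝ) : ℝ → ℝ :=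
  fun v => ∑ i ∈ s.support, s i * window i t * i.1.1 v

/-! ### Step functions in time with values in the observables -/

theorem measurable_window (i : TestFn × ℝ × ℝ) : Measurable (window i) :=
  measurable_one.indicator measurableSet_Ioc

theorem abs_window_le (i : TestFn × ℝ × ℝ) (t : ℝ) : |window i t| ≤ 1 := by
  unfold window indicator
  split_ifs <;> simp

section Slice

variable (s : TestFn × ℝ × ℝ →₀ ℝ) (t : ℝ)

theorem contDiff_stepFn : ContDiff ℝ 2 (stepFn s t) :=
  ContDiff.sum fun i _ => contDiff_const.mul i.1.2.1

theorem hasCompactSupport_stepFn : HasCompactSupport (stepFn s t) := by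
  classical
  have : ∀ S : Finset (TestFn × ℝ × ℝ),
      HasCompactSupport fun v => ∑ i ∈ S, s i * window i t * i.1.1 v := by
    intro S
    induction S using Finset.induction_on with
    | empty => simp only [Finset.sum_empty]; exact HasCompactSupport.zero
    | insert i S hi ih =>
      simp_rw [Finset.sum_insert hi]
      exact (i.1.2.2.mul_left (f := fun _ => s i * window i t)).add ih
  exact this _

theorem nlGrad_stepFn (p : OffDiag) :
    nlGrad (stepFn s t) p = ∑ i ∈ s.support, s i * window i t * nlGrad i.1.1 p := by
  have h : ∀ v, deriv (stepFn s t) v = ∑ i ∈ s.support, s i * window i t * deriv i.1.1 v :=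
    fun v => (HasDerivAt.fun_sum fun i _ =>
      ((i.1.2.1.differentiable two_ne_zero v).hasDerivAt.const_mul _)).deriv
  unfold nlGrad
  rw [h, h, ← Finset.sum_sub_distrib]
  exact Finset.sum_congr rfl fun i _ => by ring

theorem integral_stepFn (x : ProbabilityMeasure ℝ) : ∫ v, stepFn s t v ∂(x : Measure ℝ)
    = ∑ i ∈ s.support, s i * window i t * ∫ v, i.1.1 v ∂(x : Measure ℝ) := by
  unfold stepFn
  rw [integral_finsetSum _ fun i _ => ?_]
  · exact Finset.sum_congr rfl fun i _ => integral_const_mul _ _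
  · exact (i.1.2.1.continuous.integrable_of_hasCompactSupport i.1.2.2).const_mul _

end Slice

theorem ofReal_norm_sq_eq {X : Type*} [MeasurableSpace X] {μ : Measure X} (v : Lp ℝ 2 μ)
    {φ : X → ℝ} (h : v =ᵐ[μ] φ) :
    ENNReal.ofReal (‖v‖ ^ 2) = ∫⁻ x, ENNReal.ofReal (φ x ^ 2) ∂μ := by
  have hi : Integrable (fun x => v x ^ 2) μ := (Lp.memLp v).integrable_sq
  rw [← real_inner_self_eq_norm_sq, L2.inner_def]
  have h1 : ∀ x, inner ℝ (v x) (v x) = v x ^ 2 := fun x => by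
    rw [real_inner_self_eq_norm_sq, Real.norm_eq_abs, sq_abs]
  simp_rw [h1]
  rw [ofReal_integral_eq_lintegral_ofReal hi (ae_of_all _ fun x => sq_nonneg _)]
  refine lintegral_congr_ae ?_
  filter_upwards [h] with x hx
  rw [hx]

theorem coeFn_sum_smul_toLp {ι X : Type*} [MeasurableSpace X] {μ : Measure X} {g : ι → X → ℝ}
    (hg : ∀ i, MemLp (g i) 2 μ) (S : Finset ι) (c : ι → ℝ) :
    ⇑(∑ i ∈ S, c i • (hg i).toLp) =ᵐ[μ] fun x => ∑ i ∈ S, c i * g i x := by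
  classical
  induction S using Finset.induction_on with
  | empty =>
    filter_upwards [Lp.coeFn_zero ℝ 2 μ] with x hx
    simpa using hx
  | insert i S hi ih =>
    rw [Finset.sum_insert hi]
    filter_upwards [Lp.coeFn_add (c i • (hg i).toLp) (∑ i ∈ S, c i • (hg i).toLp),
      Lp.coeFn_smul (c i) (hg i).toLp, (hg i).coeFn_toLp, ih] with x h1 h2 h3 h4
    rw [h1, Pi.add_apply, h2, Pi.smul_apply, h3, h4, Finset.sum_insert hi, smul_eq_mul]

/-! ### Construction of the optimal flux by Riesz representation -/

section Riesz

variable {e T : ℝ} {f : ℝ → ProbabilityMeasure ℝ} {n : ℝ → ℝ}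

/-- The measure `f_t ⊗ f_t dt` on `[0, T]` times the pairs of distinct velocities. -/
def spaceTime (f : ℝ → ProbabilityMeasure ℝ) (hf : Continuous f) (T : ℝ) :
    Measure (ℝ × OffDiag) :=
  (volume.restrict (Icc 0 T)).compProd (pairKernel f hf)

theorem lintegral_spaceTime (hf : Continuous f) {F : ℝ × OffDiag → ℝ≥0∞} (hF : Measurable F) :
    ∫⁻ q, F q ∂spaceTime f hf T = ∫⁻ t in Icc 0 T, ∫⁻ p, F (t, p) ∂prodOff (f t) := by
  rw [spaceTime, Measure.lintegral_compProd hF]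
  simp_rw [pairKernel_apply]

/-- The vector in `L²` that represents an observable on a time interval. -/
def rieszVec (e : ℝ) (n : ℝ → ℝ) (i : TestFn × ℝ × ℝ) (q : ℝ × OffDiag) : ℝ :=
  √(weight e q.2 * (n q.1 + 1)) * (window i q.1 * nlGrad i.1.1 q.2)

theorem measurable_rieszVec (e : ℝ) (hn : Measurable n) (i : TestFn × ℝ × ℝ) :
    Measurable (rieszVec e n i) := by
  have h1 := measurable_weight e
  have h2 := measurable_window i
  have h3 := measurable_nlGrad i.1.1
  unfold rieszVec
  fun_prop

theorem sum_rieszVec (s : TestFn × ℝ × ℝ →₀ ℝ) (q : ℝ × OffDiag) :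
    ∑ i ∈ s.support, s i * rieszVec e n i q
      = √(weight e q.2 * (n q.1 + 1)) * nlGrad (stepFn s q.1) q.2 := by
  rw [nlGrad_stepFn, Finset.mul_sum]
  exact Finset.sum_congr rfl fun i _ => by unfold rieszVec; ring

/-- The square root of the weight makes the `L²` norm of a gradient its energy, and the factor `n +
1` is a weight in time. -/
theorem lintegral_sq_sqrt_mul (he : e < 1) (hf : Continuous f) (hn : Measurable n)
    (hn0 : ∀ t, 0 ≤ n t) {Φ : ℝ × OffDiag → ℝ} (hΦ : Measurable Φ) :
    ∫⁻ q, ENNReal.ofReal ((√(weight e q.2 * (n q.1 + 1)) * Φ q) ^ 2) ∂spaceTime f hf T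
      = ∫⁻ t in Icc 0 T, ENNReal.ofReal (n t + 1) * energy e (f t) (fun p => Φ (t, p)) := by
  have h1 := measurable_weight e
  rw [lintegral_spaceTime hf (by fun_prop)]
  refine lintegral_congr fun t => ?_
  rw [energy, ← lintegral_const_mul' _ _ ENNReal.ofReal_ne_top]
  refine lintegral_congr fun p => ?_
  have h2 := weight_nonneg he p
  have h3 := hn0 t
  rw [← ENNReal.ofReal_mul (by positivity), mul_pow, Real.sq_sqrt (by positivity)]
  congr 1; ring

theorem memLp_rieszVec (he : e < 1) (hf : Continuous f) (hn : Measurable n) (hn0 : ∀ t, 0 ≤ n t)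
    (hni : IntegrableOn n (Icc 0 T)) (i : TestFn × ℝ × ℝ) {C : ℝ}
    (hC : ∀ t ∈ Icc 0 T, energy e (f t) (nlGrad i.1.1) ≤ ENNReal.ofReal C) :
    MemLp (rieszVec e n i) 2 (spaceTime f hf T) := by
  have hm := measurable_rieszVec e hn i
  rw [memLp_two_iff_integrable_sq hm.aestronglyMeasurable]
  refine ⟨(hm.pow_const 2).aestronglyMeasurable, ?_⟩
  rw [hasFiniteIntegral_iff_ofReal (ae_of_all _ fun _ => sq_nonneg _)]
  have h2 := measurable_window i
  have h3 := measurable_nlGrad i.1.1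
  unfold rieszVec
  rw [lintegral_sq_sqrt_mul he hf hn hn0
    (Φ := fun q => window i q.1 * nlGrad i.1.1 q.2) (by fun_prop)]
  have h4 : ∀ t ∈ Icc 0 T, ENNReal.ofReal (n t + 1)
      * energy e (f t) (fun p => window i t * nlGrad i.1.1 p)
      ≤ ENNReal.ofReal (n t + 1) * ENNReal.ofReal C := fun t ht => by
    refine mul_le_mul_right (le_trans (lintegral_mono fun p => ENNReal.ofReal_le_ofReal ?_)
      (hC t ht)) _
    have hw : window i t ^ 2 ≤ 1 := by
      rw [← sq_abs]; exact pow_le_one₀ (abs_nonneg _) (abs_window_le i t)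
    rw [mul_pow]
    exact mul_le_mul_of_nonneg_left (mul_le_of_le_one_left (sq_nonneg _) hw) (weight_nonneg he p)
  refine (setLIntegral_mono' measurableSet_Icc h4).trans_lt ?_
  rw [lintegral_mul_const' _ _ ENNReal.ofReal_ne_top]
  refine ENNReal.mul_lt_top ?_ ENNReal.ofReal_lt_top
  have h5 : IntegrableOn (fun t => n t + 1) (Icc 0 T) := hni.add (by simp)
  have h6 := h5.2
  rwa [hasFiniteIntegral_iff_ofReal (ae_of_all _ fun t => by have := hn0 t; positivity)] at h6

theorem energy_stepFn_lt_top (he₀ : 0 ≤ e) (he : e < 1) (hM : ∀ t ∈ Icc 0 T, moment (f t) < ⊤)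
    (s : TestFn × ℝ × ℝ →₀ ℝ) {t : ℝ} (ht : t ∈ Icc 0 T) :
    energy e (f t) (nlGrad (stepFn s t)) < ⊤ := by
  obtain ⟨C, hC⟩ := exists_deriv_bound ((contDiff_stepFn s t).of_le one_le_two)
    (hasCompactSupport_stepFn s t)
  exact energy_nlGrad_lt_top he₀ he (hM t ht) hC

/-- An observable along a curve. -/
def observable (f : ℝ → ProbabilityMeasure ℝ) (ψ : ℝ → ℝ) (t : ℝ) : ℝ :=
  ∫ v, ψ v ∂(f t : Measure ℝ)

/-- At a fixed time the coefficients of the step function are frozen, and the sum is the derivative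
of the observable `stepFn s t`. For this the bound must hold at that time for all observables at
once, outside a null set independent of them. -/
theorem abs_sum_deriv_observable_le {t : ℝ} (s : TestFn × ℝ × ℝ →₀ ℝ)
    (hd : ∀ i ∈ s.support, DifferentiableAt ℝ (observable f i.1.1) t)
    (hbd : ∀ (ψ : TestFn) (a : ℝ), HasDerivAt (observable f ψ.1) a t →
      |a| ≤ n t * √(energy e (f t) (nlGrad ψ.1)).toReal) :
    |∑ i ∈ s.support, s i * window i t * deriv (observable f i.1.1) t|
      ≤ n t * √(energy e (f t) (nlGrad (stepFn s t))).toReal := by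
  refine hbd ⟨stepFn s t, contDiff_stepFn s t, hasCompactSupport_stepFn s t⟩ _ ?_
  have h1 : observable f (stepFn s t)
      = fun r => ∑ i ∈ s.support, s i * window i t * observable f i.1.1 r :=
    funext fun r => integral_stepFn s t (f r)
  rw [h1]
  exact HasDerivAt.fun_sum fun i hi => (hd i hi).hasDerivAt.const_mul _

/-- Cauchy–Schwarz for `n = (n² / (n + 1))^(1/2) · (n + 1)^(1/2)`. As `n² / (n + 1) ≤ n`, the first
factor is finite for merely integrable `n`. -/
theorem lintegral_mul_sqrt_le {E : ℝ → ℝ≥0∞} (hE : Measurable E) (hn : Measurable n)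
    (hn0 : ∀ t, 0 ≤ n t) :
    ∫⁻ t in Icc 0 T, ENNReal.ofReal (n t) * E t ^ (1 / 2 : ℝ)
      ≤ (∫⁻ t in Icc 0 T, ENNReal.ofReal (n t ^ 2 / (n t + 1))) ^ (1 / 2 : ℝ)
        * (∫⁻ t in Icc 0 T, ENNReal.ofReal (n t + 1) * E t) ^ (1 / 2 : ℝ) := by
  have h := ENNReal.lintegral_mul_le_Lp_mul_Lq (volume.restrict (Icc 0 T))
    Real.HolderConjugate.two_two
    (f := fun t => ENNReal.ofReal (n t ^ 2 / (n t + 1)) ^ (1 / 2 : ℝ))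
    (g := fun t => (ENNReal.ofReal (n t + 1) * E t) ^ (1 / 2 : ℝ))
    (by fun_prop) (by fun_prop)
  have e1 : ∀ x : ℝ≥0∞, (x ^ (1 / 2 : ℝ)) ^ (2 : ℝ) = x := fun x => by
    rw [← ENNReal.rpow_mul]; norm_num
  simp only [e1] at h
  refine le_trans (le_of_eq (lintegral_congr fun t => ?_)) h
  have h0 := hn0 t
  have h1 : 0 < n t + 1 := by positivity
  rw [Pi.mul_apply, ENNReal.mul_rpow_of_nonneg _ _ (by norm_num), ← mul_assoc,
    ← ENNReal.mul_rpow_of_nonneg _ _ (by norm_num), ← ENNReal.ofReal_mul (by positivity),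
    div_mul_cancel₀ _ h1.ne', ENNReal.ofReal_pow h0, ← ENNReal.rpow_natCast, ← ENNReal.rpow_mul]
  norm_num

end Riesz

section Riesz

variable {e T : ℝ} {f : ℝ → ProbabilityMeasure ℝ} {n : ℝ → ℝ}

theorem measurable_nlGrad_stepFn (s : TestFn × ℝ × ℝ →₀ ℝ) :
    Measurable fun q : ℝ × OffDiag => nlGrad (stepFn s q.1) q.2 := by
  simp_rw [nlGrad_stepFn]
  refine Finset.measurable_sum _ fun i _ => ?_
  have h2 := measurable_window i
  have h3 := measurable_nlGrad i.1.1
  fun_prop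

/-- The rescaling of a vector in `L²` to the density of a flux. -/
def rescale (e : ℝ) (n : ℝ → ℝ) (v : ℝ × OffDiag → ℝ) (q : ℝ × OffDiag) : ℝ :=
  √((n q.1 + 1) / weight e q.2) * v q

theorem measurable_rescale (e : ℝ) (hn : Measurable n) {v : ℝ × OffDiag → ℝ} (hv : Measurable v) :
    Measurable (rescale e n v) := by
  have h1 := measurable_weight e
  unfold rescale
  fun_prop

theorem energy_rescale (he : e < 1) (hn0 : ∀ t, 0 ≤ n t) (v : ℝ × OffDiag → ℝ) (t : ℝ) :
    energy e (f t) (fun p => rescale e n v (t, p))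
      = ENNReal.ofReal (n t + 1) * ∫⁻ p, ENNReal.ofReal (v (t, p) ^ 2) ∂prodOff (f t) := by
  rw [energy, ← lintegral_const_mul' _ _ ENNReal.ofReal_ne_top]
  refine lintegral_congr fun p => ?_
  have h2 := weight_pos he p
  have h3 := hn0 t
  rw [← ENNReal.ofReal_mul (by positivity), rescale, mul_pow, Real.sq_sqrt (by positivity)]
  congr 1
  field_simp

theorem weight_mul_rescale (he : e < 1) (hn0 : ∀ t, 0 ≤ n t) (v : ℝ × OffDiag → ℝ)
    (q : ℝ × OffDiag) :
    weight e q.2 * rescale e n v q = √(weight e q.2 * (n q.1 + 1)) * v q := by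
  have h2 := weight_pos he q.2
  have h3 : 0 ≤ n q.1 + 1 := by have := hn0 q.1; positivity
  rw [rescale, ← mul_assoc]
  congr 1
  rw [Real.sqrt_div h3, Real.sqrt_mul h2.le]
  have h4 := Real.mul_self_sqrt h2.le
  have h5 := (Real.sqrt_pos.2 h2).ne'
  field_simp
  linear_combination -√(n q.1 + 1) * h4

/-- Limits of gradients have finite mass, by the Poincaré inequality. -/
theorem lintegral_sq_rescale_lt_top (he : e < 1) (hn0 : ∀ t, 0 ≤ n t) {t : ℝ}
    {v : ℝ × OffDiag → ℝ} {ψ : ℕ → ℝ → ℝ}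
    (hlim : ∀ᵐ p ∂prodOff (f t), Tendsto
      (fun k => √(weight e p * (n t + 1)) * nlGrad (ψ k) p) atTop (𝓝 (v (t, p))))
    (hE : liminf (fun k => ENNReal.ofReal (n t + 1) * energy e (f t) (nlGrad (ψ k))) atTop < ⊤) :
    ∫⁻ p, ENNReal.ofReal (rescale e n v (t, p) ^ 2) ∂prodOff (f t) < ⊤ := by
  obtain ⟨C, hC, hP⟩ := exists_lintegral_nlGrad_sq_le he (f t)
  -- The summand 1 makes the constant nonzero, so that it can be taken out of the liminf.
  set D : ℝ≥0∞ := ENNReal.ofReal (n t + 1) * C + 1 with hD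
  have hD0 : D ≠ 0 := by simp [hD]
  have hDt : D ≠ ⊤ := ENNReal.add_ne_top.2 ⟨ENNReal.mul_ne_top ENNReal.ofReal_ne_top hC, by simp⟩
  have hn1 : 0 < n t + 1 := by have := hn0 t; positivity
  -- Rescaling cancels the weight: the left side is the limit of unweighted squared gradients, to
  -- which Fatou and the Poincaré inequality apply.
  have h1 : ∀ᵐ p ∂prodOff (f t), ENNReal.ofReal (rescale e n v (t, p) ^ 2)
      = liminf (fun k => ENNReal.ofReal ((n t + 1) ^ 2 * nlGrad (ψ k) p ^ 2)) atTop := by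
    filter_upwards [hlim] with p hp
    have hw := weight_pos he p
    have h2 : Tendsto (fun k => ENNReal.ofReal ((n t + 1) ^ 2 * nlGrad (ψ k) p ^ 2)) atTop
        (𝓝 (ENNReal.ofReal ((n t + 1) / weight e p * v (t, p) ^ 2))) := by
      refine ENNReal.tendsto_ofReal (((hp.pow 2).const_mul ((n t + 1) / weight e p)).congr
        fun k => ?_)
      rw [mul_pow, Real.sq_sqrt (by positivity)]
      field_simp
    rw [h2.liminf_eq, rescale, mul_pow, Real.sq_sqrt (by positivity)]
  rw [lintegral_congr_ae h1]
  have hm : ∀ k, Measurable fun p => ENNReal.ofReal ((n t + 1) ^ 2 * nlGrad (ψ k) p ^ 2) :=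
    fun k => by have := measurable_nlGrad (ψ k); fun_prop
  refine (lintegral_liminf_le hm).trans_lt ?_
  have h2 : ∀ k, ∫⁻ p, ENNReal.ofReal ((n t + 1) ^ 2 * nlGrad (ψ k) p ^ 2) ∂prodOff (f t)
      ≤ D * (ENNReal.ofReal (n t + 1) * energy e (f t) (nlGrad (ψ k))) := fun k => by
    simp_rw [ENNReal.ofReal_mul (sq_nonneg (n t + 1))]
    rw [lintegral_const_mul' _ _ ENNReal.ofReal_ne_top]
    calc _ ≤ ENNReal.ofReal ((n t + 1) ^ 2) * (C * energy e (f t) (nlGrad (ψ k))) :=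
          mul_le_mul_right (hP _) _
      _ = (ENNReal.ofReal (n t + 1) * C) * (ENNReal.ofReal (n t + 1)
            * energy e (f t) (nlGrad (ψ k))) := by rw [ENNReal.ofReal_pow hn1.le]; ring
      _ ≤ _ := mul_le_mul_left le_self_add _
  refine (liminf_le_liminf (Eventually.of_forall h2)).trans_lt ?_
  rw [ENNReal.liminf_const_mul_of_ne_zero_of_ne_top hD0 hDt]
  exact ENNReal.mul_lt_top hDt.lt_top hE

theorem integral_window_mul {X : ℝ → ℝ} {a b : ℝ} (ψ : TestFn) (ha : 0 ≤ a) (hab : a ≤ b)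
    (hb : b ≤ T) : ∫ t in Icc 0 T, window (ψ, a, b) t * X t = ∫ t in a..b, X t := by
  have h1 : (fun t => window (ψ, a, b) t * X t) = (Ioc a b).indicator X := by
    funext t
    unfold window indicator
    split_ifs <;> simp
  rw [h1, setIntegral_indicator measurableSet_Ioc, intervalIntegral.integral_of_le hab,
    inter_eq_self_of_subset_right (Ioc_subset_Icc_self.trans (Icc_subset_Icc ha hb))]

set_option maxHeartbeats 1600000 in
/-- The representation of the time derivatives of all observables by a single flux of minimal
energy. -/
theorem exists_flux_of_deriv_bound (he₀ : 0 ≤ e) (he : e < 1) (hf : Continuous f)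
    (hM : ∀ t ∈ Icc 0 T, moment (f t) < ⊤) (hn : Measurable n) (hn0 : ∀ t, 0 ≤ n t)
    (hni : IntegrableOn n (Icc 0 T))
    (hN : ∀ ψ : TestFn, ∃ C, ∀ t ∈ Icc 0 T, energy e (f t) (nlGrad ψ.1) ≤ ENNReal.ofReal C)
    (hdiff : ∀ ψ : TestFn, ∀ᵐ t ∂(volume.restrict (Icc 0 T)),
      DifferentiableAt ℝ (observable f ψ.1) t)
    (hint : ∀ ψ : TestFn, IntegrableOn (deriv (observable f ψ.1)) (Icc 0 T))
    (hbd : ∀ᵐ t ∂(volume.restrict (Icc 0 T)), ∀ (ψ : TestFn) (a : ℝ),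
      HasDerivAt (observable f ψ.1) a t → |a| ≤ n t * √(energy e (f t) (nlGrad ψ.1)).toReal) :
    ∃ u : ℝ × OffDiag → ℝ, Measurable u ∧
      (∀ (ψ : TestFn) (a b : ℝ), 0 ≤ a → a ≤ b → b ≤ T →
        ∫ r in a..b, deriv (observable f ψ.1) r
          = ∫ r in a..b, fluxPair e (f r) (fun p => u (r, p)) ψ.1) ∧
      ∫⁻ t in Icc 0 T, energy e (f t) (fun p => u (t, p)) / ENNReal.ofReal (n t + 1)
        ≤ ∫⁻ t in Icc 0 T, ENNReal.ofReal (n t ^ 2 / (n t + 1)) ∧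
      ∀ᵐ t ∂(volume.restrict (Icc 0 T)),
        ∫⁻ p, ENNReal.ofReal (u (t, p) ^ 2) ∂prodOff (f t) < ⊤ := by
  choose C hC using hN
  have hg : ∀ i, MemLp (rieszVec e n i) 2 (spaceTime f hf T) := fun i =>
    memLp_rieszVec he hf hn hn0 hni i (hC i.1)
  -- Formal combinations of observables on time intervals are sent by `G` to their weighted
  -- gradients, and by `l` to the integrated time derivatives that the flux has to reproduce.
  set G : (TestFn × ℝ × ℝ →₀ ℝ) →ₗ[ℝ] Lp ℝ 2 (spaceTime f hf T) :=
    Finsupp.linearCombination ℝ fun i => (hg i).toLp with hG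
  set l : (TestFn × ℝ × ℝ →₀ ℝ) →ₗ[ℝ] ℝ :=
    Finsupp.linearCombination ℝ fun i =>
      ∫ t in Icc 0 T, window i t * deriv (observable f i.1.1) t with hl
  have hGae : ∀ s, G s =ᵐ[spaceTime f hf T]
      fun q => √(weight e q.2 * (n q.1 + 1)) * nlGrad (stepFn s q.1) q.2 := fun s => by
    rw [hG, Finsupp.linearCombination_apply, Finsupp.sum]
    refine (coeFn_sum_smul_toLp hg _ _).trans (ae_of_all _ fun q => ?_)
    exact sum_rieszVec s q
  have hGn : ∀ s, ENNReal.ofReal (‖G s‖ ^ 2)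
      = ∫⁻ t in Icc 0 T, ENNReal.ofReal (n t + 1) * energy e (f t) (nlGrad (stepFn s t)) :=
    fun s => by
      rw [ofReal_norm_sq_eq _ (hGae s),
        lintegral_sq_sqrt_mul he hf hn hn0 (measurable_nlGrad_stepFn s)]
  have hEm : ∀ s, Measurable fun t => energy e (f t) (nlGrad (stepFn s t)) := fun s =>
    measurable_energy e hf (measurable_nlGrad_stepFn s)
  set A := ∫⁻ t in Icc 0 T, ENNReal.ofReal (n t ^ 2 / (n t + 1)) with hA
  have hAt : A < ⊤ := by
    have h1 := hni.2
    rw [hasFiniteIntegral_iff_ofReal (ae_of_all _ hn0)] at h1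
    refine (lintegral_mono fun t => ENNReal.ofReal_le_ofReal ?_).trans_lt h1
    have := hn0 t
    rw [div_le_iff₀ (by positivity)]
    nlinarith
  have hls : ∀ s, |l s| ≤ √A.toReal * ‖G s‖ := by
    intro s
    have hwi : ∀ i : TestFn × ℝ × ℝ, IntegrableOn
        (fun t => window i t * deriv (observable f i.1.1) t) (Icc 0 T) := fun i =>
      (hint i.1).bdd_mul (c := 1) (measurable_window i).aestronglyMeasurable
        (ae_of_all _ (abs_window_le i))
    have h1 : l s = ∫ t in Icc 0 T,
        ∑ i ∈ s.support, s i * window i t * deriv (observable f i.1.1) t := by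
      rw [hl, Finsupp.linearCombination_apply, Finsupp.sum]
      simp_rw [mul_assoc]
      rw [integral_finsetSum _ fun i _ => (hwi i).const_mul (s i)]
      exact Finset.sum_congr rfl fun i _ => by rw [smul_eq_mul, integral_const_mul]
    have h2 : ∀ᵐ t ∂(volume.restrict (Icc 0 T)),
        ‖∑ i ∈ s.support, s i * window i t * deriv (observable f i.1.1) t‖ₑ
          ≤ ENNReal.ofReal (n t) * energy e (f t) (nlGrad (stepFn s t)) ^ (1 / 2 : ℝ) := by
      have h3 : ∀ᵐ t ∂(volume.restrict (Icc 0 T)), ∀ i ∈ s.support,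
          DifferentiableAt ℝ (observable f i.1.1) t :=
        (Finset.eventually_all s.support).2 fun i _ => hdiff i.1
      filter_upwards [h3, hbd, ae_restrict_mem measurableSet_Icc] with t ht hb htm
      have h4 := abs_sum_deriv_observable_le s ht hb
      rw [← ofReal_norm, Real.norm_eq_abs]
      refine (ENNReal.ofReal_le_ofReal h4).trans (le_of_eq ?_)
      rw [ENNReal.ofReal_mul (hn0 t), Real.sqrt_eq_rpow,
        ← ENNReal.ofReal_rpow_of_nonneg ENNReal.toReal_nonneg (by norm_num),
        ENNReal.ofReal_toReal (energy_stepFn_lt_top he₀ he hM s htm).ne]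
    have h5 : ENNReal.ofReal |l s| ≤ A ^ (1 / 2 : ℝ) * ENNReal.ofReal (‖G s‖ ^ 2) ^ (1 / 2 : ℝ) := by
      rw [← Real.norm_eq_abs, ofReal_norm, h1, hGn]
      exact (enorm_integral_le_lintegral_enorm _).trans ((lintegral_mono_ae h2).trans
        (lintegral_mul_sqrt_le (hEm s) hn hn0))
    rw [← ENNReal.ofReal_toReal hAt.ne, ENNReal.ofReal_rpow_of_nonneg ENNReal.toReal_nonneg
      (by norm_num), ENNReal.ofReal_rpow_of_nonneg (sq_nonneg _) (by norm_num),
      ← Real.sqrt_eq_rpow, ← Real.sqrt_eq_rpow, Real.sqrt_sq (norm_nonneg _),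
      ← ENNReal.ofReal_mul (Real.sqrt_nonneg _),
      ENNReal.ofReal_le_ofReal_iff (by positivity)] at h5
    exact h5
  obtain ⟨v, hvc, hvn, hvl⟩ := exists_mem_closure_inner_eq G l (Real.sqrt_nonneg _) hls
  have hvm : Measurable (v : ℝ × OffDiag → ℝ) := (Lp.stronglyMeasurable v).measurable
  refine ⟨rescale e n v, measurable_rescale e hn hvm, fun ψ a b ha hab hb => ?_, ?_, ?_⟩
  -- A single generator gives the continuity equation for `ψ` on the interval from `a` to `b`.
  · have h1 := hvl (Finsupp.single (ψ, a, b) 1)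
    rw [hG, hl, Finsupp.linearCombination_single, Finsupp.linearCombination_single, one_smul,
      one_smul, integral_window_mul ψ ha hab hb, L2.inner_def] at h1
    rw [← h1]
    have h2 : (fun q => inner ℝ ((hg (ψ, a, b)).toLp (rieszVec e n (ψ, a, b)) q) (v q))
        =ᵐ[spaceTime f hf T] fun q => rieszVec e n (ψ, a, b) q * v q := by
      filter_upwards [(hg (ψ, a, b)).coeFn_toLp] with q hq
      rw [hq, RCLike.inner_apply, conj_trivial, mul_comm]
    have h3 : Integrable (fun q => rieszVec e n (ψ, a, b) q * v q) (spaceTime f hf T) :=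
      (hg (ψ, a, b)).integrable_mul (Lp.memLp v)
    rw [integral_congr_ae h2]
    unfold spaceTime at h3 ⊢
    rw [Measure.integral_compProd h3, ← integral_window_mul ψ ha hab hb]
    refine integral_congr_ae (ae_of_all _ fun t => ?_)
    simp only [pairKernel_apply, fluxPair]
    rw [← integral_const_mul]
    refine integral_congr_ae (ae_of_all _ fun p => ?_)
    have h4 := weight_mul_rescale he hn0 v (t, p)
    change √(weight e p * (n t + 1)) * (window (ψ, a, b) t * nlGrad ψ.1 p) * v (t, p)
      = window (ψ, a, b) t * (weight e p * nlGrad ψ.1 p * rescale e n v (t, p))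
    change weight e p * rescale e n v (t, p) = √(weight e p * (n t + 1)) * v (t, p) at h4
    linear_combination -(window (ψ, a, b) t * nlGrad ψ.1 p) * h4
  · have h1 : ∀ t, energy e (f t) (fun p => rescale e n v (t, p)) / ENNReal.ofReal (n t + 1)
        = ∫⁻ p, ENNReal.ofReal (v (t, p) ^ 2) ∂prodOff (f t) := fun t => by
      have : 0 < n t + 1 := by have := hn0 t; positivity
      rw [energy_rescale he hn0, mul_comm, ENNReal.mul_div_cancel_right
        (ENNReal.ofReal_pos.2 this).ne' ENNReal.ofReal_ne_top]
    simp_rw [h1]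
    rw [← lintegral_spaceTime hf (F := fun q => ENNReal.ofReal (v q ^ 2)) (by fun_prop),
      ← ofReal_norm_sq_eq v EventuallyEq.rfl, ← ENNReal.ofReal_toReal hAt.ne]
    refine ENNReal.ofReal_le_ofReal ?_
    calc ‖v‖ ^ 2 ≤ √A.toReal ^ 2 := pow_le_pow_left₀ (norm_nonneg _) hvn 2
      _ = _ := Real.sq_sqrt ENNReal.toReal_nonneg
  -- As `v` lies in the closure of the range, a subsequence of gradients converges to it almost
  -- everywhere, hence on almost every time slice. Fatou in time keeps the liminf of the slice
  -- energies finite.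
  · obtain ⟨y, hy, hyv⟩ := mem_closure_iff_seq_limit.1 hvc
    choose s hs using hy
    have hyv' : Tendsto (fun k => G (s k)) atTop (𝓝 v) := by simpa only [hs] using hyv
    obtain ⟨ns, hns, hae⟩ := (tendstoInMeasure_of_tendsto_Lp hyv').exists_seq_tendsto_ae
    have hall := ae_all_iff.2 fun k => hGae (s k)
    have hae' : ∀ᵐ q ∂spaceTime f hf T, Tendsto (fun k => √(weight e q.2 * (n q.1 + 1))
        * nlGrad (stepFn (s (ns k)) q.1) q.2) atTop (𝓝 (v q)) := by
      filter_upwards [hae, hall] with q h1 h2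
      exact h1.congr fun k => h2 (ns k)
    have hslice := Measure.ae_ae_of_ae_compProd hae'
    have hFm : ∀ k, Measurable fun t => ENNReal.ofReal (n t + 1)
        * energy e (f t) (nlGrad (stepFn (s (ns k)) t)) := fun k =>
      (hn.add_const 1).ennreal_ofReal.mul (hEm _)
    have hbound : ∫⁻ t in Icc 0 T, liminf (fun k => ENNReal.ofReal (n t + 1)
        * energy e (f t) (nlGrad (stepFn (s (ns k)) t))) atTop < ⊤ := by
      refine (lintegral_liminf_le hFm).trans_lt ?_
      simp_rw [← hGn]
      have h1 : Tendsto (fun k => ENNReal.ofReal (‖G (s (ns k))‖ ^ 2)) atTop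
          (𝓝 (ENNReal.ofReal (‖v‖ ^ 2))) :=
        ENNReal.tendsto_ofReal (((hyv'.comp hns.tendsto_atTop).norm).pow 2)
      rw [h1.liminf_eq]
      exact ENNReal.ofReal_lt_top
    filter_upwards [hslice, ae_lt_top (Measurable.liminf hFm) hbound.ne] with t h1 h2
    rw [pairKernel_apply] at h1
    exact lintegral_sq_rescale_lt_top he hn0 h1 h2

end Riesz

/-! ### Absolute continuity up to the end points and smoother test functions -/

/-- The increments are bounded only between interior times. Both sides are continuous on the closed
square, so the bound extends to its closure. -/
theorem absolutelyContinuousOnInterval_of_abs_sub_le {T K : ℝ} (hT : 0 < T) (hK : 0 ≤ K)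
    {F m : ℝ → ℝ} (hF : Continuous F) (hm : IntervalIntegrable m volume 0 T)
    (h : ∀ s ∈ Ioo 0 T, ∀ t ∈ Ioo 0 T, |F t - F s| ≤ K * |∫ r in s..t, m r|) :
    AbsolutelyContinuousOnInterval F 0 T := by
  set M : ℝ → ℝ := fun x => K * ∫ r in (0 : ℝ)..x, m r with hM
  have hac : AbsolutelyContinuousOnInterval M 0 T :=
    (hm.absolutelyContinuousOnInterval_intervalIntegral left_mem_uIcc).const_mul K
  refine absolutelyContinuousOnInterval_of_dist_le hac fun x hx y hy => ?_
  have hMc := hac.continuousOn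
  rw [uIcc_of_le hT.le] at hx hy hMc
  have hMc' : ContinuousOn (fun q : ℝ × ℝ => dist (M q.1) (M q.2)) (Icc 0 T ×ˢ Icc 0 T) :=
    continuous_dist.comp_continuousOn
      ((hMc.comp continuousOn_fst fun q hq => hq.1).prodMk
        (hMc.comp continuousOn_snd fun q hq => hq.2))
  have hcl : (x, y) ∈ closure (Ioo 0 T ×ˢ Ioo 0 T) := by
    rw [closure_prod_eq, closure_Ioo hT.ne]; exact ⟨hx, hy⟩
  refine ContinuousWithinAt.closure_le (f := fun q : ℝ × ℝ => dist (F q.1) (F q.2))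
    (g := fun q : ℝ × ℝ => dist (M q.1) (M q.2)) hcl (by fun_prop)
    ((hMc' (x, y) ⟨hx, hy⟩).mono (prod_mono Ioo_subset_Icc_self Ioo_subset_Icc_self)) ?_
  rintro ⟨s, t⟩ ⟨hs, ht⟩
  have hI : ∀ r ∈ Ioo 0 T, IntervalIntegrable m volume 0 r := fun r hr =>
    hm.mono_set (uIcc_subset_uIcc left_mem_uIcc (mem_uIcc_of_le hr.1.le hr.2.le))
  have h1 : dist (M s) (M t) = K * |∫ r in s..t, m r| := by
    rw [dist_comm, Real.dist_eq, hM, ← mul_sub, abs_mul, abs_of_nonneg hK,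
      intervalIntegral.integral_interval_sub_left (hI t ht) (hI s hs)]
  change dist (F s) (F t) ≤ dist (M s) (M t)
  rw [h1, dist_comm, Real.dist_eq]
  exact h s hs t ht

/-- Difference quotients with increment `1 / (k + 1)`. -/
def diffQuot (g : ℝ → ℝ) (k : ℕ) (v : ℝ) : ℝ :=
  (1 / ((k : ℝ) + 1))⁻¹ * (g (v + 1 / ((k : ℝ) + 1)) - g v)

theorem abs_diffQuot_le {g : ℝ → ℝ} (hg : ContDiff ℝ 1 g) {C : ℝ} (hC : ∀ v, |deriv g v| ≤ C)
    (k : ℕ) (v : ℝ) : |diffQuot g k v| ≤ C := by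
  have hk : (0 : ℝ) < 1 / ((k : ℝ) + 1) := Nat.one_div_pos_of_nat
  have h1 := abs_sub_le_of_deriv_bound hg hC (v + 1 / ((k : ℝ) + 1)) v
  rw [add_sub_cancel_left, abs_of_pos hk] at h1
  rw [diffQuot, abs_mul, abs_of_pos (inv_pos.2 hk), inv_mul_le_iff₀ hk, mul_comm]
  exact h1

theorem tendsto_diffQuot {g : ℝ → ℝ} {v g' : ℝ} (hg : HasDerivAt g g' v) :
    Tendsto (fun k => diffQuot g k v) atTop (𝓝 g') := by
  have h1 : Tendsto (fun k : ℕ => 1 / ((k : ℝ) + 1)) atTop (𝓝[≠] 0) :=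
    tendsto_nhdsWithin_iff.2 ⟨tendsto_one_div_add_atTop_nhds_zero_nat,
      Eventually.of_forall fun k => (Nat.one_div_pos_of_nat (α := ℝ)).ne'⟩
  exact (hasDerivAt_iff_tendsto_slope_zero.1 hg).comp h1

theorem hasDerivAt_diffQuot {g g' : ℝ → ℝ} (hg : ∀ v, HasDerivAt g (g' v) v) (k : ℕ) (v : ℝ) :
    HasDerivAt (diffQuot g k) (diffQuot g' k v) v :=
  (((hg _).comp_add_const v _).sub (hg v)).const_mul _

/-- Approximation of observables by smoother ones. -/
theorem exists_approx_testFn {ψ : ℝ → ℝ} (hψ : ContDiff ℝ 1 ψ) (hc : HasCompactSupport ψ) :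
    ∃ (B C : ℝ) (χ : ℕ → TestFn), (∀ k v, |(χ k).1 v| ≤ B) ∧ (∀ k v, |deriv (χ k).1 v| ≤ C) ∧
      (∀ v, |deriv ψ v| ≤ C) ∧ (∀ v, Tendsto (fun k => (χ k).1 v) atTop (𝓝 (ψ v))) ∧
      ∀ v, Tendsto (fun k => deriv (χ k).1 v) atTop (𝓝 (deriv ψ v)) := by
  obtain ⟨C, hC⟩ := exists_deriv_bound hψ hc
  obtain ⟨B, hB⟩ := hψ.continuous.bounded_above_of_compact_support hc
  -- Difference quotients of a primitive of `ψ` are local averages of `ψ`: they gain one derivative,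
  -- keep compact support, and inherit the bounds on `ψ` and its derivative.
  set P : ℝ → ℝ := fun v => ∫ x in (0 : ℝ)..v, ψ x with hP
  have hPd : ∀ v, HasDerivAt P (ψ v) v := fun v =>
    intervalIntegral.integral_hasDerivAt_right (hψ.continuous.intervalIntegrable _ _)
      (hψ.continuous.stronglyMeasurableAtFilter _ _) hψ.continuous.continuousAt
  have hPd' : deriv P = ψ := funext fun v => (hPd v).deriv
  have hP2 : ContDiff ℝ 2 P := by
    rw [← one_add_one_eq_two, contDiff_succ_iff_deriv]
    exact ⟨fun v => (hPd v).differentiableAt, by simp, by rwa [hPd']⟩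
  have hψd : ∀ v, HasDerivAt ψ (deriv ψ v) v := fun v =>
    (hψ.differentiable one_ne_zero v).hasDerivAt
  have hd : ∀ k, deriv (diffQuot P k) = diffQuot ψ k := fun k =>
    funext fun v => (hasDerivAt_diffQuot hPd k v).deriv
  have hs : ∀ k, ContDiff ℝ 2 (diffQuot P k) := fun k =>
    contDiff_const.mul ((hP2.comp (contDiff_id.add contDiff_const)).sub hP2)
  obtain ⟨R, hR⟩ := hc.isCompact.isBounded.subset_closedBall 0
  have hcs : ∀ k, HasCompactSupport (diffQuot P k) := fun k => by
    have hk : (0 : ℝ) < 1 / ((k : ℝ) + 1) := Nat.one_div_pos_of_nat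
    have hk1 : 1 / ((k : ℝ) + 1) ≤ 1 := by
      rw [div_le_one (by positivity)]; linarith [Nat.cast_nonneg (α := ℝ) k]
    refine HasCompactSupport.intro (isCompact_Icc (a := -R - 1) (b := R)) fun v hv => ?_
    have h0 : P (v + 1 / ((k : ℝ) + 1)) - P v = 0 := by
      rw [hP, intervalIntegral.integral_interval_sub_left
        (hψ.continuous.intervalIntegrable _ _) (hψ.continuous.intervalIntegrable _ _)]
      refine (intervalIntegral.integral_congr (g := fun _ => (0 : ℝ)) fun x hx => ?_).trans (by simp)
      rw [uIcc_of_le (by linarith)] at hx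
      refine image_eq_zero_of_notMem_tsupport fun hx' => hv ?_
      have := hR hx'
      rw [mem_closedBall_zero_iff, Real.norm_eq_abs, abs_le] at this
      exact ⟨by linarith [hx.2], by linarith [hx.1]⟩
    rw [diffQuot, h0, mul_zero]
  refine ⟨B, C, fun k => ⟨diffQuot P k, hs k, hcs k⟩, fun k v => ?_, fun k v => ?_, hC,
    fun v => tendsto_diffQuot (hPd v), fun v => ?_⟩
  · exact abs_diffQuot_le (hP2.of_le (by norm_num)) (fun w => by rw [hPd']; exact hB w) k v
  · rw [hd]; exact abs_diffQuot_le hψ hC k v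
  · simp only [hd]; exact tendsto_diffQuot (hψd v)

variable {e T : ℝ} {f : ℝ → ProbabilityMeasure ℝ} {u : ℝ × OffDiag → ℝ}

theorem tendsto_fluxPair (he : e < 1) {x : ProbabilityMeasure ℝ} {w : OffDiag → ℝ}
    (hw : Measurable w) (h : fluxMass e x w < ⊤) {χ : ℕ → ℝ → ℝ} {ψ : ℝ → ℝ} {C : ℝ}
    (hC : ∀ k v, |deriv (χ k) v| ≤ C)
    (hχ : ∀ v, Tendsto (fun k => deriv (χ k) v) atTop (𝓝 (deriv ψ v))) :
    Tendsto (fun k => fluxPair e x w (χ k)) atTop (𝓝 (fluxPair e x w ψ)) := by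
  have hi := ((integrable_weight_mul he hw h).abs).const_mul (2 * C)
  refine tendsto_integral_of_dominated_convergence _
    (fun k => (integrable_fluxPair he hw h (hC k)).aestronglyMeasurable) hi
    (fun k => ae_of_all _ fun p => ?_) (ae_of_all _ fun p => ?_)
  · rw [Real.norm_eq_abs, mul_right_comm, abs_mul, mul_comm]
    exact mul_le_mul_of_nonneg_right (abs_nlGrad_le (hC k) p) (abs_nonneg _)
  · exact (((hχ _).sub (hχ _)).const_mul _).mul_const _

/-- It suffices to test the continuity equation with smoother observables. -/
theorem isDensitySolution_of_testFn (he : e < 1) (hf : Continuous f) (hu : Measurable u)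
    (fin : ∀ᵐ t ∂(volume.restrict (Icc 0 T)), Integrable (fun p => u (t, p)) (prodOff (f t)))
    (mass : ∫⁻ t in Icc 0 T, fluxMass e (f t) (fun p => u (t, p)) < ⊤)
    (eq : ∀ (χ : TestFn) (s t : ℝ), 0 ≤ s → s ≤ t → t ≤ T →
      observable f χ.1 t - observable f χ.1 s
        = ∫ r in s..t, fluxPair e (f r) (fun p => u (r, p)) χ.1) :
    IsDensitySolution e 0 T f u := by
  refine ⟨hf, hu, fin, mass, fun ψ hψ hc s t hs hst ht => ?_⟩
  obtain ⟨B, C, χ, hB, hC, -, hχ, hχ'⟩ := exists_approx_testFn hψ hc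
  have hum : ∀ t, Measurable fun p => u (t, p) := fun t => by fun_prop
  have hobs : ∀ r, Tendsto (fun k => observable f (χ k).1 r) atTop
      (𝓝 (∫ v, ψ v ∂(f r : Measure ℝ))) := fun r =>
    tendsto_integral_of_dominated_convergence (fun _ => B)
      (fun k => (χ k).2.1.continuous.aestronglyMeasurable) (integrable_const B)
      (fun k => ae_of_all _ (hB k)) (ae_of_all _ hχ)
  refine tendsto_nhds_unique ((hobs t).sub (hobs s)) ?_
  have hmi : IntegrableOn (fun r => (fluxMass e (f r) (fun p => u (r, p))).toReal) (Icc 0 T) :=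
    integrable_toReal_of_lintegral_ne_top (measurable_fluxMass e hf hu).aemeasurable mass.ne
  have hfin := ae_lt_top (measurable_fluxMass e hf hu) mass.ne
  have hsub : Ioc s t ⊆ Icc 0 T := fun r hr => ⟨hs.trans hr.1.le, hr.2.trans ht⟩
  have hfin' := ae_restrict_of_ae_restrict_of_subset hsub hfin
  simp only [eq _ s t hs hst ht, intervalIntegral.integral_of_le hst]
  refine tendsto_integral_of_dominated_convergence _
    (fun k => (measurable_fluxPair e hf hu _).aestronglyMeasurable)
    ((hmi.mono_set hsub).const_mul (2 * C)) (fun k => ?_) ?_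
  · filter_upwards [hfin'] with r hr
    exact abs_fluxPair_le he (hum r) hr (hC k)
  · filter_upwards [hfin'] with r hr
    exact tendsto_fluxPair he (hum r) hr hC hχ'

/-- This recovers an integrable square root of the energy from the bound on `E / (n + 1)`, with `ρ =
n + 1`. -/
theorem rpow_half_le_div_add (x : ℝ≥0∞) {ρ : ℝ≥0∞} (h0 : ρ ≠ 0) (h1 : ρ ≠ ⊤) :
    x ^ (1 / 2 : ℝ) ≤ x / ρ + ρ := by
  rcases le_total (x ^ (1 / 2 : ℝ)) ρ with h | h
  · exact h.trans le_add_self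
  · refine le_trans ?_ le_self_add
    rw [ENNReal.le_div_iff_mul_le (Or.inl h0) (Or.inl h1)]
    calc x ^ (1 / 2 : ℝ) * ρ ≤ x ^ (1 / 2 : ℝ) * x ^ (1 / 2 : ℝ) := by gcongr
      _ = x := by
          rw [← ENNReal.rpow_add_of_nonneg _ _ (by norm_num) (by norm_num)]; norm_num

/-! ### Optimality of the flux -/

variable {e T : ℝ} {f : ℝ → ProbabilityMeasure ℝ}

/-- The metric derivative is bounded by the energy of any solution. -/
theorem sq_metricDeriv_le_energy (he : e < 1) (hT : 0 < T) {u : ℝ × OffDiag → ℝ} {n : ℝ → ℝ}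
    (h : IsDensitySolution e 0 T (fun t => f (projIcc 0 T hT.le t)) u)
    (hE : ∫⁻ t in Icc 0 T, energy e (f (projIcc 0 T hT.le t)) (fun p => u (t, p)) ^ (1 / 2 : ℝ) < ⊤)
    (hn : ∀ᵐ t ∂(volume.restrict (Icc 0 T)), HasMetricDeriv e f t (ENNReal.ofReal (n t))) :
    ∀ᵐ t ∂(volume.restrict (Icc 0 T)),
      ENNReal.ofReal (n t) ^ 2 ≤ energy e (f (projIcc 0 T hT.le t)) (fun p => u (t, p)) := by
  have hum : ∀ t, Measurable fun p => u (t, p) := fun t => h.meas.comp measurable_prodMk_left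
  have hcl : ∀ t ∈ Icc 0 T, f t = f (projIcc 0 T hT.le t) := fun t ht => by
    rw [projIcc_of_mem hT.le ht]
  have hg : GCE e T f _ := (h.gce he hT).congr hcl fun t _ => rfl
  have hle : ∀ t ∈ Icc 0 T, action e (f t)
      ((prodOff (f (projIcc 0 T hT.le t))).withDensityᵥ fun p => u (t, p))
      ≤ energy e (f (projIcc 0 T hT.le t)) (fun p => u (t, p)) := fun t ht => by
    rw [hcl t ht]
    exact action_withDensityᵥ_le e _ (hum t)
  obtain ⟨-, -, -, hr⟩ := isAC_and_metricDeriv_of_GCE he hT hg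
    ((setLIntegral_mono' measurableSet_Icc fun t ht =>
      ENNReal.rpow_le_rpow (hle t ht) (by norm_num)).trans_lt hE)
  filter_upwards [hr, hn, ae_restrict_mem measurableSet_Icc] with t ⟨r, hr1, hr2⟩ hnt ht
  rw [hnt.unique hr1]
  exact hr2.trans (hle t ht)

/-- The curves of finite first moment that are absolutely continuous have a flux whose energy is
the square of the metric derivative. -/
theorem IsACCurve.exists_optimal_flux {m : ℝ → ℝ} (he₀ : 0 ≤ e) (he : e < 1) (hT : 0 < T)
    (h : IsACCurve e T f m) :
    ∃ (n : ℝ → ℝ) (u : ℝ × OffDiag → ℝ), Measurable n ∧ (∀ t, 0 ≤ n t) ∧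
      IntegrableOn n (Icc 0 T) ∧ (∀ᵐ t ∂(volume.restrict (Icc 0 T)), n t ≤ m t) ∧
      (∀ᵐ t ∂(volume.restrict (Icc 0 T)), HasMetricDeriv e f t (ENNReal.ofReal (n t))) ∧
      IsDensitySolution e 0 T (fun t => f (projIcc 0 T hT.le t)) u ∧
      ∀ᵐ t ∂(volume.restrict (Icc 0 T)),
        energy e (f (projIcc 0 T hT.le t)) (fun p => u (t, p)) = ENNReal.ofReal (n t) ^ 2 := by
  obtain ⟨n, hn, hn0, hni, hnm, -, hnd⟩ := exists_hasMetricDeriv he h.nonneg h.integrable h.dA_le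
  rw [IntegrableOn, restrict_Ioo_eq_restrict_Icc] at hni
  obtain ⟨B, hB0, hB⟩ := h.exists_moment_bound he₀ he
  obtain ⟨κ, hκ, hκle⟩ := h.exists_abs_integral_sub_le he₀ he
  set g : ℝ → ProbabilityMeasure ℝ := fun t => f (projIcc 0 T hT.le t) with hg
  have hgc : Continuous g := continuous_clamp hT.le (h.continuousOn he₀ he)
  have hgf : ∀ t ∈ Icc 0 T, g t = f t := fun t ht => by rw [hg]; simp only [projIcc_of_mem hT.le ht]
  have hmom : ∀ t ∈ Icc 0 T, Collision.moment (g t) ≤ ENNReal.ofReal B := fun t ht => by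
    rw [hgf t ht]; exact (ENNReal.le_ofReal_iff_toReal_le (h.moment t ht).ne hB0).2 (hB t ht)
  have hac : ∀ χ : TestFn, AbsolutelyContinuousOnInterval (observable g χ.1) 0 T := fun χ => by
    have hχ : ContDiff ℝ 1 χ.1 := χ.2.1.of_le (by norm_num)
    obtain ⟨C, hC⟩ := exists_deriv_bound hχ χ.2.2
    refine absolutelyContinuousOnInterval_of_abs_sub_le hT
      (mul_nonneg hκ ((abs_nonneg _).trans (hC 0)))
      (continuous_integral_curve hgc hχ.continuous χ.2.2)
      (h.intervalIntegrable (left_mem_Icc.2 hT.le) (right_mem_Icc.2 hT.le)) fun s hs t ht => ?_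
    have := hκle χ.1 C hχ hC s hs t ht
    rwa [← hgf s (Ioo_subset_Icc_self hs), ← hgf t (Ioo_subset_Icc_self ht)] at this
  obtain ⟨u, hu, hueq, huE, hu2⟩ := exists_flux_of_deriv_bound (T := T) he₀ he hgc
    (fun t ht => (hmom t ht).trans_lt ENNReal.ofReal_lt_top) hn hn0 hni
    (fun χ => by
      obtain ⟨C, hC⟩ := exists_deriv_bound (χ.2.1.of_le (by norm_num)) χ.2.2
      refine ⟨(2 * C) ^ 2 * (2 * B), fun t ht => ?_⟩
      rw [ENNReal.ofReal_mul (sq_nonneg _), ENNReal.ofReal_mul zero_le_two, ENNReal.ofReal_ofNat]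
      refine (energy_nlGrad_le he _ hC).trans ?_
      gcongr
      refine (energy_one_le he₀ he _).trans ?_
      gcongr
      exact hmom t ht)
    (fun χ => by
      rw [ae_restrict_iff' measurableSet_Icc]
      have := (hac χ).ae_differentiableAt
      rwa [uIcc_of_le hT.le] at this)
    (fun χ => by
      have := (hac χ).intervalIntegrable_deriv
      rwa [intervalIntegrable_iff_integrableOn_Icc_of_le hT.le] at this)
    (by
      have hIoo : ∀ᵐ t ∂(volume.restrict (Icc 0 T)), t ∈ Ioo 0 T := by
        rw [← restrict_Ioo_eq_restrict_Icc]; exact ae_restrict_mem measurableSet_Ioo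
      filter_upwards [hnd, hIoo] with t hnt ht χ a ha
      rw [hgf t (Ioo_subset_Icc_self ht)]
      refine h.abs_deriv_le he₀ he ht (hn0 t) hnt χ.2.1 χ.2.2 (ha.congr_of_eventuallyEq ?_)
      filter_upwards [isOpen_Ioo.mem_nhds ht] with s hs
      rw [observable, hgf s (Ioo_subset_Icc_self hs)])
  have hum : ∀ t, Measurable fun p => u (t, p) := fun t => hu.comp measurable_prodMk_left
  have hEm := measurable_energy e hgc hu
  have hρ0 : ∀ t, ENNReal.ofReal (n t + 1) ≠ 0 := fun t => by
    rw [Ne, ENNReal.ofReal_eq_zero, not_le]; linarith [hn0 t]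
  have hle : ∀ t, n t ^ 2 / (n t + 1) ≤ n t := fun t => by
    have := hn0 t
    rw [div_le_iff₀ (by linarith)]; nlinarith
  have hfin1 : ∫⁻ t in Icc 0 T, ENNReal.ofReal (n t ^ 2 / (n t + 1)) < ⊤ :=
    (lintegral_mono fun t => ENNReal.ofReal_le_ofReal (hle t)).trans_lt
      ((hasFiniteIntegral_iff_ofReal (ae_of_all _ hn0)).1 hni.2)
  have hfin2 : ∫⁻ t in Icc 0 T, ENNReal.ofReal (n t + 1) < ⊤ :=
    (hasFiniteIntegral_iff_ofReal (ae_of_all _ fun t => add_nonneg (hn0 t) zero_le_one)).1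
      (hni.add (integrable_const 1)).2
  have hEhalf : ∫⁻ t in Icc 0 T, energy e (g t) (fun p => u (t, p)) ^ (1 / 2 : ℝ) < ⊤ := by
    refine (lintegral_mono fun t => rpow_half_le_div_add _ (hρ0 t) ENNReal.ofReal_ne_top).trans_lt ?_
    rw [lintegral_add_right _ (by fun_prop)]
    exact ENNReal.add_lt_top.2 ⟨huE.trans_lt hfin1, hfin2⟩
  have hsol : IsDensitySolution e 0 T g u := by
    refine isDensitySolution_of_testFn he hgc hu ?_ ?_ fun χ s t hs hst ht => ?_
    -- On a finite measure, square integrability of the density, which came from the Poincaré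
    -- inequality, gives integrability.
    · filter_upwards [hu2] with t ht
      have hL2 : MemLp (fun p => u (t, p)) 2 (prodOff (g t)) := by
        refine (memLp_two_iff_integrable_sq (hum t).aestronglyMeasurable).2
          ⟨((hum t).pow_const 2).aestronglyMeasurable, ?_⟩
        rwa [hasFiniteIntegral_iff_ofReal (ae_of_all _ fun p => sq_nonneg _)]
      exact hL2.integrable one_le_two
    · calc ∫⁻ t in Icc 0 T, fluxMass e (g t) (fun p => u (t, p))
          ≤ ∫⁻ t in Icc 0 T, (2 * ENNReal.ofReal B) ^ (1 / 2 : ℝ)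
              * energy e (g t) (fun p => u (t, p)) ^ (1 / 2 : ℝ) :=
            setLIntegral_mono' measurableSet_Icc fun t ht =>
              (fluxMass_le he₀ he _ (hum t)).trans (by gcongr; exact hmom t ht)
        _ < ⊤ := by
            rw [lintegral_const_mul _ (hEm.pow_const _)]
            exact ENNReal.mul_lt_top (ENNReal.rpow_lt_top_of_nonneg (by norm_num)
              (ENNReal.mul_ne_top (by simp) ENNReal.ofReal_ne_top)) hEhalf
    · rw [← hueq χ s t hs hst ht]
      refine (((hac χ).mono ?_).integral_deriv_eq_sub).symm
      rw [uIcc_of_le hst, uIcc_of_le hT.le]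
      exact Icc_subset_Icc hs ht
  refine ⟨n, u, hn, hn0, hni, hnm, hnd, hsol, ?_⟩
  have hlow := sq_metricDeriv_le_energy he hT hsol hEhalf hnd
  have hdiv : ∀ t, ENNReal.ofReal (n t ^ 2 / (n t + 1))
      = ENNReal.ofReal (n t) ^ 2 / ENNReal.ofReal (n t + 1) := fun t => by
    rw [ENNReal.ofReal_div_of_pos (by linarith [hn0 t]), ENNReal.ofReal_pow (hn0 t)]
  -- The energy is at least `n²` almost everywhere, while the integrals weighted by `1 / (n + 1)`
  -- satisfy the opposite inequality and are finite. Hence equality.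
  have heq := ae_eq_of_ae_le_of_lintegral_le (μ := volume.restrict (Icc 0 T))
    (f := fun t => ENNReal.ofReal (n t ^ 2 / (n t + 1)))
    (g := fun t => energy e (g t) (fun p => u (t, p)) / ENNReal.ofReal (n t + 1))
    (hlow.mono fun t ht => by
      simp only [hdiv]
      exact ENNReal.div_le_div_right ht _)
    hfin1.ne (hEm.div (by fun_prop)).aemeasurable huE
  filter_upwards [heq] with t ht
  rw [hdiv] at ht
  have hmul := congrArg (· * ENNReal.ofReal (n t + 1)) ht
  simp only [ENNReal.div_mul_cancel (hρ0 t) ENNReal.ofReal_ne_top] at hmul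
  exact hmul.symm

/-! ### Uniqueness by strict convexity -/

section Slice

variable {e : ℝ} {x : ProbabilityMeasure ℝ} {w z : OffDiag → ℝ}

theorem fluxMass_midpoint_le (he : e < 1) (hw : Measurable w) :
    fluxMass e x (fun p => (w p + z p) / 2) ≤ fluxMass e x w + fluxMass e x z := by
  have := measurable_weight e
  rw [fluxMass, fluxMass, fluxMass, ← lintegral_add_left (by fun_prop)]
  refine lintegral_mono fun p => ?_
  have hp := weight_nonneg he p
  rw [← ENNReal.ofReal_add (by positivity) (by positivity)]
  refine ENNReal.ofReal_le_ofReal ?_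
  rw [← mul_add, abs_div, abs_two]
  gcongr
  linarith [abs_add_le (w p) (z p), abs_nonneg (w p), abs_nonneg (z p)]

theorem fluxPair_midpoint (he : e < 1) (hw : Measurable w) (hz : Measurable z)
    (hw' : fluxMass e x w < ⊤) (hz' : fluxMass e x z < ⊤) {ψ : ℝ → ℝ} {C : ℝ}
    (hC : ∀ v, |deriv ψ v| ≤ C) :
    fluxPair e x (fun p => (w p + z p) / 2) ψ = (fluxPair e x w ψ + fluxPair e x z ψ) / 2 := by
  unfold fluxPair
  rw [← integral_add (integrable_fluxPair he hw hw' hC) (integrable_fluxPair he hz hz' hC),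
    ← integral_div]
  congr with p
  ring

theorem energy_parallelogram (he : e < 1) (hw : Measurable w) (hz : Measurable z) :
    energy e x (fun p => (w p + z p) / 2) + energy e x (fun p => (w p - z p) / 2)
      = (energy e x w + energy e x z) / 2 := by
  have := measurable_weight e
  rw [energy, energy, energy, energy, ← lintegral_add_left (by fun_prop),
    ← lintegral_add_left (by fun_prop), div_eq_mul_inv, ← lintegral_mul_const _ (by fun_prop)]
  refine lintegral_congr fun p => ?_
  have hp := weight_nonneg he p
  rw [← ENNReal.ofReal_add (by positivity) (by positivity),
    ← ENNReal.ofReal_add (by positivity) (by positivity), ← ENNReal.ofReal_ofNat (n := 2),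
    ← ENNReal.ofReal_inv_of_pos two_pos, ← ENNReal.ofReal_mul (by positivity)]
  congr 1
  ring

theorem ae_eq_of_energy_sub_eq_zero (he : e < 1) (hw : Measurable w) (hz : Measurable z)
    (h : energy e x (fun p => (w p - z p) / 2) = 0) : w =ᵐ[prodOff x] z := by
  have := measurable_weight e
  rw [energy, lintegral_eq_zero_iff (by fun_prop)] at h
  filter_upwards [h] with p hp
  have hp' : weight e p * ((w p - z p) / 2) ^ 2 ≤ 0 := ENNReal.ofReal_eq_zero.1 hp
  have h0 : ((w p - z p) / 2) ^ 2 = 0 :=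
    le_antisymm (nonpos_of_mul_nonpos_right hp' (weight_pos he p)) (sq_nonneg _)
  have := pow_eq_zero_iff two_ne_zero |>.1 h0
  linarith

end Slice

/-- For a fixed curve the continuity equation is linear in the flux. -/
theorem IsDensitySolution.midpoint {e a b : ℝ} {f : ℝ → ProbabilityMeasure ℝ}
    {u v : ℝ × OffDiag → ℝ} (he : e < 1) (hu : IsDensitySolution e a b f u)
    (hv : IsDensitySolution e a b f v) :
    IsDensitySolution e a b f fun q => (u q + v q) / 2 := by
  have hum : ∀ t, Measurable fun p => u (t, p) := fun t => hu.meas.comp measurable_prodMk_left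
  have hvm : ∀ t, Measurable fun p => v (t, p) := fun t => hv.meas.comp measurable_prodMk_left
  refine ⟨hu.cont, (hu.meas.add hv.meas).div_const 2, ?_, ?_, fun ψ hψ hc s t hs hst ht => ?_⟩
  · filter_upwards [hu.fin, hv.fin] with t h1 h2
    exact (h1.add h2).div_const 2
  · refine (lintegral_mono fun t => fluxMass_midpoint_le he (hum t)).trans_lt ?_
    rw [lintegral_add_left (measurable_fluxMass e hu.cont hu.meas)]
    exact ENNReal.add_lt_top.2 ⟨hu.mass, hv.mass⟩
  · obtain ⟨C, hC⟩ := exists_deriv_bound hψ hc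
    have hsub : Ioc s t ⊆ Icc a b := fun r hr => ⟨hs.trans hr.1.le, hr.2.trans ht⟩
    have h1 := hu.eq ψ hψ hc s t hs hst ht
    have h2 := hv.eq ψ hψ hc s t hs hst ht
    rw [intervalIntegral.integral_of_le hst] at h1 h2 ⊢
    have h3 : ∫ r in Ioc s t, fluxPair e (f r) (fun p => (u (r, p) + v (r, p)) / 2) ψ
        = ∫ r in Ioc s t, (fluxPair e (f r) (fun p => u (r, p)) ψ
          + fluxPair e (f r) (fun p => v (r, p)) ψ) / 2 := by
      refine integral_congr_ae ?_
      filter_upwards [ae_restrict_of_ae_restrict_of_subset hsub hu.ae_mass_lt_top,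
        ae_restrict_of_ae_restrict_of_subset hsub hv.ae_mass_lt_top] with r hr hr'
      exact fluxPair_midpoint he (hum r) (hvm r) hr hr' hC
    rw [h3, integral_div, integral_add ((hu.integrableOn_fluxPair he hC).mono_set hsub)
      ((hv.integrableOn_fluxPair he hC).mono_set hsub), ← h1, ← h2]
    ring

variable {e T : ℝ} {f : ℝ → ProbabilityMeasure ℝ}

theorem lintegral_sqrt_lt_top {F : ℝ → ℝ≥0∞} {n : ℝ → ℝ} (hn0 : ∀ t, 0 ≤ n t)
    (hn : IntegrableOn n (Icc 0 T))
    (h : ∀ᵐ t ∂(volume.restrict (Icc 0 T)), F t ≤ ENNReal.ofReal (n t) ^ 2) :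
    ∫⁻ t in Icc 0 T, F t ^ (1 / 2 : ℝ) < ⊤ := by
  refine (lintegral_mono_ae ?_).trans_lt ((hasFiniteIntegral_iff_ofReal (ae_of_all _ hn0)).1 hn.2)
  filter_upwards [h] with t ht
  refine (ENNReal.rpow_le_rpow ht (by norm_num)).trans_eq ?_
  rw [← ENNReal.rpow_natCast, ← ENNReal.rpow_mul]
  norm_num

/-- The flux whose action is the square of the metric derivative is unique. -/
theorem ae_eq_of_action_eq_metricDeriv (he : e < 1) (hT : 0 < T) {n : ℝ → ℝ}
    (hn0 : ∀ t, 0 ≤ n t) (hni : IntegrableOn n (Icc 0 T))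
    (hn : ∀ᵐ t ∂(volume.restrict (Icc 0 T)), HasMetricDeriv e f t (ENNReal.ofReal (n t)))
    {U V : ℝ → SignedMeasure OffDiag} (hU : GCE e T f U) (hV : GCE e T f V)
    (hUn : ∀ᵐ t ∂(volume.restrict (Icc 0 T)), action e (f t) (U t) = ENNReal.ofReal (n t) ^ 2)
    (hVn : ∀ᵐ t ∂(volume.restrict (Icc 0 T)), action e (f t) (V t) = ENNReal.ofReal (n t) ^ 2) :
    ∀ᵐ t ∂(volume.restrict (Icc 0 T)), U t = V t := by
  obtain ⟨u, hu, hu'⟩ := exists_density_of_GCE he hT hU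
    (lintegral_sqrt_lt_top hn0 hni (hUn.mono fun t ht => ht.le))
  obtain ⟨v, hv, hv'⟩ := exists_density_of_GCE he hT hV
    (lintegral_sqrt_lt_top hn0 hni (hVn.mono fun t ht => ht.le))
  have hum : ∀ t, Measurable fun p => u (t, p) := fun t => hu.meas.comp measurable_prodMk_left
  have hvm : ∀ t, Measurable fun p => v (t, p) := fun t => hv.meas.comp measurable_prodMk_left
  have hpar : ∀ᵐ t ∂(volume.restrict (Icc 0 T)), energy e (f t) (fun p => (u (t, p) + v (t, p)) / 2)
      + energy e (f t) (fun p => (u (t, p) - v (t, p)) / 2) = ENNReal.ofReal (n t) ^ 2 := by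
    filter_upwards [hu', hv', hUn, hVn] with t h1 h2 h3 h4
    rw [energy_parallelogram he (hum t) (hvm t), ← h1.2.2, ← h2.2.2, h3, h4, ENNReal.add_div,
      ENNReal.add_halves]
  have hcl : ∀ t ∈ Icc 0 T, f (projIcc 0 T hT.le t) = f t := fun t ht => by
    rw [projIcc_of_mem hT.le ht]
  -- The average is again a solution, so its energy is at least `n²`; the parallelogram identity
  -- then leaves no energy for the difference.
  have hmid := sq_metricDeriv_le_energy he hT (hu.midpoint he hv)
    (lintegral_sqrt_lt_top hn0 hni (by
      filter_upwards [hpar, ae_restrict_mem measurableSet_Icc] with t h1 h2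
      rw [hcl t h2, ← h1]
      exact le_self_add)) hn
  filter_upwards [hu', hv', hpar, hmid, ae_restrict_mem measurableSet_Icc] with t h1 h2 h3 h4 h5
  rw [hcl t h5] at h4
  rw [h1.2.1, h2.2.1]
  refine WithDensityᵥEq.congr_ae (ae_eq_of_energy_sub_eq_zero he (hum t) (hvm t) ?_)
  have hfin : energy e (f t) (fun p => (u (t, p) + v (t, p)) / 2) ≠ ⊤ :=
    ne_top_of_le_ne_top (ENNReal.pow_ne_top ENNReal.ofReal_ne_top) (h3 ▸ le_self_add)
  refine le_antisymm ?_ zero_le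
  rw [← ENNReal.add_le_add_iff_left hfin, h3, add_zero]
  exact h4

/-- Absolutely continuous curves of finite first moment solve the generalised continuity equation
with a flux whose action is the square of the metric derivative. -/
theorem IsACCurve.exists_optimal_GCE {m : ℝ → ℝ} (he₀ : 0 ≤ e) (he : e < 1) (hT : 0 < T)
    (h : IsACCurve e T f m) :
    ∃ (n : ℝ → ℝ) (V : ℝ → SignedMeasure OffDiag), (∀ t, 0 ≤ n t) ∧ IntegrableOn n (Icc 0 T) ∧
      (∀ᵐ t ∂(volume.restrict (Icc 0 T)), n t ≤ m t) ∧
      (∀ᵐ t ∂(volume.restrict (Icc 0 T)), HasMetricDeriv e f t (ENNReal.ofReal (n t))) ∧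
      GCE e T f V ∧ HasFluxDensity T f V ∧
      ∀ᵐ t ∂(volume.restrict (Icc 0 T)), action e (f t) (V t) = ENNReal.ofReal (n t) ^ 2 := by
  obtain ⟨n, u, -, hn0, hni, hnm, hnd, hu, huE⟩ := h.exists_optimal_flux he₀ he hT
  have hcl : ∀ t ∈ Icc 0 T, f (projIcc 0 T hT.le t) = f t := fun t ht => by
    rw [projIcc_of_mem hT.le ht]
  refine ⟨n, fun t => (prodOff (f t)).withDensityᵥ fun p => u (t, p), hn0, hni, hnm, hnd,
    (hu.gce he hT).congr (fun t ht => (hcl t ht).symm) (fun t ht => by simp only [hcl t ht]),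
    ⟨u, hu.meas, ?_⟩, ?_⟩
  · filter_upwards [hu.fin, ae_restrict_mem measurableSet_Icc] with t h1 h2
    rw [hcl t h2] at h1
    exact ⟨h1, rfl⟩
  · filter_upwards [hu.fin, huE, ae_restrict_mem measurableSet_Icc] with t h1 h2 h3
    rw [hcl t h3] at h1 h2
    rw [action_withDensityᵥ e (f t) h1 (hu.meas.comp measurable_prodMk_left), h2]

theorem lintegral_sq_lt_top {m n : ℝ → ℝ} (hm0 : ∀ t, 0 ≤ m t)
    (hm : MemLp m 2 (volume.restrict (Ioo 0 T)))
    (h : ∀ᵐ t ∂(volume.restrict (Icc 0 T)), n t ≤ m t) :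
    ∫⁻ t in Icc 0 T, ENNReal.ofReal (n t) ^ 2 < ⊤ := by
  have h2 := (hasFiniteIntegral_iff_ofReal (ae_of_all _ fun t => sq_nonneg (m t))).1
    hm.integrable_sq.2
  rw [restrict_Ioo_eq_restrict_Icc] at h2
  refine (lintegral_mono_ae ?_).trans_lt h2
  filter_upwards [h] with t ht
  rw [ENNReal.ofReal_pow (hm0 t)]
  gcongr

end Collision

end

/-! ### Assembly of the theorem -/

theorem mainTheorem6 (e : ℝ) (he₀ : 0 ≤ e) (he₁ : e < 1) (T : ℝ) (hT : 0 < T)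
    (f : ℝ → ProbabilityMeasure ℝ) :
    -- solutions of the GCE with integrable square root of the action, in all of `P(ℝ)`
    (∀ U : ℝ → SignedMeasure Collision.OffDiag, Collision.GCE e T f U →
      ∫⁻ t in Icc 0 T, Collision.action e (f t) (U t) ^ (1 / 2 : ℝ) < ⊤ →
        Collision.IsAC e 1 T f ∧
        (∫⁻ t in Icc 0 T, Collision.action e (f t) (U t) < ⊤ → Collision.IsAC e 2 T f) ∧
        Collision.HasFluxDensity T f U ∧
        ∀ᵐ t ∂(volume.restrict (Icc 0 T)), ∃ r : ℝ≥0∞,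
          Collision.HasMetricDeriv e f t r ∧ r ^ 2 ≤ Collision.action e (f t) (U t)) ∧
    -- curves of finite first moment that are narrowly continuous at the two end points
    ((∀ t ∈ Icc 0 T, Integrable (fun v : ℝ => v) (f t : Measure ℝ)) →
      ContinuousWithinAt f (Icc 0 T) 0 → ContinuousWithinAt f (Icc 0 T) T →
      (Collision.IsAC e 1 T f ↔
        ∃ U : ℝ → SignedMeasure Collision.OffDiag, Collision.GCE e T f U ∧
          ∫⁻ t in Icc 0 T, Collision.action e (f t) (U t) ^ (1 / 2 : ℝ) < ⊤) ∧
      (Collision.IsAC e 2 T f ↔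
        ∃ U : ℝ → SignedMeasure Collision.OffDiag, Collision.GCE e T f U ∧
          ∫⁻ t in Icc 0 T, Collision.action e (f t) (U t) < ⊤) ∧
      (Collision.IsAC e 1 T f →
        ∃ V : ℝ → SignedMeasure Collision.OffDiag,
          (Collision.GCE e T f V ∧
            Collision.HasFluxDensity T f V ∧
            ∫⁻ t in Icc 0 T, Collision.action e (f t) (V t) ^ (1 / 2 : ℝ) < ⊤ ∧
            ∀ᵐ t ∂(volume.restrict (Icc 0 T)), ∃ r : ℝ≥0∞,
              Collision.HasMetricDeriv e f t r ∧ r ^ 2 = Collision.action e (f t) (V t)) ∧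
          ∀ U : ℝ → SignedMeasure Collision.OffDiag, Collision.GCE e T f U →
            (∀ᵐ t ∂(volume.restrict (Icc 0 T)), ∃ r : ℝ≥0∞,
              Collision.HasMetricDeriv e f t r ∧ r ^ 2 = Collision.action e (f t) (U t)) →
            ∀ᵐ t ∂(volume.restrict (Icc 0 T)), U t = V t)) := by
  refine ⟨fun U hU hA => Collision.isAC_and_metricDeriv_of_GCE he₁ hT hU hA, fun hmom h0 h1 => ?_⟩
  have hcurve : ∀ m : ℝ → ℝ, (∀ t, 0 ≤ m t) → MemLp m 1 (volume.restrict (Ioo 0 T)) →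
      (∀ s t : ℝ, 0 < s → s ≤ t → t < T →
        Collision.dA e (f s) (f t) ≤ ENNReal.ofReal (∫ r in s..t, m r)) →
      Collision.IsACCurve e T f m := fun m hm0 hm hd =>
    ⟨hm0, memLp_one_iff_integrable.1 hm, hd, fun t ht => Collision.moment_lt_top (hmom t ht), h0,
      h1⟩
  refine ⟨⟨?_, ?_⟩, ⟨?_, ?_⟩, ?_⟩
  · rintro ⟨m, hm0, hm, hd⟩
    obtain ⟨n, V, hn0, hni, -, -, hV, -, hVn⟩ :=
      (hcurve m hm0 hm hd).exists_optimal_GCE he₀ he₁ hT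
    exact ⟨V, hV, Collision.lintegral_sqrt_lt_top hn0 hni (hVn.mono fun t ht => ht.le)⟩
  · rintro ⟨U, hU, hA⟩
    exact (Collision.isAC_and_metricDeriv_of_GCE he₁ hT hU hA).1
  · rintro ⟨m, hm0, hm, hd⟩
    -- On a bounded interval a square integrable bound is integrable, so the optimal flux exists;
    -- its action is `n²`, and `n ≤ m` gives the finite total.
    obtain ⟨n, V, -, -, hnm, -, hV, -, hVn⟩ :=
      (hcurve m hm0 (hm.mono_exponent one_le_two) hd).exists_optimal_GCE he₀ he₁ hT
    refine ⟨V, hV, ?_⟩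
    rw [lintegral_congr_ae hVn]
    exact Collision.lintegral_sq_lt_top hm0 hm hnm
  · rintro ⟨U, hU, hA⟩
    exact (Collision.isAC_and_metricDeriv_of_GCE he₁ hT hU
      (Collision.lintegral_rpow_half_le _ hA)).2.1 hA
  · rintro ⟨m, hm0, hm, hd⟩
    obtain ⟨n, V, hn0, hni, -, hnd, hV, hVd, hVn⟩ :=
      (hcurve m hm0 hm hd).exists_optimal_GCE he₀ he₁ hT
    refine ⟨V, ⟨hV, hVd,
      Collision.lintegral_sqrt_lt_top hn0 hni (hVn.mono fun t ht => ht.le), ?_⟩, fun U hU hr => ?_⟩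
    · filter_upwards [hnd, hVn] with t h2 h3
      exact ⟨_, h2, h3.symm⟩
    · refine Collision.ae_eq_of_action_eq_metricDeriv he₁ hT hn0 hni hnd hU hV ?_ hVn
      -- Limits are unique, so the value `r` is the metric derivative `n`. Integrability of the
      -- square root of the action of `U` follows from this.
      filter_upwards [hr, hnd] with t ⟨r, h2, h3⟩ h4
      rw [h4.unique h2, h3]
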